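/- **Setting.** Let $L>0$, $I=(0,L)$, let $\eta\ge 1$ be an integer, and put $\phi(s)=2\pi\eta s/L$. Let $W^{1,p}_{\rm per}(I)$ be the set of continuous $L$-periodic $u:\mathbb R\to\mathbb R$ with $u\in W^{1,p}(I)$, and $W^{2,p}_{\rm per}(I)$ the set of $u\in W^{2,p}(I)$ such that $u$ and $\partial_s u$ are continuous and $L$-periodic. For $u\in W^{1,p}_{\rm per}(I)$ and $\theta=u+\phi$ let $$A_T(\theta)=\begin{pmatrix}\int_I\sin^2\theta\,ds&-\int_I\sin\theta\cos\theta\,ds\\-\int_I\sin\theta\cos\theta\,ds&\int_I\cos^2\theta\,ds\end{pmatrix},$$ $$\tilde\lambda_1(u)=\frac{1}{\det A_T(\theta)}\Big[\int_I|\partial_s\theta|^p\cos\theta\,ds\int_I\cos^2\theta\,ds+\int_I|\partial_s\theta|^p\sin\theta\,ds\int_I\sin\theta\cos\theta\,ds\Big],$$ $$\tilde\lambda_2(u)=\frac{1}{\det A_T(\theta)}\Big[\int_I|\partial_s\theta|^p\cos\theta\,ds\int_I\cos\theta\sin\theta\,ds+\int_I|\partial_s\theta|^p\sin\theta\,ds\int_I\sin^2\theta\,ds\Big].$$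 A *weak solution* of (P) on $[0,T)$ with initial datum $u_0\in W^{1,p}_{\rm per}(I)$ and Lagrange multipliers $\lambda_1,\lambda_2\in L^2(0,T)$ is a function $u\in L^\infty(0,T;W^{1,p}_{\rm per}(I))\cap H^1(0,T;L^2(I))$ (taken continuous in time with values in $L^2(I)$) such that $$\int_0^T\!\!\int_I\Big[\{\partial_tu-\lambda_1\sin(u+\phi)+\lambda_2\cos(u+\phi)\}\varphi+|\partial_s(u+\phi)|^{p-2}\partial_s(u+\phi)\,\partial_s\varphi\Big]ds\,dt=0$$ for all $\varphi\in L^\infty(0,T;W^{1,p}_{\rm per}(I))$, such that $\int_I\cos(u(\cdot,t)+\phi)\,ds=\int_I\sin(u(\cdot,t)+\phi)\,ds=0$ for all $t\in[0,T)$, and $u(\cdot,0)=u_0$. For a datum $u_0$ put $c_*(u_0)=2\|\partial_s(u_0+\phi)\|_{L^p(I)}^p$ and $c_1(u_0)=8Lc_*\big(\tfrac4{L^2}+(\tfrac{8c_*}{\pi})^{2p/(p-1)}\big)$. For $\tilde C>0$ say that $u_0\in W^{2,2}_{\rm per}(I)$ satisfies (SC) with threshold $\tilde C$ if $$c_*(u_0)\le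 4\|\partial_s\phi\|_{L^p(I)}^p,\qquad \|V_0\|_{L^2(I)}^2\le\min\{\tfrac12,\tilde C\},\qquad |\partial_s(u_0+\phi)|^{p-1}\ge\tfrac12|\partial_s\phi|^{p-1}\ \text{a.e. on } I,$$ where $V_0=\partial_s\big(|\partial_s(u_0+\phi)|^{p-2}\partial_s(u_0+\phi)\big)+\tilde\lambda_1(u_0)\sin(u_0+\phi)-\tilde\lambda_2(u_0)\cos(u_0+\phi)$, the weak derivative in $V_0$ being assumed to exist in $L^2(I)$. **Claim.** (i) Let $p=2$. For all $T>0$ and $M$ there is a constant $C(T)>0$, depending only on $L,\eta,T,M$, such that (E) and (U) below hold for all $u_0^u,u_0^w\in W^{1,2}_{\rm per}(I)$ with $c_*(u_0^u),c_*(u_0^w)\le M$ and all weak solutions $u,w$ of (P) on $[0,T)$ with initial data $u_0^u$, $u_0^w$ and Lagrange multipliers $\lambda_j^u$, $\lambda_j^w$ respectively. (ii) Let $p>2$. There is $\tilde C>0$, depending only on $p,L,\eta$, such that for every $T>0$ there is a constant $C(T)>0$, depending only on $p,L,\eta,T$, such that (E) and (U) hold for all $u_0^u,u_0^w\in W^{2,2}_{\rm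 per}(I)$ that both satisfy (SC) with threshold $\tilde C$ and for which $T\le \frac{c_*}{8pLc_1^2}$ (with $c_*,c_1$ of $u_0^u$ and of $u_0^w$), and all weak solutions $u,w$ of (P) on $[0,T)$ with initial data $u_0^u$, $u_0^w$ and Lagrange multipliers $\lambda_j^u$, $\lambda_j^w$ respectively. (E) For $j=1,2$, $$\int_0^T|\lambda_j^u-\lambda_j^w|^2\,dt\le C(T)\|u_0^u-u_0^w\|_{L^2(I)}^2,$$ $$\sup_{\tau\in(0,T)}\|(u-w)(\tau)\|_{L^2(I)}^2+\int_0^T\|\partial_s(u-w)\|_{L^2(I)}^2\,dt\le C(T)\|u_0^u-u_0^w\|_{L^2(I)}^2.$$ (U) If $u_0^u=u_0^w$, then $u=w$ on $I\times[0,T)$ and $\lambda_j^u=\lambda_j^w$ a.e. on $(0,T)$ for $j=1,2$. -/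

import Mathlib

open MeasureTheory Set Filter Topology
open scoped ContDiff

namespace PElastic

noncomputable section

/-- `g` is the weak derivative of `f` on the open interval `(a, b)`. -/
def HasWeakDeriv (a b : ℝ) (f g : ℝ → ℝ) : Prop :=
  LocallyIntegrableOn f (Ioo a b) ∧ LocallyIntegrableOn g (Ioo a b) ∧
    ∀ ψ : ℝ → ℝ, ContDiff ℝ ∞ ψ → HasCompactSupport ψ → tsupport ψ ⊆ Ioo a b →
      ∫ s in a..b, f s * deriv ψ s = -∫ s in a..b, g s * ψ s

/-- `f` belongs to `W^{1,p}_per(I)`, `I = (0, L)`, with weak derivative `df`. -/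
structure MemW1Per (p L : ℝ) (f df : ℝ → ℝ) : Prop where
  continuous : Continuous f
  periodic : Function.Periodic f L
  memLp : MemLp f (ENNReal.ofReal p) (volume.restrict (Ioo 0 L))
  memLp_deriv : MemLp df (ENNReal.ofReal p) (volume.restrict (Ioo 0 L))
  hasWeakDeriv : HasWeakDeriv 0 L f df

/-- `f` belongs to `W^{2,q}_per(I)`: both `f` and its derivative `df` are continuous and
`L`-periodic, and `f` has weak derivatives `df`, `ddf` in `L^q(I)`. -/
def MemW2Per (q L : ℝ) (f df ddf : ℝ → ℝ) : Prop :=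
  MemW1Per q L f df ∧ MemW1Per q L df ddf

/-- Lebesgue measure on the space-time cylinder, in the variables `(t, s) ∈ (0, T) × (0, L)`. -/
def cylinder (T L : ℝ) : Measure (ℝ × ℝ) :=
  (volume : Measure (ℝ × ℝ)).restrict (Ioo 0 T ×ˢ Ioo 0 L)

/-- `v ∈ L^∞(0, T; W^{1,p}_per(I))` with spatial weak derivative `dv`
(first argument time, second argument space). -/
structure MemLinftyW1Per (p L T : ℝ) (v dv : ℝ → ℝ → ℝ) : Prop where
  aestronglyMeasurable : AEStronglyMeasurable (fun z : ℝ × ℝ => v z.1 z.2) (cylinder T L)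
  aestronglyMeasurable_deriv : AEStronglyMeasurable (fun z : ℝ × ℝ => dv z.1 z.2) (cylinder T L)
  memW1Per : ∀ᵐ t ∂(volume.restrict (Ioo 0 T)), MemW1Per p L (v t) (dv t)
  bounded : ∃ K : NNReal, ∀ᵐ t ∂(volume.restrict (Ioo 0 T)),
    eLpNorm (v t) (ENNReal.ofReal p) (volume.restrict (Ioo 0 L)) ≤ K ∧
    eLpNorm (dv t) (ENNReal.ofReal p) (volume.restrict (Ioo 0 L)) ≤ K

/-- `v ∈ H^1(0, T; L^2(I))` with weak time derivative `vt`: the identity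
`∫ v ψ' dt = -∫ vt ψ dt` holds in `L^2(I)` for all `ψ ∈ C_c^∞(0, T)`. -/
structure MemH1L2 (L T : ℝ) (v vt : ℝ → ℝ → ℝ) : Prop where
  memLp : MemLp (fun z : ℝ × ℝ => v z.1 z.2) 2 (cylinder T L)
  memLp_deriv : MemLp (fun z : ℝ × ℝ => vt z.1 z.2) 2 (cylinder T L)
  weakDeriv : ∀ ψ : ℝ → ℝ, ContDiff ℝ ∞ ψ → HasCompactSupport ψ → tsupport ψ ⊆ Ioo 0 T →
    ∀ᵐ s ∂(volume.restrict (Ioo 0 L)),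
      ∫ t in (0 : ℝ)..T, v t s * deriv ψ t = -∫ t in (0 : ℝ)..T, vt t s * ψ t

/-- `φ(s) = 2πηs / L`. -/
def phi (L : ℝ) (η : ℕ) (s : ℝ) : ℝ := 2 * Real.pi * η * s / L

/-- The constant derivative `∂ₛφ = 2πη / L`. -/
def dphi (L : ℝ) (η : ℕ) : ℝ := 2 * Real.pi * η / L

/-- `x ↦ |x|^{p-2} x`. -/
def pFlux (p x : ℝ) : ℝ := |x| ^ (p - 2) * x

/-- The matrix `A_T(θ)`. -/
def matAT (L : ℝ) (θ : ℝ → ℝ) : Matrix (Fin 2) (Fin 2) ℝ :=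
  !![∫ s in (0 : ℝ)..L, Real.sin (θ s) ^ 2,
     -∫ s in (0 : ℝ)..L, Real.sin (θ s) * Real.cos (θ s);
     -∫ s in (0 : ℝ)..L, Real.sin (θ s) * Real.cos (θ s),
     ∫ s in (0 : ℝ)..L, Real.cos (θ s) ^ 2]

/-- `λ̃₁`, as a function of `θ = u + φ` and `dθ = ∂ₛθ`. -/
def lamTilde₁ (p L : ℝ) (θ dθ : ℝ → ℝ) : ℝ :=
  1 / (matAT L θ).det *
    ((∫ s in (0 : ℝ)..L, |dθ s| ^ p * Real.cos (θ s)) * (∫ s in (0 : ℝ)..L, Real.cos (θ s) ^ 2) +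
     (∫ s in (0 : ℝ)..L, |dθ s| ^ p * Real.sin (θ s)) *
       (∫ s in (0 : ℝ)..L, Real.sin (θ s) * Real.cos (θ s)))

/-- `λ̃₂`, as a function of `θ = u + φ` and `dθ = ∂ₛθ`. -/
def lamTilde₂ (p L : ℝ) (θ dθ : ℝ → ℝ) : ℝ :=
  1 / (matAT L θ).det *
    ((∫ s in (0 : ℝ)..L, |dθ s| ^ p * Real.cos (θ s)) *
       (∫ s in (0 : ℝ)..L, Real.cos (θ s) * Real.sin (θ s)) +
     (∫ s in (0 : ℝ)..L, |dθ s| ^ p * Real.sin (θ s)) * (∫ s in (0 : ℝ)..L, Real.sin (θ s) ^ 2))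

/-- `c_* = 2 ‖∂ₛ(u₀ + φ)‖_{L^p(I)}^p`, where `du₀ = ∂ₛu₀`. -/
def cStar (p L : ℝ) (η : ℕ) (du₀ : ℝ → ℝ) : ℝ :=
  2 * ∫ s in (0 : ℝ)..L, |du₀ s + dphi L η| ^ p

/-- `c₁ = 8 L c_* (4 / L² + (8 c_* / π)^{2p/(p-1)})`. -/
def cOne (p L : ℝ) (η : ℕ) (du₀ : ℝ → ℝ) : ℝ :=
  8 * L * cStar p L η du₀ *
    (4 / L ^ 2 + (8 * cStar p L η du₀ / Real.pi) ^ (2 * p / (p - 1)))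

/-- The upper bound `c_* / (8 p L c₁²)` for the existence time attached to the datum `u₀`. -/
def maxTime (p L : ℝ) (η : ℕ) (du₀ : ℝ → ℝ) : ℝ :=
  cStar p L η du₀ / (8 * p * L * cOne p L η du₀ ^ 2)

/-- The initial velocity
`V₀ = ∂ₛ(|∂ₛ(u₀+φ)|^{p-2} ∂ₛ(u₀+φ)) + λ̃₁(u₀) sin(u₀+φ) - λ̃₂(u₀) cos(u₀+φ)`,
where `du₀ = ∂ₛu₀` and `G` is the weak derivative of the flux. -/
def initialVelocity (p L : ℝ) (η : ℕ) (u₀ du₀ G : ℝ → ℝ) (s : ℝ) : ℝ :=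
  G s
    + lamTilde₁ p L (fun x => u₀ x + phi L η x) (fun x => du₀ x + dphi L η) *
        Real.sin (u₀ s + phi L η s)
    - lamTilde₂ p L (fun x => u₀ x + phi L η x) (fun x => du₀ x + dphi L η) *
        Real.cos (u₀ s + phi L η s)

/-- The smallness condition on a datum `u₀` with derivative `du₀`, with threshold `κ`
for the initial velocity. -/
structure SmallDatum (p L : ℝ) (η : ℕ) (κ : ℝ) (u₀ du₀ : ℝ → ℝ) : Prop where
  energy : cStar p L η du₀ ≤ 4 * ∫ _ in (0 : ℝ)..L, |dphi L η| ^ p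
  velocity : ∃ G : ℝ → ℝ,
    HasWeakDeriv 0 L (fun s => pFlux p (du₀ s + dphi L η)) G ∧
    MemLp G 2 (volume.restrict (Ioo 0 L)) ∧
    ∫ s in (0 : ℝ)..L, initialVelocity p L η u₀ du₀ G s ^ 2 ≤ min (1 / 2) κ
  nondegenerate : ∀ᵐ s ∂(volume.restrict (Ioo 0 L)),
    1 / 2 * |dphi L η| ^ (p - 1) ≤ |du₀ s + dphi L η| ^ (p - 1)

/-- A weak solution `u` of the flow on `[0, T)` with initial datum `u₀`, together with its weak
derivatives `ut = ∂ₜu`, `us = ∂ₛu` and its Lagrange multipliers. As usual for functions in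
`H^1(0, T; L^2(I))`, `u` is the representative that is continuous in time with values in
`L^2(I)`; each `u t` is the continuous periodic representative. -/
structure WeakSolution (p L : ℝ) (η : ℕ) (T : ℝ) (u₀ : ℝ → ℝ) where
  u : ℝ → ℝ → ℝ
  ut : ℝ → ℝ → ℝ
  us : ℝ → ℝ → ℝ
  lam₁ : ℝ → ℝ
  lam₂ : ℝ → ℝ
  memLinftyW1Per : MemLinftyW1Per p L T u us
  memH1L2 : MemH1L2 L T u ut
  memW1Per : ∀ t ∈ Ico 0 T, ∃ du : ℝ → ℝ, MemW1Per p L (u t) du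
  continuous_time : ∀ t₀ ∈ Ico 0 T,
    Tendsto (fun t => ∫ s in (0 : ℝ)..L, (u t s - u t₀ s) ^ 2) (𝓝[Ico 0 T] t₀) (𝓝 0)
  memLp_lam₁ : MemLp lam₁ 2 (volume.restrict (Ioo 0 T))
  memLp_lam₂ : MemLp lam₂ 2 (volume.restrict (Ioo 0 T))
  weakEquation : ∀ v dv : ℝ → ℝ → ℝ, MemLinftyW1Per p L T v dv →
    ∫ t in (0 : ℝ)..T, ∫ s in (0 : ℝ)..L,
      ((ut t s - lam₁ t * Real.sin (u t s + phi L η s)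
          + lam₂ t * Real.cos (u t s + phi L η s)) * v t s
        + pFlux p (us t s + dphi L η) * dv t s) = 0
  closed_cos : ∀ t ∈ Ico 0 T, ∫ s in (0 : ℝ)..L, Real.cos (u t s + phi L η s) = 0
  closed_sin : ∀ t ∈ Ico 0 T, ∫ s in (0 : ℝ)..L, Real.sin (u t s + phi L η s) = 0
  initial : ∀ s, u 0 s = u₀ s

/-- The stability estimates, with constant `C`, for two weak solutions. -/
structure StabilityEstimate {p L : ℝ} {η : ℕ} {T : ℝ} {u₀ w₀ : ℝ → ℝ} (C : ℝ)
    (U : WeakSolution p L η T u₀) (W : WeakSolution p L η T w₀) : Prop where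
  lam₁_le : ∫ t in (0 : ℝ)..T, (U.lam₁ t - W.lam₁ t) ^ 2 ≤
    C * ∫ s in (0 : ℝ)..L, (u₀ s - w₀ s) ^ 2
  lam₂_le : ∫ t in (0 : ℝ)..T, (U.lam₂ t - W.lam₂ t) ^ 2 ≤
    C * ∫ s in (0 : ℝ)..L, (u₀ s - w₀ s) ^ 2
  energy_le : ∀ τ ∈ Ioo 0 T,
    (∫ s in (0 : ℝ)..L, (U.u τ s - W.u τ s) ^ 2)
      + (∫ t in (0 : ℝ)..T, ∫ s in (0 : ℝ)..L, (U.us t s - W.us t s) ^ 2) ≤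
    C * ∫ s in (0 : ℝ)..L, (u₀ s - w₀ s) ^ 2

/-- The two weak solutions and their Lagrange multipliers coincide. -/
structure Coincide {p L : ℝ} {η : ℕ} {T : ℝ} {u₀ w₀ : ℝ → ℝ}
    (U : WeakSolution p L η T u₀) (W : WeakSolution p L η T w₀) : Prop where
  u_eq : ∀ t ∈ Ico 0 T, ∀ s, U.u t s = W.u t s
  lam₁_eq : ∀ᵐ t ∂(volume.restrict (Ioo 0 T)), U.lam₁ t = W.lam₁ t
  lam₂_eq : ∀ᵐ t ∂(volume.restrict (Ioo 0 T)), U.lam₂ t = W.lam₂ t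

end

end PElastic

open MeasureTheory Set Filter Topology
open scoped ContDiff

namespace PElastic

/-! ### Pointwise inequalities for the `p`-flux -/

/-! Write `θ = u + φ`. Two facts about closed curves carry the proof.

The first is a cancellation. If the integrals of `cos` agree along `θ` and `ϑ`, the first-order
Taylor term drops out, so the pairing of `sin θ` with `θ - ϑ` is bounded by the squared `L²`
distance of the angles, and likewise with `sin` and `cos` exchanged (`abs_integral_sin_mul_le`,
`abs_integral_cos_mul_le`). Hence, when the equations of two solutions are subtracted and tested
with their difference, the multiplier terms are quadratic in that difference. It suffices that the
multipliers are bounded; they need not be compared. Gronwall's inequality then controls the `L²`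
distance and the total dissipation.

The second is coercivity of `A_T(θ)`. Because `θ` winds `η ≥ 1` times, the quadratic form of the
matrix is bounded below in terms of the energy (`coercive_trig`). Differentiating the closing
conditions in time and testing the equation with `sin θ` and `cos θ` gives a linear system with this
matrix for the multipliers (`ae_system`). The system bounds the multipliers by the energy, and the
difference of two systems bounds the difference of multipliers by the dissipation and the `H¹`
distance (`sq_sub_multipliers_le`). The energy itself stays below its initial value by convexity and
an averaging argument that needs no time derivative of the energy (`ae_energy_le`).

Everything then follows once the dissipation controls the `L²` distance of the space derivatives
(`stabilityEstimate_of_le_dissipation`). For `p = 2` the two are equal. For `p > 2` one needs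
`|∂ₛθ|` bounded away from zero. Comparing a solution with its own time translates, and with its
datum viewed as a stationary solution with force `V₀`, shows that `∂ₜu` and the dissipation relative
to the datum are small with `V₀`. The flux is Hölder continuous in space, since its derivative is
the lower-order part of the equation; if it became small at one point it would be small on an
interval of fixed length, which would cost a fixed amount of dissipation. Small `V₀` excludes this
(`ae_le_rpow_of_dissipation_lt`). -/

lemma pFlux_mul_self {p : ℝ} (hp : 2 ≤ p) (x : ℝ) : pFlux p x * x = |x| ^ p := by
  unfold pFlux
  rcases eq_or_ne x 0 with rfl | hx
  · simp [Real.zero_rpow (show p ≠ 0 by linarith)]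
  · have h : (0 : ℝ) < |x| := abs_pos.2 hx
    rw [mul_assoc, ← sq, ← sq_abs, ← Real.rpow_natCast, ← Real.rpow_add h]
    norm_num

lemma abs_pFlux {p : ℝ} (hp : 2 ≤ p) (x : ℝ) : |pFlux p x| = |x| ^ (p - 1) := by
  unfold pFlux
  rcases eq_or_ne x 0 with rfl | hx
  · simp [Real.zero_rpow (show p - 1 ≠ 0 by linarith)]
  · have h : (0 : ℝ) < |x| := abs_pos.2 hx
    rw [abs_mul, abs_of_nonneg (Real.rpow_nonneg h.le _)]
    nth_rewrite 2 [← Real.rpow_one |x|]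
    rw [← Real.rpow_add h]
    ring_nf

lemma continuous_pFlux {p : ℝ} (hp : 2 ≤ p) : Continuous (pFlux p) := by
  unfold pFlux
  exact (continuous_abs.rpow_const fun x => Or.inr (by linarith)).mul continuous_id

lemma p_mul_pFlux_mul_le {p : ℝ} (hp : 2 ≤ p) (a b : ℝ) :
    p * (pFlux p a * b) ≤ (p - 1) * |a| ^ p + |b| ^ p := by
  have hpq : (p / (p - 1)).HolderConjugate p := by
    have : p.HolderConjugate (p / (p - 1)) := Real.HolderConjugate.conjExponent (by linarith)
    exact this.symm
  have h := Real.young_inequality_of_nonneg (Real.rpow_nonneg (abs_nonneg a) (p - 1))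
    (abs_nonneg b) hpq
  rw [← Real.rpow_mul (abs_nonneg a), show (p - 1) * (p / (p - 1)) = p by
    field_simp [show p - 1 ≠ 0 by linarith]] at h
  have h2 : pFlux p a * b ≤ |a| ^ (p - 1) * |b| := by
    rw [← abs_pFlux hp, ← abs_mul]; exact le_abs_self _
  have h3 : p * (|a| ^ p / (p / (p - 1)) + |b| ^ p / p) = (p - 1) * |a| ^ p + |b| ^ p := by
    have : p ≠ 0 := by linarith
    have : p - 1 ≠ 0 := by linarith
    field_simp
  rw [← h3]
  exact mul_le_mul_of_nonneg_left (h2.trans h) (by linarith)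

lemma abs_pFlux_mul_le {p : ℝ} (hp : 2 ≤ p) (a b : ℝ) :
    |pFlux p a * b| ≤ |a| ^ p + |b| ^ p := by
  have key : ∀ c, |c| = |b| → pFlux p a * c ≤ |a| ^ p + |b| ^ p := by
    intro c hc
    have h := p_mul_pFlux_mul_le hp a c
    rw [hc] at h
    have h1 := Real.rpow_nonneg (abs_nonneg a) p
    have h2 := Real.rpow_nonneg (abs_nonneg b) p
    by_contra! hcon
    nlinarith
  rw [abs_le]
  constructor
  · have := key (-b) (abs_neg b); nlinarith
  · exact key b rfl

/-- Convexity of `|x| ^ p`: the graph lies above its tangent at `a`, whose slope is `p * pFlux p a`.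
This produces the energy inequality. -/
lemma rpow_abs_sub_le_pFlux {p : ℝ} (hp : 2 ≤ p) (a b : ℝ) :
    |a| ^ p - |b| ^ p ≤ p * (pFlux p a * (a - b)) := by
  have h := p_mul_pFlux_mul_le hp a b
  have h2 := pFlux_mul_self hp a
  rw [mul_sub, mul_sub, h2]
  linarith

/-- With `A = |a| ^ (p - 2)` and `B = |b| ^ (p - 2)`, the right side is exactly the left side plus
`(A - B) * (a ^ 2 - b ^ 2) / 2`, and this product is nonnegative because both factors increase with
the modulus. -/
lemma pFlux_monotone_bound {p : ℝ} (hp : 2 ≤ p) (a b : ℝ) :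
    1 / 2 * ((|a| ^ (p - 2) + |b| ^ (p - 2)) * (a - b) ^ 2) ≤
      (pFlux p a - pFlux p b) * (a - b) := by
  have key : 0 ≤ (|a| ^ (p - 2) - |b| ^ (p - 2)) * (|a| - |b|) := by
    rcases le_total |a| |b| with h | h
    · have := Real.rpow_le_rpow (abs_nonneg a) h (show 0 ≤ p - 2 by linarith)
      exact mul_nonneg_of_nonpos_of_nonpos (by linarith) (by linarith)
    · have := Real.rpow_le_rpow (abs_nonneg b) h (show 0 ≤ p - 2 by linarith)
      exact mul_nonneg (by linarith) (by linarith)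
  have key2 : 0 ≤ (|a| ^ (p - 2) - |b| ^ (p - 2)) * (a ^ 2 - b ^ 2) := by
    rw [← sq_abs a, ← sq_abs b]
    nlinarith [mul_nonneg key (add_nonneg (abs_nonneg a) (abs_nonneg b))]
  unfold pFlux
  nlinarith

/-- Replacing the mixed products by products of moduli only lowers the right side. This bound serves
where only the moduli of the two fluxes are known. -/
lemma abs_rpow_diff_mul_le {p : ℝ} (hp : 2 ≤ p) (a b : ℝ) :
    (|a| ^ (p - 1) - |b| ^ (p - 1)) * (|a| - |b|) ≤ (pFlux p a - pFlux p b) * (a - b) := by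
  have h1 := pFlux_mul_self hp a
  have h2 := pFlux_mul_self hp b
  have h3 : pFlux p a * b ≤ |a| ^ (p - 1) * |b| := by
    rw [← abs_pFlux hp, ← abs_mul]; exact le_abs_self _
  have h4 : pFlux p b * a ≤ |b| ^ (p - 1) * |a| := by
    rw [← abs_pFlux hp, ← abs_mul]; exact le_abs_self _
  have h5 : ∀ x : ℝ, |x| ^ (p - 1) * |x| = |x| ^ p := fun x => by
    rw [← abs_pFlux hp, ← abs_mul, pFlux_mul_self hp, abs_of_nonneg (by positivity)]
  have := h5 a
  have := h5 b
  nlinarith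

lemma abs_rpow_abs_sub_le {p : ℝ} (hp : 2 ≤ p) (a b : ℝ) :
    |(|a| ^ p - |b| ^ p)| ≤ p * ((|a| ^ (p - 1) + |b| ^ (p - 1)) * |a - b|) := by
  have key : ∀ a b : ℝ, |a| ^ p - |b| ^ p ≤ p * ((|a| ^ (p - 1) + |b| ^ (p - 1)) * |a - b|) := by
    intro a b
    refine (rpow_abs_sub_le_pFlux hp a b).trans ?_
    refine mul_le_mul_of_nonneg_left ?_ (by linarith)
    have h1 : pFlux p a * (a - b) ≤ |a| ^ (p - 1) * |a - b| := by
      rw [← abs_pFlux hp, ← abs_mul]; exact le_abs_self _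
    have h2 : 0 ≤ |b| ^ (p - 1) * |a - b| := by positivity
    linarith
  rw [abs_le]
  constructor
  · have := key b a
    rw [abs_sub_comm b a, add_comm (|b| ^ (p - 1))] at this
    linarith
  · exact key a b

lemma abs_sin_sub_sin_le (x y : ℝ) : |Real.sin x - Real.sin y| ≤ |x - y| := by
  have h : LipschitzWith 1 Real.sin := by
    refine lipschitzWith_of_nnnorm_deriv_le Real.differentiable_sin fun x => ?_
    rw [Real.deriv_sin, ← NNReal.coe_le_coe, coe_nnnorm, Real.norm_eq_abs]
    exact Real.abs_cos_le_one x
  simpa [Real.dist_eq] using h.dist_le_mul x y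

lemma abs_cos_sub_cos_le (x y : ℝ) : |Real.cos x - Real.cos y| ≤ |x - y| := by
  rw [← Real.sin_pi_div_two_sub, ← Real.sin_pi_div_two_sub]
  refine (abs_sin_sub_sin_le _ _).trans (le_of_eq ?_)
  rw [abs_sub_comm]
  ring_nf

/-- The error in the first order expansion of `cos`. -/
lemma abs_sin_mul_add_cos_sub_le (x y : ℝ) :
    |Real.sin x * (x - y) + (Real.cos x - Real.cos y)| ≤ (x - y) ^ 2 := by
  -- The error is the integral of `sin x - sin t` over an interval of length `|x - y|` on which the
  -- integrand is at most `|x - y|`.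
  have h : ∫ t in x..y, (Real.sin x - Real.sin t) =
      -(Real.sin x * (x - y) + (Real.cos x - Real.cos y)) := by
    rw [intervalIntegral.integral_sub (by simp) (Real.continuous_sin.intervalIntegrable _ _),
      integral_sin, intervalIntegral.integral_const, smul_eq_mul]
    ring
  have h2 := intervalIntegral.norm_integral_le_of_norm_le_const (a := x) (b := y)
    (f := fun t => Real.sin x - Real.sin t) (C := |x - y|) fun t ht => by
      refine (abs_sin_sub_sin_le x t).trans ?_
      rcases le_total x y with hxy | hxy
      · rw [uIoc_of_le hxy] at ht
        rw [abs_sub_comm, abs_sub_comm x y, abs_of_nonneg (by linarith [ht.1]),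
          abs_of_nonneg (by linarith)]
        linarith [ht.2]
      · rw [uIoc_of_ge hxy] at ht
        rw [abs_of_nonneg (by linarith [ht.2]), abs_of_nonneg (by linarith)]
        linarith [ht.1]
  rw [h, norm_neg, Real.norm_eq_abs, abs_sub_comm y x, ← sq, sq_abs] at h2
  exact h2

/-- The error in the first order expansion of `sin`. -/
lemma abs_cos_mul_sub_sin_sub_le (x y : ℝ) :
    |Real.cos x * (x - y) - (Real.sin x - Real.sin y)| ≤ (x - y) ^ 2 := by
  have h := abs_sin_mul_add_cos_sub_le (x + Real.pi / 2) (y + Real.pi / 2)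
  rw [Real.sin_add_pi_div_two, Real.cos_add_pi_div_two, Real.cos_add_pi_div_two] at h
  convert h using 2 <;> ring

/-! ### Primitives of integrable functions -/

/-- On `[a, b]`, the function `f` is a primitive of the integrable function `g`. -/
structure IsPrimitive (a b : ℝ) (f g : ℝ → ℝ) : Prop where
  integrable : IntervalIntegrable g volume a b
  eq : ∀ x ∈ Icc a b, f x = f a + ∫ t in a..x, g t

namespace IsPrimitive

variable {a b c d : ℝ} {f g f₁ g₁ f₂ g₂ : ℝ → ℝ}

lemma integrable_sub (h : IsPrimitive a b f g) {x y : ℝ} (hx : x ∈ Icc a b) (hy : y ∈ Icc a b) :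
    IntervalIntegrable g volume x y := by
  refine h.integrable.mono_set ?_
  have hab : a ≤ b := hx.1.trans hx.2
  rw [uIcc_of_le hab]
  exact uIcc_subset_Icc hx hy

lemma integral_eq (h : IsPrimitive a b f g) {x y : ℝ} (hx : x ∈ Icc a b) (hy : y ∈ Icc a b) :
    ∫ t in x..y, g t = f y - f x := by
  have hab : a ≤ b := hx.1.trans hx.2
  have ha : a ∈ Icc a b := ⟨le_rfl, hab⟩
  rw [h.eq x hx, h.eq y hy, ← intervalIntegral.integral_add_adjacent_intervals
    (h.integrable_sub ha hx) (h.integrable_sub hx hy)]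
  ring

lemma mono (h : IsPrimitive a b f g) (hac : a ≤ c) (hcd : c ≤ d) (hdb : d ≤ b) :
    IsPrimitive c d f g where
  integrable := h.integrable_sub ⟨hac, hcd.trans hdb⟩ ⟨hac.trans hcd, hdb⟩
  eq x hx := by
    rw [h.integral_eq ⟨hac, hcd.trans hdb⟩ ⟨hac.trans hx.1, hx.2.trans hdb⟩]; ring

lemma congr (h : IsPrimitive a b f₁ g₁) (hf : ∀ x ∈ Icc a b, f₁ x = f₂ x)
    (hg : ∀ᵐ x ∂(volume.restrict (Ioo a b)), g₁ x = g₂ x) (hab : a ≤ b) :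
    IsPrimitive a b f₂ g₂ := by
  have hg' : ∀ᵐ x ∂volume, x ∈ Ioc a b → g₁ x = g₂ x := by
    rw [restrict_Ioo_eq_restrict_Ioc] at hg
    exact (ae_restrict_iff' measurableSet_Ioc).1 hg
  refine ⟨?_, fun x hx => ?_⟩
  · rw [intervalIntegrable_iff, uIoc_of_le hab]
    have := h.integrable
    rw [intervalIntegrable_iff, uIoc_of_le hab] at this
    exact this.congr ((ae_restrict_iff' measurableSet_Ioc).2 hg')
  · rw [← hf x hx, ← hf a ⟨le_rfl, hab⟩, h.eq x hx]
    congr 1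
    refine intervalIntegral.integral_congr_ae ?_
    filter_upwards [hg'] with y hy hy2
    rw [uIoc_of_le hx.1] at hy2
    exact hy ⟨hy2.1, hy2.2.trans hx.2⟩

/-- Nothing is known of `f` outside `[a, b]`, so absolute continuity and two-sided derivatives are
stated for the integral expression, which agrees with `f` on the interval. -/
lemma absolutelyContinuous (h : IsPrimitive a b f g) :
    AbsolutelyContinuousOnInterval (fun x => f a + ∫ t in a..x, g t) a b := by
  refine AbsolutelyContinuousOnInterval.add ?_
    (h.integrable.absolutelyContinuousOnInterval_intervalIntegral (by simp))
  exact (LipschitzWith.const (f a)).lipschitzOnWith.absolutelyContinuousOnInterval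

lemma continuousOn (h : IsPrimitive a b f g) (hab : a ≤ b) : ContinuousOn f (Icc a b) := by
  have := (h.absolutelyContinuous).continuousOn
  rw [uIcc_of_le hab] at this
  exact this.congr h.eq

lemma ae_hasDerivAt (h : IsPrimitive a b f g) (hab : a ≤ b) :
    ∀ᵐ x, x ∈ Icc a b → HasDerivAt (fun x => f a + ∫ t in a..x, g t) (g x) x := by
  filter_upwards [h.integrable.ae_hasDerivAt_integral] with x hx hxI
  rw [uIcc_of_le hab] at hx
  exact (hx hxI a ⟨le_rfl, hab⟩).const_add _

lemma of_absolutelyContinuous (hab : a ≤ b) (hf : AbsolutelyContinuousOnInterval f a b)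
    (hg : ∀ᵐ x, x ∈ Icc a b → HasDerivAt f (g x) x) : IsPrimitive a b f g := by
  have hae : ∀ᵐ x, x ∈ Icc a b → deriv f x = g x := by
    filter_upwards [hg] with x hx hxI using (hx hxI).deriv
  refine IsPrimitive.congr (f₁ := f) (g₁ := deriv f) ⟨hf.intervalIntegrable_deriv, fun x hx => ?_⟩
    (fun _ _ => rfl) ?_ hab
  · have := (hf.mono (c := a) (d := x) ?_).integral_deriv_eq_sub
    · rw [this]; ring
    · rw [uIcc_of_le hab, uIcc_of_le hx.1]; exact Icc_subset_Icc le_rfl hx.2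
  · refine (ae_restrict_iff' measurableSet_Ioo).2 ?_
    filter_upwards [hae] with x hx hxI using hx (Ioo_subset_Icc_self hxI)

lemma mul (h₁ : IsPrimitive a b f₁ g₁) (h₂ : IsPrimitive a b f₂ g₂) (hab : a ≤ b) :
    IsPrimitive a b (fun x => f₁ x * f₂ x) (fun x => g₁ x * f₂ x + f₁ x * g₂ x) := by
  have key := of_absolutelyContinuous hab
    ((h₁.absolutelyContinuous).fun_mul (h₂.absolutelyContinuous))
    (g := fun x => g₁ x * f₂ x + f₁ x * g₂ x) ?_
  · refine key.congr (fun x hx => ?_) (ae_of_all _ fun _ => rfl) hab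
    rw [← h₁.eq x hx, ← h₂.eq x hx]
  · filter_upwards [h₁.ae_hasDerivAt hab, h₂.ae_hasDerivAt hab] with x hx₁ hx₂ hx
    have := (hx₁ hx).mul (hx₂ hx)
    rw [← h₁.eq x hx, ← h₂.eq x hx] at this
    exact this

lemma comp {Φ Φ' : ℝ → ℝ} {K : NNReal} (h : IsPrimitive a b f g) (hab : a ≤ b)
    (hΦ : ∀ x, HasDerivAt Φ (Φ' x) x) (hK : LipschitzWith K Φ) :
    IsPrimitive a b (fun x => Φ (f x)) (fun x => Φ' (f x) * g x) := by
  have key := of_absolutelyContinuous hab (f := fun x => Φ (f a + ∫ t in a..x, g t))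
    (g := fun x => Φ' (f x) * g x) ?_ ?_
  · refine key.congr (fun x hx => ?_) (ae_of_all _ fun _ => rfl) hab
    rw [← h.eq x hx]
  · have hac := h.absolutelyContinuous
    -- Post-composition with `Φ` enlarges each sum of increments in the definition by at most the
    -- factor `K`.
    unfold AbsolutelyContinuousOnInterval at hac ⊢
    have hac' := hac.const_mul (K : ℝ)
    rw [mul_zero] at hac'
    refine squeeze_zero (fun _ => Finset.sum_nonneg fun _ _ => dist_nonneg) (fun E => ?_) hac'
    rw [Finset.mul_sum]
    exact Finset.sum_le_sum fun i _ => by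
      simpa using hK.dist_le_mul (f a + ∫ t in a..(E.2 i).1, g t) (f a + ∫ t in a..(E.2 i).2, g t)
  · filter_upwards [h.ae_hasDerivAt hab] with x hx hxI
    have := (hΦ (f a + ∫ t in a..x, g t)).comp x (hx hxI)
    rwa [← h.eq x hxI] at this

lemma add (h₁ : IsPrimitive a b f₁ g₁) (h₂ : IsPrimitive a b f₂ g₂) :
    IsPrimitive a b (fun x => f₁ x + f₂ x) (fun x => g₁ x + g₂ x) where
  integrable := h₁.integrable.add h₂.integrable
  eq x hx := by
    have ha : a ∈ Icc a b := ⟨le_rfl, hx.1.trans hx.2⟩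
    rw [intervalIntegral.integral_add (h₁.integrable_sub ha hx) (h₂.integrable_sub ha hx),
      h₁.eq x hx, h₂.eq x hx]
    ring

lemma const_mul (h : IsPrimitive a b f g) (k : ℝ) :
    IsPrimitive a b (fun x => k * f x) (fun x => k * g x) where
  integrable := h.integrable.const_mul k
  eq x hx := by
    rw [intervalIntegral.integral_const_mul, h.eq x hx]
    ring

lemma sub (h₁ : IsPrimitive a b f₁ g₁) (h₂ : IsPrimitive a b f₂ g₂) :
    IsPrimitive a b (fun x => f₁ x - f₂ x) (fun x => g₁ x - g₂ x) := by
  simpa [sub_eq_add_neg] using h₁.add (h₂.const_mul (-1))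

lemma of_hasDerivAt (hf : ∀ x, HasDerivAt f (g x) x) (hg : Continuous g) :
    IsPrimitive a b f g where
  integrable := hg.intervalIntegrable _ _
  eq x _ := by
    rw [intervalIntegral.integral_eq_sub_of_hasDerivAt (fun x _ => hf x)
      (hg.intervalIntegrable _ _)]
    ring

lemma of_hasDerivAt_Icc (hab : a ≤ b) (hf : ∀ x ∈ Icc a b, HasDerivAt f (g x) x)
    (hg : ContinuousOn g (Icc a b)) : IsPrimitive a b f g where
  integrable := by rw [← uIcc_of_le hab] at hg; exact hg.intervalIntegrable
  eq x hx := by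
    have hs : uIcc a x ⊆ Icc a b := by rw [uIcc_of_le hx.1]; exact Icc_subset_Icc_right hx.2
    rw [intervalIntegral.integral_eq_sub_of_hasDerivAt (fun y hy => hf y (hs hy))
      (hg.mono hs).intervalIntegrable]
    ring

end IsPrimitive

/-! ### Weak derivatives and primitives -/

/-- Zero mean is what makes the primitive vanish to the right of the support of `h` as well as to
the left: test functions of mean zero are derivatives of test functions. -/
lemma exists_smooth_primitive {a b : ℝ} {h : ℝ → ℝ} (hh : ContDiff ℝ ∞ h)
    (hc : HasCompactSupport h) (hs : tsupport h ⊆ Ioo a b) (h0 : ∫ t in a..b, h t = 0) :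
    ∃ ψ : ℝ → ℝ, ContDiff ℝ ∞ ψ ∧ HasCompactSupport ψ ∧ tsupport ψ ⊆ Ioo a b ∧ deriv ψ = h := by
  have hd : ∀ x, HasDerivAt (fun x => ∫ t in a..x, h t) (h x) x := fun x =>
    (hh.continuous.integral_hasStrictDerivAt a x).hasDerivAt
  have hderiv : deriv (fun x => ∫ t in a..x, h t) = h := funext fun x => (hd x).deriv
  rcases (tsupport h).eq_empty_or_nonempty with he | hne
  · have hz : h = 0 := tsupport_eq_empty_iff.1 he
    refine ⟨0, contDiff_const, HasCompactSupport.zero, ?_, ?_⟩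
    · simp [tsupport_eq_empty_iff.2 (rfl : (0 : ℝ → ℝ) = 0)]
    · rw [hz]; ext x; simp
  have hK : IsCompact (tsupport h) := hc
  obtain ⟨c, hcm⟩ := hK.exists_isLeast hne
  obtain ⟨d, hdm⟩ := hK.exists_isGreatest hne
  have hac := (hs hcm.1).1
  have hdb := (hs hdm.1).2
  have hz : ∀ x, x ∉ Icc c d → h x = 0 := fun x hx =>
    image_eq_zero_of_notMem_tsupport fun hx' => hx ⟨hcm.2 hx', hdm.2 hx'⟩
  have hsub : tsupport (fun x => ∫ t in a..x, h t) ⊆ Icc c d := by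
    refine closure_minimal (fun x hx => ?_) isClosed_Icc
    by_contra hcon
    refine hx ?_
    rw [mem_Icc, not_and_or, not_le, not_le] at hcon
    rcases hcon with hlt | hgt
    · refine (intervalIntegral.integral_congr fun t ht => ?_).trans intervalIntegral.integral_zero
      exact hz t fun htm => by
        have := (mem_uIcc.1 ht)
        rcases this with h1 | h1 <;> linarith [htm.1, h1.1, h1.2]
    · change ∫ t in a..x, h t = 0
      rw [← intervalIntegral.integral_add_adjacent_intervals (b := b)
        (hh.continuous.intervalIntegrable _ _) (hh.continuous.intervalIntegrable _ _), h0, zero_add]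
      refine (intervalIntegral.integral_congr fun t ht => ?_).trans intervalIntegral.integral_zero
      exact hz t fun htm => by
        have := (mem_uIcc.1 ht)
        rcases this with h1 | h1 <;> linarith [htm.2, h1.1, h1.2]
  refine ⟨fun x => ∫ t in a..x, h t, ?_, ?_, ?_, hderiv⟩
  · rw [contDiff_infty_iff_deriv, hderiv]
    exact ⟨fun x => (hd x).differentiableAt, hh⟩
  · exact isCompact_Icc.of_isClosed_subset (isClosed_tsupport _) hsub
  · exact hsub.trans (Icc_subset_Ioo hac hdb)

lemma eq_zero_of_tsupport_subset {a b x : ℝ} {ψ : ℝ → ℝ} (hs : tsupport ψ ⊆ Ioo a b)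
    (hx : x ∉ Ioo a b) : ψ x = 0 :=
  image_eq_zero_of_notMem_tsupport fun h => hx (hs h)

/-- The lemma of du Bois-Reymond. -/
lemma exists_ae_eq_const_of_integral_mul_deriv_eq_zero {a b : ℝ} (hab : a < b) {f : ℝ → ℝ}
    (hf : LocallyIntegrableOn f (Ioo a b))
    (h : ∀ ψ : ℝ → ℝ, ContDiff ℝ ∞ ψ → HasCompactSupport ψ → tsupport ψ ⊆ Ioo a b →
      ∫ s in a..b, f s * deriv ψ s = 0) :
    ∃ c, ∀ᵐ x ∂volume, x ∈ Ioo a b → f x = c := by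
  obtain ⟨ρ, hρ⟩ : ∃ ρ : ContDiffBump ((a + b) / 2), ρ.rOut = (b - a) / 4 :=
    ⟨⟨(b - a) / 8, (b - a) / 4, by linarith, by linarith⟩, rfl⟩
  set r : ℝ → ℝ := ρ.normed volume with hr
  have hrs : tsupport r ⊆ Ioo a b := by
    rw [hr, ρ.tsupport_normed_eq, hρ, Real.closedBall_eq_Icc]
    exact Icc_subset_Ioo (by linarith) (by linarith)
  have hrc : HasCompactSupport r := ρ.hasCompactSupport_normed
  have hrd : ContDiff ℝ ∞ r := ρ.contDiff_normed
  have toI : ∀ g : ℝ → ℝ, tsupport g ⊆ Ioo a b → ∫ s in a..b, g s = ∫ s, g s := by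
    intro g hg
    exact intervalIntegral.integral_eq_integral_of_support_subset
      ((subset_tsupport g).trans (hg.trans Ioo_subset_Ioc_self))
  have hr1 : ∫ s in a..b, r s = 1 := by rw [toI r hrs]; exact ρ.integral_normed
  set c := ∫ s in a..b, f s * r s with hcdef
  have intg : ∀ g : ℝ → ℝ, ContDiff ℝ ∞ g → HasCompactSupport g → tsupport g ⊆ Ioo a b →
      Integrable (fun x => g x • f x) := fun g hg hgc hgs =>
    by
    have hK : IntegrableOn f (tsupport g) := hf.integrableOn_compact_subset hgs hgc
    have h2 : IntegrableOn (fun x => g x • f x) (tsupport g) :=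
      hK.continuousOn_smul hg.continuous.continuousOn hgc
    refine h2.integrable_of_forall_notMem_eq_zero fun x hx => ?_
    simp [image_eq_zero_of_notMem_tsupport hx]
  refine ⟨c, ?_⟩
  have key := isOpen_Ioo.ae_eq_zero_of_integral_contDiff_smul_eq_zero
    (μ := volume) (f := fun x => f x - c) (U := Ioo a b) ?_ ?_
  · filter_upwards [key] with x hx hxI
    linarith [hx hxI]
  · exact hf.sub ((locallyIntegrable_const c).locallyIntegrableOn _)
  · intro g hg hgc hgs
    -- Subtracting `k * r`, with `r` a bump of integral one, gives `g` mean zero, so the hypothesis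
    -- applies. The constant `c` is the average of `f` against `r`.
    set k := ∫ s in a..b, g s with hk
    have hts : tsupport (fun x => g x - k * r x) ⊆ Ioo a b := by
      refine (tsupport_sub _ _).trans (union_subset hgs ?_)
      exact (tsupport_mul_subset_right).trans hrs
    have hcd : ContDiff ℝ ∞ (fun x => g x - k * r x) := hg.sub (contDiff_const.mul hrd)
    obtain ⟨ψ, hψ1, hψ2, hψ3, hψ4⟩ := exists_smooth_primitive hcd
      (hgc.sub hrc.mul_left) hts (by
        rw [intervalIntegral.integral_sub (hg.continuous.intervalIntegrable _ _)
          (hrd.continuous.intervalIntegrable _ _ |>.const_mul k),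
          intervalIntegral.integral_const_mul, hr1]
        simp [hk])
    have h1 := h ψ hψ1 hψ2 hψ3
    rw [hψ4] at h1
    have hgi := intg g hg hgc hgs
    have hri := intg r hrd hrc hrs
    have e1 : ∫ s in a..b, f s * (g s - k * r s) = (∫ s, g s • f s) - k * c := by
      have : ∀ s, f s * (g s - k * r s) = g s • f s - k * (r s • f s) := fun s => by
        simp only [smul_eq_mul]; ring
      simp_rw [this]
      rw [intervalIntegral.integral_sub hgi.intervalIntegrable
        (hri.const_mul k).intervalIntegrable, intervalIntegral.integral_const_mul, hcdef]
      congr 1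
      · refine toI _ ((closure_mono fun x hx => ?_).trans hgs)
        exact fun h0 => hx (by simp [h0])
      · congr 2; ext s; simp [mul_comm]
    have e2 : ∫ x, g x • (f x - c) = (∫ s, g s • f s) - k * c := by
      have : ∀ s, g s • (f s - c) = g s • f s - c * g s := fun s => by
        simp only [smul_eq_mul]; ring
      simp_rw [this]
      rw [integral_sub hgi ((hg.continuous.integrable_of_hasCompactSupport hgc).const_mul c),
        integral_const_mul, ← toI g hgs]
      ring
    rw [e2, ← e1, h1]

lemma isPrimitive_of_smooth {a b : ℝ} {ψ : ℝ → ℝ} (hψ : ContDiff ℝ ∞ ψ) :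
    IsPrimitive a b ψ (deriv ψ) :=
  IsPrimitive.of_hasDerivAt (fun x => (hψ.differentiable (by simp) x).hasDerivAt)
    (hψ.continuous_deriv (by simp))

lemma IsPrimitive.integral_mul_deriv_test {a b : ℝ} (hab : a ≤ b) {f g ψ : ℝ → ℝ}
    (h : IsPrimitive a b f g) (hψ : ContDiff ℝ ∞ ψ) (hψs : tsupport ψ ⊆ Ioo a b) :
    ∫ s in a..b, f s * deriv ψ s = -∫ s in a..b, g s * ψ s := by
  have hψp := isPrimitive_of_smooth (a := a) (b := b) hψ
  have hm := h.mul hψp hab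
  have h1 := hm.integral_eq ⟨le_rfl, hab⟩ ⟨hab, le_rfl⟩
  have ha : ψ a = 0 := eq_zero_of_tsupport_subset hψs (by simp)
  have hb : ψ b = 0 := eq_zero_of_tsupport_subset hψs (by simp)
  have hcf : ContinuousOn f (uIcc a b) := by rw [uIcc_of_le hab]; exact h.continuousOn hab
  rw [intervalIntegral.integral_add (h.integrable.mul_continuousOn hψ.continuous.continuousOn)
    ((hψp.integrable).continuousOn_mul hcf), ha, hb] at h1
  linarith

/-- The difference of `f` and the integral of `g` has zero weak derivative, hence is constant almost
everywhere; continuity upgrades this to every point of the closed interval. -/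
lemma HasWeakDeriv.isPrimitive {a b : ℝ} (hab : a < b) {f g : ℝ → ℝ} (h : HasWeakDeriv a b f g)
    (hf : ContinuousOn f (Icc a b)) (hg : IntervalIntegrable g volume a b) :
    IsPrimitive a b f g := by
  have hP : IsPrimitive a b (fun x => ∫ t in a..x, g t) g := ⟨hg, fun x _ => by simp⟩
  have hPc := hP.continuousOn hab.le
  have hfc : ContinuousOn (fun x => f x - ∫ t in a..x, g t) (Icc a b) := hf.sub hPc
  obtain ⟨c, hc⟩ := exists_ae_eq_const_of_integral_mul_deriv_eq_zero hab
    (f := fun x => f x - ∫ t in a..x, g t)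
    ((hfc.mono Ioo_subset_Icc_self).locallyIntegrableOn measurableSet_Ioo) fun ψ h1 h2 h3 => by
      have e := hP.integral_mul_deriv_test hab.le h1 h3
      have e2 := h.2.2 ψ h1 h2 h3
      simp_rw [sub_mul]
      have hd : ContinuousOn (deriv ψ) (uIcc a b) := (h1.continuous_deriv (by simp)).continuousOn
      rw [intervalIntegral.integral_sub, e, e2, sub_self]
      · rw [← uIcc_of_le hab.le] at hf
        exact (hf.mul hd).intervalIntegrable
      · rw [← uIcc_of_le hab.le] at hPc
        exact (hPc.mul hd).intervalIntegrable
  have heq : EqOn (fun x => f x - ∫ t in a..x, g t) (fun _ => c) (Ioo a b) := by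
    refine Measure.eqOn_open_of_ae_eq (μ := volume) ?_ isOpen_Ioo
      (hfc.mono Ioo_subset_Icc_self) continuousOn_const
    exact (ae_restrict_iff' measurableSet_Ioo).2 hc
  have heq2 : EqOn (fun x => f x - ∫ t in a..x, g t) (fun _ => c) (Icc a b) := by
    rw [← closure_Ioo hab.ne]
    refine heq.of_subset_closure ?_ continuousOn_const subset_closure subset_rfl
    rwa [closure_Ioo hab.ne]
  refine ⟨hg, fun x hx => ?_⟩
  have h1 := heq2 hx
  have h2 := heq2 (left_mem_Icc.2 hab.le)
  simp only [intervalIntegral.integral_same] at h1 h2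
  linarith

lemma IsPrimitive.hasWeakDeriv {a b : ℝ} (hab : a ≤ b) {f g : ℝ → ℝ} (h : IsPrimitive a b f g) :
    HasWeakDeriv a b f g := by
  refine ⟨((h.continuousOn hab).mono Ioo_subset_Icc_self).locallyIntegrableOn measurableSet_Ioo,
    ?_, fun ψ h1 _ h3 => h.integral_mul_deriv_test hab h1 h3⟩
  have := h.integrable
  rw [intervalIntegrable_iff_integrableOn_Ioo_of_le hab] at this
  exact this.locallyIntegrableOn

/-- Restriction of a weak derivative to an initial interval. -/
lemma HasWeakDeriv.restrict {a b c : ℝ} (hac : a ≤ c) (hcb : c ≤ b) {f g : ℝ → ℝ}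
    (h : HasWeakDeriv a b f g) : HasWeakDeriv a c f g := by
  have hsub : Ioo a c ⊆ Ioo a b := Ioo_subset_Ioo_right hcb
  refine ⟨h.1.mono_set hsub, h.2.1.mono_set hsub, fun ψ h1 h2 h3 => ?_⟩
  have e := h.2.2 ψ h1 h2 (h3.trans hsub)
  have key : ∀ F : ℝ → ℝ, (∀ x, x ∉ Ioo a c → F x = 0) → ∫ s in a..b, F s = ∫ s in a..c, F s := by
    intro F hF
    rw [intervalIntegral.integral_of_le (hac.trans hcb), intervalIntegral.integral_of_le hac]
    refine setIntegral_eq_of_subset_of_forall_sdiff_eq_zero measurableSet_Ioc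
      (Ioc_subset_Ioc_right hcb) fun x hx => hF x fun hx' => hx.2 (Ioo_subset_Ioc_self hx')
  rw [key, key] at e
  · exact e
  · intro x hx; rw [eq_zero_of_tsupport_subset h3 hx, mul_zero]
  · intro x hx
    rw [image_eq_zero_of_notMem_tsupport fun h => hx (h3 (tsupport_deriv_subset h)), mul_zero]

/-! ### Integrability and inequalities on a finite measure space -/

section Measure

variable {X : Type*} [MeasurableSpace X] {μ : Measure X}

lemma integrable_fun_sub {f g : X → ℝ} (hf : Integrable f μ) (hg : Integrable g μ) :
    Integrable (fun x => f x - g x) μ := hf.sub hg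

lemma integrable_mul_of_memLp_two {f g : X → ℝ} (hf : MemLp f 2 μ) (hg : MemLp g 2 μ) :
    Integrable (fun x => f x * g x) μ :=
  hf.integrable_mul hg

/-- The Cauchy-Schwarz inequality. -/
lemma sq_integral_mul_le {f g : X → ℝ} (hf : MemLp f 2 μ) (hg : MemLp g 2 μ) :
    (∫ x, f x * g x ∂μ) ^ 2 ≤ (∫ x, f x ^ 2 ∂μ) * ∫ x, g x ^ 2 ∂μ := by
  have hfg := integrable_mul_of_memLp_two hf hg
  -- The integral of `(f + r * g) ^ 2` is a nonnegative quadratic polynomial in `r`, so its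
  -- discriminant is nonpositive.
  have key : ∀ r : ℝ, 0 ≤ (∫ x, g x ^ 2 ∂μ) * (r * r) + 2 * (∫ x, f x * g x ∂μ) * r +
      ∫ x, f x ^ 2 ∂μ := by
    intro r
    have h0 : 0 ≤ ∫ x, (f x + r * g x) ^ 2 ∂μ := integral_nonneg fun x => sq_nonneg _
    have e : ∀ x, (f x + r * g x) ^ 2 = f x ^ 2 + (2 * r) * (f x * g x) + r ^ 2 * g x ^ 2 :=
      fun x => by ring
    simp_rw [e] at h0
    rw [integral_add (hf.integrable_sq.fun_add (hfg.const_mul _)) (hg.integrable_sq.const_mul _),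
      integral_add hf.integrable_sq (hfg.const_mul _), integral_const_mul,
      integral_const_mul] at h0
    linarith
  have := discrim_le_zero key
  unfold discrim at this
  linarith

lemma integrable_abs_rpow {p : ℝ} (hp : 2 ≤ p) {a : X → ℝ} (ha : MemLp a (ENNReal.ofReal p) μ) :
    Integrable (fun x => |a x| ^ p) μ := by
  have := ha.integrable_norm_rpow (by simp; linarith) ENNReal.ofReal_ne_top
  rwa [ENNReal.toReal_ofReal (by linarith)] at this

lemma integrable_pFlux_mul {p : ℝ} (hp : 2 ≤ p) {a b : X → ℝ}
    (ha : MemLp a (ENNReal.ofReal p) μ) (hb : MemLp b (ENNReal.ofReal p) μ) :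
    Integrable (fun x => pFlux p (a x) * b x) μ := by
  refine ((integrable_abs_rpow hp ha).add (integrable_abs_rpow hp hb)).mono'
    (((continuous_pFlux hp).comp_aestronglyMeasurable ha.1).mul hb.1) (ae_of_all _ fun x => ?_)
  exact abs_pFlux_mul_le hp _ _

lemma two_le_ofReal {p : ℝ} (hp : 2 ≤ p) : (2 : ENNReal) ≤ ENNReal.ofReal p := by
  rw [show (2 : ENNReal) = ENNReal.ofReal 2 by simp]
  exact ENNReal.ofReal_le_ofReal hp

lemma memLp_two_of_memLp [IsFiniteMeasure μ] {p : ℝ} (hp : 2 ≤ p) {a : X → ℝ}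
    (ha : MemLp a (ENNReal.ofReal p) μ) : MemLp a 2 μ :=
  ha.mono_exponent (two_le_ofReal hp)

lemma memLp_of_bound [IsFiniteMeasure μ] {q : ENNReal} {f : X → ℝ} (hf : AEStronglyMeasurable f μ)
    (C : ℝ) (hC : ∀ᵐ x ∂μ, |f x| ≤ C) : MemLp f q μ :=
  MemLp.of_bound hf C hC

lemma memLp_mul_of_bound {q : ENNReal} {f g : X → ℝ} (hf : AEStronglyMeasurable f μ)
    (C : ℝ) (hC : ∀ᵐ x ∂μ, |f x| ≤ C) (hg : MemLp g q μ) : MemLp (fun x => f x * g x) q μ := by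
  refine MemLp.of_le_mul (c := C) hg (hf.mul hg.1) ?_
  filter_upwards [hC] with x hx
  rw [Real.norm_eq_abs, Real.norm_eq_abs, abs_mul]
  exact mul_le_mul_of_nonneg_right hx (abs_nonneg _)

lemma integrable_mul_of_bound {f g : X → ℝ} (hf : AEStronglyMeasurable f μ)
    (C : ℝ) (hC : ∀ᵐ x ∂μ, |f x| ≤ C) (hg : Integrable g μ) :
    Integrable (fun x => f x * g x) μ := by
  rw [← memLp_one_iff_integrable] at hg ⊢
  exact memLp_mul_of_bound hf C hC hg

lemma sq_le_one_add_rpow {p : ℝ} (hp : 2 ≤ p) (x : ℝ) : x ^ 2 ≤ 1 + |x| ^ p := by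
  rw [← sq_abs]
  rcases le_total |x| 1 with h | h
  · have : (0 : ℝ) ≤ |x| ^ p := by positivity
    nlinarith [abs_nonneg x]
  · have := Real.rpow_le_rpow_of_exponent_le h hp
    norm_cast at this
    linarith

lemma integral_sq_le [IsFiniteMeasure μ] {p : ℝ} (hp : 2 ≤ p) {a : X → ℝ}
    (ha : MemLp a (ENNReal.ofReal p) μ) :
    ∫ x, a x ^ 2 ∂μ ≤ μ.real univ + ∫ x, |a x| ^ p ∂μ := by
  have h := integrable_abs_rpow hp ha
  calc ∫ x, a x ^ 2 ∂μ ≤ ∫ x, (1 + |a x| ^ p) ∂μ :=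
        integral_mono (memLp_two_of_memLp hp ha).integrable_sq ((integrable_const _).add h)
          fun x => sq_le_one_add_rpow hp _
    _ = _ := by rw [integral_add (integrable_const _) h]; simp

end Measure

/-- Lebesgue measure on `(0, L)`. -/
noncomputable abbrev mu (L : ℝ) : Measure ℝ := volume.restrict (Ioo 0 L)

lemma intervalIntegral_eq_mu {L : ℝ} (hL : 0 ≤ L) (f : ℝ → ℝ) :
    ∫ s in (0 : ℝ)..L, f s = ∫ s, f s ∂(mu L) := by
  rw [intervalIntegral.integral_of_le hL, integral_Ioc_eq_integral_Ioo]

lemma intervalIntegrable_iff_mu {L : ℝ} (hL : 0 ≤ L) (f : ℝ → ℝ) :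
    IntervalIntegrable f volume 0 L ↔ Integrable f (mu L) :=
  intervalIntegrable_iff_integrableOn_Ioo_of_le hL

lemma mu_real_univ {L : ℝ} (hL : 0 ≤ L) : (mu L).real univ = L := by
  simp [hL]

lemma Continuous.memLp_mu {f : ℝ → ℝ} (hf : Continuous f) (q : ENNReal) (L : ℝ) :
    MemLp f q (mu L) := by
  obtain ⟨C, hC⟩ := isCompact_Icc.exists_bound_of_continuousOn (s := Icc 0 L) hf.continuousOn
  refine memLp_of_bound hf.aestronglyMeasurable C ?_
  exact (ae_restrict_iff' measurableSet_Ioo).2 (ae_of_all _ fun x hx => hC x (Ioo_subset_Icc_self hx))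

lemma Continuous.integrable_mu {f : ℝ → ℝ} (hf : Continuous f) (L : ℝ) : Integrable f (mu L) :=
  memLp_one_iff_integrable.1 (Continuous.memLp_mu hf 1 L)

lemma MemW1Per.isPrimitive {p L : ℝ} (hp : 2 ≤ p) (hL : 0 < L) {f df : ℝ → ℝ}
    (h : MemW1Per p L f df) : IsPrimitive 0 L f df := by
  refine h.hasWeakDeriv.isPrimitive hL h.continuous.continuousOn ?_
  rw [intervalIntegrable_iff_mu hL.le]
  exact (memLp_two_of_memLp hp h.memLp_deriv).integrable (by norm_num)

lemma IsPrimitive.memW1Per {p L : ℝ} (hL : 0 < L) {f df : ℝ → ℝ} (h : IsPrimitive 0 L f df)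
    (hc : Continuous f) (hper : Function.Periodic f L)
    (hdf : MemLp df (ENNReal.ofReal p) (mu L)) : MemW1Per p L f df :=
  ⟨hc, hper, Continuous.memLp_mu hc _ _, hdf, h.hasWeakDeriv hL.le⟩

/-- The sup norm is controlled by the `H¹` norm. -/
lemma IsPrimitive.sq_le {L : ℝ} (hL : 0 < L) {f df : ℝ → ℝ} (h : IsPrimitive 0 L f df)
    (hc : Continuous f) (hdf : MemLp df 2 (mu L)) {x : ℝ} (hx : x ∈ Icc 0 L) :
    f x ^ 2 ≤ 2 / L * (∫ s, f s ^ 2 ∂(mu L)) + 2 * L * ∫ s, df s ^ 2 ∂(mu L) := by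
  set I := ∫ s, df s ^ 2 ∂(mu L) with hI
  have hdiff : ∀ y ∈ Icc 0 L, (f x - f y) ^ 2 ≤ L * I := by
    intro y hy
    have hA : (∫ s, |df s| ∂(mu L)) ^ 2 ≤ L * I := by
      have := sq_integral_mul_le (μ := mu L) (f := fun _ => (1 : ℝ)) (g := fun s => |df s|)
        (memLp_const _) hdf.abs
      simpa [mu_real_univ hL.le, hL.le] using this
    have hB : |f x - f y| ≤ ∫ s, |df s| ∂(mu L) := by
      rw [← h.integral_eq hy hx]
      refine (intervalIntegral.norm_integral_le_integral_norm_uIoc (f := df)).trans ?_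
      rw [← integral_Ioc_eq_integral_Ioo]
      refine setIntegral_mono_set ?_ (ae_of_all _ fun _ => abs_nonneg _) ?_
      · have := h.integrable.abs
        rwa [intervalIntegrable_iff_integrableOn_Ioc_of_le hL.le] at this
      · refine LE.le.eventuallyLE ?_
        intro z hz
        rw [mem_uIoc] at hz
        rcases hz with hz | hz
        · exact ⟨hy.1.trans_lt hz.1, hz.2.trans hx.2⟩
        · exact ⟨hx.1.trans_lt hz.1, hz.2.trans hy.2⟩
    calc (f x - f y) ^ 2 = |f x - f y| ^ 2 := (sq_abs _).symm
      _ ≤ (∫ s, |df s| ∂(mu L)) ^ 2 := by gcongr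
      _ ≤ _ := hA
  -- Average `f x ^ 2 ≤ 2 * f y ^ 2 + 2 * (f x - f y) ^ 2` over `y`.
  have h1 : ∫ _, f x ^ 2 ∂(mu L) ≤ ∫ y, (2 * f y ^ 2 + 2 * (L * I)) ∂(mu L) := by
    refine integral_mono_ae (integrable_const _)
      (((Continuous.integrable_mu (hc.fun_pow 2) L).const_mul 2).add (integrable_const _)) ?_
    refine (ae_restrict_iff' measurableSet_Ioo).2 (ae_of_all _ fun y hy => ?_)
    have := hdiff y (Ioo_subset_Icc_self hy)
    simp only
    nlinarith [sq_nonneg (f x - 2 * f y)]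
  rw [integral_add ((Continuous.integrable_mu (hc.fun_pow 2) L).const_mul 2) (integrable_const _),
    integral_const_mul, integral_const, integral_const, mu_real_univ hL.le, smul_eq_mul,
    smul_eq_mul] at h1
  have h2 : f x ^ 2 = (L * f x ^ 2) / L := by field_simp
  rw [h2, div_le_iff₀ hL]
  have h3 : (2 / L * (∫ s, f s ^ 2 ∂(mu L)) + 2 * L * I) * L =
      2 * (∫ s, f s ^ 2 ∂(mu L)) + L * (2 * (L * I)) := by field_simp
  rw [h3]
  exact h1

/-- Integration by parts with vanishing boundary terms. -/
lemma IsPrimitive.integral_mul_eq_neg {L : ℝ} (hL : 0 < L) {f df g dg : ℝ → ℝ}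
    (hf : IsPrimitive 0 L f df) (hg : IsPrimitive 0 L g dg) (hb : f L * g L = f 0 * g 0) :
    ∫ s, f s * dg s ∂(mu L) = -∫ s, df s * g s ∂(mu L) := by
  have hm := (hf.mul hg hL.le).integral_eq (left_mem_Icc.2 hL.le) (right_mem_Icc.2 hL.le)
  have hcf := hf.continuousOn hL.le
  have hcg := hg.continuousOn hL.le
  rw [← uIcc_of_le hL.le] at hcf hcg
  rw [intervalIntegral.integral_add (hf.integrable.mul_continuousOn hcg)
    (hg.integrable.continuousOn_mul hcf), intervalIntegral_eq_mu hL.le,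
    intervalIntegral_eq_mu hL.le, hb] at hm
  linarith

/-! ### The matrix `A_T` and the multipliers -/

/-- Apart from the linear term the primitive is periodic, so over `η` full turns it grows by exactly
`π * η * (x ^ 2 + y ^ 2)`. -/
lemma hasDerivAt_trigPrimitive (x y z : ℝ) :
    HasDerivAt (fun z => (x ^ 2 + y ^ 2) / 2 * z + (y ^ 2 - x ^ 2) / 2 * (Real.sin z * Real.cos z)
      - x * y * Real.sin z ^ 2) ((x * Real.sin z - y * Real.cos z) ^ 2) z := by
  have h := (((hasDerivAt_id z).const_mul ((x ^ 2 + y ^ 2) / 2)).add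
    (((Real.hasDerivAt_sin z).mul (Real.hasDerivAt_cos z)).const_mul ((y ^ 2 - x ^ 2) / 2))).sub
    (((Real.hasDerivAt_sin z).pow 2).const_mul (x * y))
  convert! h using 1
  have := Real.sin_sq_add_cos_sq z
  simp only [Nat.cast_ofNat]
  norm_num
  have e : Real.sin z ^ 2 = 1 - Real.cos z ^ 2 := by linarith
  ring_nf
  rw [e]
  ring

lemma sq_trig_le (x y z : ℝ) : (x * Real.sin z - y * Real.cos z) ^ 2 ≤ x ^ 2 + y ^ 2 := by
  have := Real.sin_sq_add_cos_sq z
  nlinarith [sq_nonneg (x * Real.cos z + y * Real.sin z)]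

/-- Coercivity of the matrix `A_T(θ)`, from the winding of `θ`. -/
lemma coercive_trig {L : ℝ} (hL : 0 < L) {η : ℕ} (hη : 1 ≤ η) {θ a : ℝ → ℝ} {B : ℝ}
    (h : IsPrimitive 0 L θ a) (hθ : Continuous θ) (hw : θ L = θ 0 + 2 * Real.pi * η)
    (ha : MemLp a 2 (mu L)) (hB : ∫ s, a s ^ 2 ∂(mu L) ≤ B) (x y : ℝ) :
    Real.pi ^ 2 * (x ^ 2 + y ^ 2) ≤
      B * ∫ s, (x * Real.sin (θ s) - y * Real.cos (θ s)) ^ 2 ∂(mu L) := by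
  set R := x ^ 2 + y ^ 2 with hR
  set q : ℝ → ℝ := fun s => x * Real.sin (θ s) - y * Real.cos (θ s) with hq
  have hqc : Continuous q := by fun_prop
  have hR0 : 0 ≤ R := by positivity
  have hq2 : ∀ s, q s ^ 2 ≤ R := fun s => sq_trig_le x y (θ s)
  have hlip : LipschitzWith (Real.toNNReal R) (fun z => (x ^ 2 + y ^ 2) / 2 * z +
      (y ^ 2 - x ^ 2) / 2 * (Real.sin z * Real.cos z) - x * y * Real.sin z ^ 2) := by
    refine lipschitzWith_of_nnnorm_deriv_le
      (fun z => (hasDerivAt_trigPrimitive x y z).differentiableAt) fun z => ?_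
    rw [(hasDerivAt_trigPrimitive x y z).deriv, ← NNReal.coe_le_coe, coe_nnnorm, Real.norm_eq_abs,
      abs_of_nonneg (sq_nonneg _), Real.coe_toNNReal _ hR0]
    exact sq_trig_le x y z
  have hint := (h.comp hL.le (hasDerivAt_trigPrimitive x y) hlip).integral_eq
    (left_mem_Icc.2 hL.le) (right_mem_Icc.2 hL.le)
  have hsin : Real.sin (θ L) = Real.sin (θ 0) := by
    rw [hw, show θ 0 + 2 * Real.pi * η = θ 0 + η * (2 * Real.pi) by ring, Real.sin_add_nat_mul_two_pi]
  have hcos : Real.cos (θ L) = Real.cos (θ 0) := by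
    rw [hw, show θ 0 + 2 * Real.pi * η = θ 0 + η * (2 * Real.pi) by ring, Real.cos_add_nat_mul_two_pi]
  rw [hsin, hcos, intervalIntegral_eq_mu hL.le] at hint
  -- Change of variables from `s` to the angle: after `η` turns only the linear part of the
  -- primitive contributes.
  have hval : ∫ s, q s * (q s * a s) ∂(mu L) = Real.pi * η * R := by
    have : ∀ s, q s * (q s * a s) = (x * Real.sin (θ s) - y * Real.cos (θ s)) ^ 2 * a s :=
      fun s => by simp only [hq]; ring
    simp_rw [this]
    rw [hint, hw, hR]; ring
  have hqb : ∀ᵐ s ∂(mu L), |q s| ≤ Real.sqrt R :=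
    ae_of_all _ fun s => Real.abs_le_sqrt (hq2 s)
  have hqa : MemLp (fun s => q s * a s) 2 (mu L) :=
    memLp_mul_of_bound hqc.aestronglyMeasurable _ hqb ha
  -- The integrand is split as `q` times `q * a`: the first factor yields the quadratic form sought,
  -- while in the second `q ^ 2` is bounded by `R`.
  have hcs := sq_integral_mul_le (Continuous.memLp_mu hqc 2 L) hqa
  rw [hval] at hcs
  have hb2 : ∫ s, (q s * a s) ^ 2 ∂(mu L) ≤ R * B := by
    refine le_trans (integral_mono hqa.integrable_sq (ha.integrable_sq.const_mul R) fun s => ?_)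
      (by rw [integral_const_mul]; exact mul_le_mul_of_nonneg_left hB hR0)
    simp only
    rw [mul_pow]
    exact mul_le_mul_of_nonneg_right (hq2 s) (sq_nonneg _)
  have hQ : 0 ≤ ∫ s, q s ^ 2 ∂(mu L) := integral_nonneg fun _ => sq_nonneg _
  rcases hR0.eq_or_lt with h0 | h0
  · rw [← h0, mul_zero]
    exact mul_nonneg ((integral_nonneg fun _ => sq_nonneg _).trans hB) hQ
  have h1 : (Real.pi * η * R) ^ 2 ≤ (∫ s, q s ^ 2 ∂(mu L)) * (R * B) :=
    hcs.trans (mul_le_mul_of_nonneg_left hb2 hQ)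
  have hη' : (1 : ℝ) ≤ η := by exact_mod_cast hη
  have h2 : Real.pi ^ 2 * R ^ 2 ≤ (Real.pi * η * R) ^ 2 := by
    rw [mul_pow, mul_pow]
    have : (1 : ℝ) ≤ (η : ℝ) ^ 2 := one_le_pow₀ hη'
    have hpos : 0 ≤ Real.pi ^ 2 * R ^ 2 := by positivity
    nlinarith
  have h3 : R * (Real.pi ^ 2 * R) ≤ R * (B * ∫ s, q s ^ 2 ∂(mu L)) := by nlinarith
  exact le_of_mul_le_mul_left h3 h0

/-- The solution of a linear system with matrix `A_T(θ)` is bounded by the right-hand side. -/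
lemma sq_add_sq_le_of_system {L : ℝ} (hL : 0 < L) {η : ℕ} (hη : 1 ≤ η) {θ a : ℝ → ℝ} {B : ℝ}
    (h : IsPrimitive 0 L θ a) (hθ : Continuous θ) (hw : θ L = θ 0 + 2 * Real.pi * η)
    (ha : MemLp a 2 (mu L)) (hB : ∫ s, a s ^ 2 ∂(mu L) ≤ B) {x y b₁ b₂ : ℝ}
    (h₁ : x * (∫ s, Real.sin (θ s) ^ 2 ∂(mu L)) -
      y * (∫ s, Real.sin (θ s) * Real.cos (θ s) ∂(mu L)) = b₁)
    (h₂ : -x * (∫ s, Real.sin (θ s) * Real.cos (θ s) ∂(mu L)) +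
      y * (∫ s, Real.cos (θ s) ^ 2 ∂(mu L)) = b₂) :
    x ^ 2 + y ^ 2 ≤ (B / Real.pi ^ 2) ^ 2 * (b₁ ^ 2 + b₂ ^ 2) := by
  have hco := coercive_trig hL hη h hθ hw ha hB x y
  have is : Integrable (fun s => Real.sin (θ s) ^ 2) (mu L) :=
    Continuous.integrable_mu (by fun_prop) L
  have isc : Integrable (fun s => Real.sin (θ s) * Real.cos (θ s)) (mu L) :=
    Continuous.integrable_mu (by fun_prop) L
  have ic : Integrable (fun s => Real.cos (θ s) ^ 2) (mu L) :=
    Continuous.integrable_mu (by fun_prop) L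
  -- Pairing the system with `(x, y)` turns its left side into the quadratic form of `A_T(θ)`.
  have e : ∫ s, (x * Real.sin (θ s) - y * Real.cos (θ s)) ^ 2 ∂(mu L) = x * b₁ + y * b₂ := by
    have : ∀ s, (x * Real.sin (θ s) - y * Real.cos (θ s)) ^ 2 = x ^ 2 * Real.sin (θ s) ^ 2 -
        2 * x * y * (Real.sin (θ s) * Real.cos (θ s)) + y ^ 2 * Real.cos (θ s) ^ 2 :=
      fun s => by ring
    simp_rw [this]
    rw [integral_add (integrable_fun_sub (is.const_mul _) (isc.const_mul _)) (ic.const_mul _),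
      integral_sub (is.const_mul _) (isc.const_mul _), integral_const_mul, integral_const_mul,
      integral_const_mul, ← h₁, ← h₂]
    ring
  rw [e] at hco
  have hB0 : 0 ≤ B := (integral_nonneg fun _ => sq_nonneg _).trans hB
  have hpi : 0 < Real.pi ^ 2 := by positivity
  set R := x ^ 2 + y ^ 2 with hR
  have hcs : (x * b₁ + y * b₂) ^ 2 ≤ R * (b₁ ^ 2 + b₂ ^ 2) := by
    nlinarith [sq_nonneg (x * b₂ - y * b₁)]
  rcases (show 0 ≤ R by positivity).eq_or_lt with h0 | h0
  · rw [← h0]; positivity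
  have h3 : R ≤ B / Real.pi ^ 2 * (x * b₁ + y * b₂) := by
    rw [div_mul_eq_mul_div, le_div_iff₀ hpi]; linarith
  have h4 : R ^ 2 ≤ (B / Real.pi ^ 2) ^ 2 * (R * (b₁ ^ 2 + b₂ ^ 2)) := by
    calc R ^ 2 ≤ (B / Real.pi ^ 2 * (x * b₁ + y * b₂)) ^ 2 := by gcongr
      _ = (B / Real.pi ^ 2) ^ 2 * (x * b₁ + y * b₂) ^ 2 := by ring
      _ ≤ _ := mul_le_mul_of_nonneg_left hcs (sq_nonneg _)
  refine le_of_mul_le_mul_left ?_ h0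
  linarith

/-! ### Closed curves -/

/-- Adding `cos θ - cos ϑ`, whose integral is zero, removes the first-order term and leaves a Taylor
remainder. This quadratic smallness is what keeps the multiplier terms harmless in every Gronwall
argument below. -/
lemma abs_integral_sin_mul_le {L : ℝ} {θ ϑ : ℝ → ℝ} (hθ : Continuous θ) (hϑ : Continuous ϑ)
    (h : ∫ s, Real.cos (θ s) ∂(mu L) = ∫ s, Real.cos (ϑ s) ∂(mu L)) :
    |∫ s, Real.sin (θ s) * (θ s - ϑ s) ∂(mu L)| ≤ ∫ s, (θ s - ϑ s) ^ 2 ∂(mu L) := by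
  have i1 : Integrable (fun s => Real.sin (θ s) * (θ s - ϑ s)) (mu L) :=
    Continuous.integrable_mu (by fun_prop) L
  have i2 : Integrable (fun s => Real.cos (θ s)) (mu L) := Continuous.integrable_mu (by fun_prop) L
  have i3 : Integrable (fun s => Real.cos (ϑ s)) (mu L) := Continuous.integrable_mu (by fun_prop) L
  have e : ∫ s, Real.sin (θ s) * (θ s - ϑ s) ∂(mu L) =
      ∫ s, (Real.sin (θ s) * (θ s - ϑ s) + (Real.cos (θ s) - Real.cos (ϑ s))) ∂(mu L) := by
    rw [integral_add i1 (integrable_fun_sub i2 i3), integral_sub i2 i3, h]; ring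
  rw [e]
  refine abs_integral_le_integral_abs.trans (integral_mono_of_nonneg
    (ae_of_all _ fun _ => abs_nonneg _) (Continuous.integrable_mu (by fun_prop) L)
    (ae_of_all _ fun s => abs_sin_mul_add_cos_sub_le _ _))

lemma abs_integral_cos_mul_le {L : ℝ} {θ ϑ : ℝ → ℝ} (hθ : Continuous θ) (hϑ : Continuous ϑ)
    (h : ∫ s, Real.sin (θ s) ∂(mu L) = ∫ s, Real.sin (ϑ s) ∂(mu L)) :
    |∫ s, Real.cos (θ s) * (θ s - ϑ s) ∂(mu L)| ≤ ∫ s, (θ s - ϑ s) ^ 2 ∂(mu L) := by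
  have i1 : Integrable (fun s => Real.cos (θ s) * (θ s - ϑ s)) (mu L) :=
    Continuous.integrable_mu (by fun_prop) L
  have i2 : Integrable (fun s => Real.sin (θ s)) (mu L) := Continuous.integrable_mu (by fun_prop) L
  have i3 : Integrable (fun s => Real.sin (ϑ s)) (mu L) := Continuous.integrable_mu (by fun_prop) L
  have e : ∫ s, Real.cos (θ s) * (θ s - ϑ s) ∂(mu L) =
      ∫ s, (Real.cos (θ s) * (θ s - ϑ s) - (Real.sin (θ s) - Real.sin (ϑ s))) ∂(mu L) := by
    rw [integral_sub i1 (integrable_fun_sub i2 i3), integral_sub i2 i3, h]; ring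
  rw [e]
  refine abs_integral_le_integral_abs.trans (integral_mono_of_nonneg
    (ae_of_all _ fun _ => abs_nonneg _) (Continuous.integrable_mu (by fun_prop) L)
    (ae_of_all _ fun s => abs_cos_mul_sub_sin_sub_le _ _))

/-! ### Functions on the space-time cylinder -/

lemma cylinder_eq (T L : ℝ) : cylinder T L = (mu T).prod (mu L) := by
  rw [cylinder, Measure.prod_restrict, Measure.volume_eq_prod]

lemma ae_ae_swap_of_ae_prod {X Y : Type*} [MeasurableSpace X] [MeasurableSpace Y] {μ : Measure X}
    {ν : Measure Y} [SFinite μ] [SFinite ν] {P : X × Y → Prop} (h : ∀ᵐ z ∂μ.prod ν, P z) :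
    ∀ᵐ y ∂ν, ∀ᵐ x ∂μ, P (x, y) := by
  have h2 : ∀ᵐ z ∂ν.prod μ, P z.swap :=
    (Measure.measurePreserving_swap (μ := ν) (ν := μ)).quasiMeasurePreserving.ae h
  exact Measure.ae_ae_of_ae_prod h2

lemma intervalIntegral_eq_integral_ite {T t : ℝ} (ht0 : 0 ≤ t) (htT : t ≤ T) (f : ℝ → ℝ) :
    ∫ σ in (0 : ℝ)..t, f σ = ∫ σ, (if σ < t then f σ else 0) ∂(mu T) := by
  have : (fun σ => if σ < t then f σ else 0) = (Iio t).indicator f := by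
    ext σ; simp [indicator_apply]
  have hset : Iio t ∩ Ioo 0 T = Ioo 0 t := by
    ext x
    constructor
    · rintro ⟨h1, h2⟩; exact ⟨h2.1, h1⟩
    · rintro ⟨h1, h2⟩; exact ⟨h2, h1, lt_of_lt_of_le h2 htT⟩
  rw [this, integral_indicator measurableSet_Iio, Measure.restrict_restrict measurableSet_Iio,
    intervalIntegral_eq_mu ht0, hset]

lemma intervalIntegral_congr_mu {T t : ℝ} (ht : t ∈ Ico 0 T) {f g : ℝ → ℝ}
    (h : ∀ᵐ σ ∂(mu T), f σ = g σ) : ∫ σ in (0 : ℝ)..t, f σ = ∫ σ in (0 : ℝ)..t, g σ := by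
  rw [intervalIntegral_eq_integral_ite ht.1 ht.2.le, intervalIntegral_eq_integral_ite ht.1 ht.2.le]
  refine integral_congr_ae ?_
  filter_upwards [h] with σ hσ
  rw [hσ]

/-- `v` is the primitive in time, with values in `L²(0, L)`, of `g ∈ L²((0, T) × (0, L))`. -/
structure IsTimePrimitive (T L : ℝ) (v g : ℝ → ℝ → ℝ) : Prop where
  memLp : MemLp (fun z : ℝ × ℝ => v z.1 z.2) 2 ((mu T).prod (mu L))
  memLp_deriv : MemLp (fun z : ℝ × ℝ => g z.1 z.2) 2 ((mu T).prod (mu L))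
  continuous : ∀ t ∈ Ico 0 T, Continuous (v t)
  eq : ∀ t ∈ Ico 0 T, ∀ᵐ s ∂(mu L), v t s = v 0 s + ∫ σ in (0 : ℝ)..t, g σ s

namespace IsTimePrimitive

variable {T L : ℝ} {v g v₁ g₁ v₂ g₂ : ℝ → ℝ → ℝ}

lemma integrable_deriv (h : IsTimePrimitive T L v g) :
    Integrable (fun z : ℝ × ℝ => g z.1 z.2) ((mu T).prod (mu L)) :=
  h.memLp_deriv.integrable (by norm_num)

lemma ae_integrable_deriv (h : IsTimePrimitive T L v g) :
    ∀ᵐ s ∂(mu L), Integrable (fun t => g t s) (mu T) := h.integrable_deriv.prod_left_ae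

/-- For each time the identity holds off a null set depending on that time. Fubini's theorem joins
these sets into one null set of the cylinder, provided the exceptional set is measurable; for this
`v` and `g` are replaced by strongly measurable representatives. -/
lemma ae_eq (hT : 0 < T) (h : IsTimePrimitive T L v g) :
    ∀ᵐ z ∂((mu T).prod (mu L)), v z.1 z.2 = v 0 z.2 + ∫ σ in (0 : ℝ)..z.1, g σ z.2 := by
  have hv := h.memLp.1
  have hg := h.memLp_deriv.1
  set v' := hv.mk _ with hv'
  set g' := hg.mk _ with hg'
  have hv'm : StronglyMeasurable v' := hv.stronglyMeasurable_mk
  have hg'm : StronglyMeasurable g' := hg.stronglyMeasurable_mk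
  have hve : ∀ᵐ z ∂((mu T).prod (mu L)), v z.1 z.2 = v' z := hv.ae_eq_mk
  have hge : ∀ᵐ z ∂((mu T).prod (mu L)), g z.1 z.2 = g' z := hg.ae_eq_mk
  have hW : StronglyMeasurable (fun z : ℝ × ℝ => v 0 z.2 +
      ∫ σ, (if σ < z.1 then g' (σ, z.2) else 0) ∂(mu T)) := by
    refine ((h.continuous 0 ⟨le_rfl, hT⟩).stronglyMeasurable.comp_measurable measurable_snd).add ?_
    refine StronglyMeasurable.integral_prod_right
      (f := fun z : ℝ × ℝ => fun σ : ℝ => if σ < z.1 then g' (σ, z.2) else 0) ?_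
    refine StronglyMeasurable.ite ?_ ?_ stronglyMeasurable_const
    · exact measurableSet_lt measurable_snd (measurable_fst.comp measurable_fst)
    · exact hg'm.comp_measurable (measurable_snd.prodMk (measurable_snd.comp measurable_fst))
  have hgs := ae_ae_swap_of_ae_prod hge
  have hset : MeasurableSet {z : ℝ × ℝ | v' z = v 0 z.2 +
      ∫ σ, (if σ < z.1 then g' (σ, z.2) else 0) ∂(mu T)} :=
    measurableSet_eq_fun hv'm.measurable hW.measurable
  have hIoo : ∀ᵐ t ∂(mu T), t ∈ Ioo 0 T := ae_restrict_mem measurableSet_Ioo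
  have key : ∀ᵐ z ∂((mu T).prod (mu L)), v' z = v 0 z.2 +
      ∫ σ, (if σ < z.1 then g' (σ, z.2) else 0) ∂(mu T) := by
    refine (Measure.ae_prod_mem_iff_ae_ae_mem hset).2 ?_
    filter_upwards [Measure.ae_ae_of_ae_prod hve, hIoo] with t ht htI
    filter_upwards [ht, h.eq t ⟨htI.1.le, htI.2⟩, hgs] with s hs1 hs2 hs3
    rw [← hs1, hs2, intervalIntegral_congr_mu ⟨htI.1.le, htI.2⟩ hs3,
      intervalIntegral_eq_integral_ite htI.1.le htI.2.le]
  have hgs' : ∀ᵐ z ∂((mu T).prod (mu L)), ∀ᵐ σ ∂(mu T), g σ z.2 = g' (σ, z.2) :=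
    Measure.quasiMeasurePreserving_snd.ae hgs
  have hIoo' : ∀ᵐ z ∂((mu T).prod (mu L)), z.1 ∈ Ioo 0 T :=
    Measure.quasiMeasurePreserving_fst.ae hIoo
  filter_upwards [key, hve, hgs', hIoo'] with z h1 h2 h3 h4
  rw [h2, h1, intervalIntegral_congr_mu ⟨h4.1.le, h4.2⟩ h3,
      intervalIntegral_eq_integral_ite h4.1.le h4.2.le]

lemma ae_isPrimitive (hT : 0 < T) (h : IsTimePrimitive T L v g) :
    ∀ᵐ s ∂(mu L), IsPrimitive 0 T (fun t => v 0 s + ∫ σ in (0 : ℝ)..t, g σ s) (fun t => g t s) := by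
  filter_upwards [h.ae_integrable_deriv] with s hs
  exact ⟨(intervalIntegrable_iff_mu hT.le _).2 hs, fun x _ => by simp⟩

/-- Fubini for pointwise-in-space fundamental theorems of calculus in time. -/
lemma _root_.PElastic.integral_eq_of_ae_intervalIntegral {T L τ : ℝ} (hτ : τ ∈ Ico 0 T)
    {k : ℝ → ℝ → ℝ} {q : ℝ → ℝ} (hk : Integrable (fun z : ℝ × ℝ => k z.1 z.2) ((mu T).prod (mu L)))
    (h : ∀ᵐ s ∂(mu L), q s = ∫ σ in (0 : ℝ)..τ, k σ s) :
    ∫ s, q s ∂(mu L) = ∫ σ in (0 : ℝ)..τ, ∫ s, k σ s ∂(mu L) := by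
  rw [integral_congr_ae h, intervalIntegral_eq_mu hτ.1]
  simp_rw [intervalIntegral_eq_mu hτ.1]
  have hle : mu τ ≤ mu T := Measure.restrict_mono (Ioo_subset_Ioo_right hτ.2.le) le_rfl
  have hk' : Integrable (Function.uncurry k) ((mu τ).prod (mu L)) := by
    refine hk.mono_measure ?_
    rw [Measure.prod_restrict, Measure.prod_restrict]
    exact Measure.restrict_mono (prod_mono (Ioo_subset_Ioo_right hτ.2.le) le_rfl) le_rfl
  exact (integral_integral_swap hk').symm

/-- The chain rule for the squared `L²` norm is obtained pointwise in space: for almost every `s`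
the function is absolutely continuous in time, so its square is too, and Fubini's theorem integrates
over `s`. -/
lemma integral_sq_sub (hT : 0 < T) (h : IsTimePrimitive T L v g) {τ : ℝ} (hτ : τ ∈ Ico 0 T) :
    (∫ s, v τ s ^ 2 ∂(mu L)) - ∫ s, v 0 s ^ 2 ∂(mu L) =
      ∫ t in (0 : ℝ)..τ, 2 * ∫ s, g t s * v t s ∂(mu L) := by
  have hi1 := Continuous.integrable_mu ((h.continuous τ hτ).fun_pow 2) L
  have hi2 := Continuous.integrable_mu ((h.continuous 0 ⟨le_rfl, hT⟩).fun_pow 2) L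
  have hgv : Integrable (fun z : ℝ × ℝ => 2 * (g z.1 z.2 * v z.1 z.2)) ((mu T).prod (mu L)) :=
    (integrable_mul_of_memLp_two h.memLp_deriv h.memLp).const_mul 2
  rw [← integral_sub hi1 hi2]
  simp_rw [← integral_const_mul]
  refine integral_eq_of_ae_intervalIntegral (k := fun t s => 2 * (g t s * v t s)) hτ hgv ?_
  filter_upwards [h.ae_isPrimitive hT, h.eq τ hτ, ae_ae_swap_of_ae_prod (h.ae_eq hT)]
    with s h1 h2 h3
  have h4 := (h1.mul h1 hT.le).integral_eq (left_mem_Icc.2 hT.le) (Ico_subset_Icc_self hτ)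
  simp only [intervalIntegral.integral_same, add_zero] at h4
  rw [h2, sq, sq, ← h4]
  refine intervalIntegral_congr_mu hτ ?_
  filter_upwards [h3] with t ht
  rw [← ht]; ring

lemma integral_comp_sub (hT : 0 < T) (h : IsTimePrimitive T L v g) {τ : ℝ} (hτ : τ ∈ Ico 0 T)
    {Φ Φ' φ : ℝ → ℝ} (hφ : Continuous φ) (hΦ : ∀ x, HasDerivAt Φ (Φ' x) x) (hΦ' : Continuous Φ')
    {K : NNReal} (hK : ∀ x, |Φ' x| ≤ K) :
    (∫ s, Φ (v τ s + φ s) ∂(mu L)) - ∫ s, Φ (v 0 s + φ s) ∂(mu L) =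
      ∫ t in (0 : ℝ)..τ, ∫ s, Φ' (v t s + φ s) * g t s ∂(mu L) := by
  have hΦc : Continuous Φ := continuous_iff_continuousAt.2 fun x => (hΦ x).continuousAt
  have hlip : LipschitzWith K Φ := by
    refine lipschitzWith_of_nnnorm_deriv_le (fun x => (hΦ x).differentiableAt) fun x => ?_
    rw [(hΦ x).deriv, ← NNReal.coe_le_coe, coe_nnnorm]
    exact hK x
  have hi1 := Continuous.integrable_mu (hΦc.comp ((h.continuous τ hτ).add hφ)) L
  have hi2 := Continuous.integrable_mu (hΦc.comp ((h.continuous 0 ⟨le_rfl, hT⟩).add hφ)) L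
  have hm : AEStronglyMeasurable (fun z : ℝ × ℝ => Φ' (v z.1 z.2 + φ z.2))
      ((mu T).prod (mu L)) :=
    hΦ'.comp_aestronglyMeasurable
      (h.memLp.1.add (hφ.aestronglyMeasurable.comp_snd))
  have hgv : Integrable (fun z : ℝ × ℝ => Φ' (v z.1 z.2 + φ z.2) * g z.1 z.2)
      ((mu T).prod (mu L)) :=
    integrable_mul_of_bound hm K (ae_of_all _ fun z => hK _) h.integrable_deriv
  have e := integral_sub hi1 hi2
  simp only [Function.comp_apply, Pi.add_apply] at e
  rw [← e]
  refine integral_eq_of_ae_intervalIntegral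
    (k := fun t s => Φ' (v t s + φ s) * g t s) hτ hgv ?_
  filter_upwards [h.ae_isPrimitive hT, h.eq τ hτ, ae_ae_swap_of_ae_prod (h.ae_eq hT)]
    with s h1 h2 h3
  have hd : ∀ x, HasDerivAt (fun x => Φ (x + φ s)) (Φ' (x + φ s)) x := fun x =>
    (hΦ (x + φ s)).comp_add_const x (φ s)
  have hl : LipschitzWith K (fun x => Φ (x + φ s)) := by
    refine LipschitzWith.of_dist_le_mul fun x y => ?_
    simpa using hlip.dist_le_mul (x + φ s) (y + φ s)
  have h4 := (h1.comp hT.le hd hl).integral_eq (left_mem_Icc.2 hT.le) (Ico_subset_Icc_self hτ)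
  simp only [intervalIntegral.integral_same, add_zero] at h4
  rw [h2, ← h4]
  refine intervalIntegral_congr_mu hτ ?_
  filter_upwards [h3] with t ht
  rw [← ht]

lemma sub (h₁ : IsTimePrimitive T L v₁ g₁) (h₂ : IsTimePrimitive T L v₂ g₂) :
    IsTimePrimitive T L (fun t s => v₁ t s - v₂ t s) (fun t s => g₁ t s - g₂ t s) where
  memLp := h₁.memLp.sub h₂.memLp
  memLp_deriv := h₁.memLp_deriv.sub h₂.memLp_deriv
  continuous t ht := (h₁.continuous t ht).sub (h₂.continuous t ht)
  eq t ht := by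
    filter_upwards [h₁.eq t ht, h₂.eq t ht, h₁.ae_integrable_deriv, h₂.ae_integrable_deriv]
      with s e1 e2 i1 i2
    have hT : 0 ≤ T := ht.1.trans ht.2.le
    rw [← intervalIntegrable_iff_mu hT] at i1 i2
    have hsub : uIcc 0 t ⊆ uIcc 0 T := by
      rw [uIcc_of_le hT, uIcc_of_le ht.1]; exact Icc_subset_Icc_right ht.2.le
    rw [intervalIntegral.integral_sub (i1.mono_set hsub) (i2.mono_set hsub), e1, e2]
    ring

/-- Constants in time. -/
lemma const {w : ℝ → ℝ} (hw : Continuous w) :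
    IsTimePrimitive T L (fun _ => w) (fun _ _ => 0) where
  memLp := (Continuous.memLp_mu hw 2 L).comp_snd (mu T)
  memLp_deriv := MemLp.zero
  continuous _ _ := hw
  eq t _ := by simp

/-- Restriction of the time interval. -/
lemma shift (h : IsTimePrimitive T L v g) {h₀ S : ℝ} (h0 : 0 ≤ h₀) (hS : h₀ + S ≤ T) :
    IsTimePrimitive S L (fun t => v (h₀ + t)) (fun t => g (h₀ + t)) := by
  have hmp : MeasurePreserving (fun t : ℝ => h₀ + t) (mu S)
      (volume.restrict (Ioo h₀ (h₀ + S))) := by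
    have := (measurePreserving_add_left (volume : Measure ℝ) h₀).restrict_preimage
      (measurableSet_Ioo (a := h₀) (b := h₀ + S))
    convert! this using 2
    ext x; simp
  have hle : (volume.restrict (Ioo h₀ (h₀ + S))).prod (mu L) ≤ (mu T).prod (mu L) := by
    rw [Measure.prod_restrict, Measure.prod_restrict]
    exact Measure.restrict_mono (prod_mono (Ioo_subset_Ioo h0 hS) le_rfl) le_rfl
  have hmp2 : MeasurePreserving (fun z : ℝ × ℝ => (h₀ + z.1, z.2)) ((mu S).prod (mu L))
      ((volume.restrict (Ioo h₀ (h₀ + S))).prod (mu L)) := hmp.prod (MeasurePreserving.id _)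
  refine ⟨(h.memLp.mono_measure hle).comp_measurePreserving hmp2,
    (h.memLp_deriv.mono_measure hle).comp_measurePreserving hmp2,
    fun t ht => h.continuous _ ⟨by linarith [ht.1], by linarith [ht.2]⟩, fun t ht => ?_⟩
  have ht1 : h₀ + t ∈ Ico 0 T := ⟨by linarith [ht.1], by linarith [ht.2]⟩
  have ht2 : h₀ ∈ Ico 0 T := ⟨h0, by linarith [ht.1, ht.2]⟩
  filter_upwards [h.eq _ ht1, h.eq _ ht2, h.ae_integrable_deriv] with s e1 e2 i
  have hT : 0 ≤ T := ht1.1.trans ht1.2.le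
  rw [← intervalIntegrable_iff_mu hT] at i
  rw [e1, add_zero, e2, intervalIntegral.integral_comp_add_left (fun σ => g σ s), add_zero, add_assoc,
    intervalIntegral.integral_add_adjacent_intervals]
  · refine i.mono_set ?_
    rw [uIcc_of_le hT, uIcc_of_le h0]; exact Icc_subset_Icc_right ht2.2.le
  · refine i.mono_set ?_
    rw [uIcc_of_le hT, uIcc_of_le (by linarith [ht.1])]; exact Icc_subset_Icc h0 ht1.2.le

end IsTimePrimitive

/-! ### Test functions -/

lemma memLp_prod_of_ae_bound {μ ν : Measure ℝ} [IsFiniteMeasure μ] [SFinite ν] {p : ℝ}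
    (hp : 2 ≤ p) {f : ℝ → ℝ → ℝ} (hf : AEStronglyMeasurable (fun z : ℝ × ℝ => f z.1 z.2) (μ.prod ν))
    {K : NNReal} (hK : ∀ᵐ t ∂μ, eLpNorm (f t) (ENNReal.ofReal p) ν ≤ K) :
    MemLp (fun z : ℝ × ℝ => f z.1 z.2) (ENNReal.ofReal p) (μ.prod ν) := by
  have hp0 : ENNReal.ofReal p ≠ 0 := by simp; linarith
  have hpt : (ENNReal.ofReal p).toReal = p := ENNReal.toReal_ofReal (by linarith)
  refine ⟨hf, (eLpNorm_lt_top_iff_lintegral_rpow_enorm_lt_top hp0 ENNReal.ofReal_ne_top).2 ?_⟩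
  rw [lintegral_prod _ (hf.enorm.pow_const _), hpt]
  calc ∫⁻ t, ∫⁻ s, ‖f t s‖ₑ ^ p ∂ν ∂μ ≤ ∫⁻ _, (K : ENNReal) ^ p ∂μ := by
        refine lintegral_mono_ae ?_
        filter_upwards [hK] with t ht
        rw [eLpNorm_eq_lintegral_rpow_enorm_toReal hp0 ENNReal.ofReal_ne_top, hpt] at ht
        have h2 := ENNReal.rpow_le_rpow ht (show 0 ≤ p by linarith)
        rwa [← ENNReal.rpow_mul, one_div, inv_mul_cancel₀ (by linarith), ENNReal.rpow_one] at h2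
    _ < ⊤ := by
        rw [lintegral_const]
        exact ENNReal.mul_lt_top (ENNReal.rpow_lt_top_of_nonneg (by linarith) ENNReal.coe_ne_top)
          (measure_lt_top _ _)

namespace MemLinftyW1Per

variable {p L T : ℝ} {v dv w dw : ℝ → ℝ → ℝ}

lemma memLp (hp : 2 ≤ p) (h : MemLinftyW1Per p L T v dv) :
    MemLp (fun z : ℝ × ℝ => v z.1 z.2) (ENNReal.ofReal p) ((mu T).prod (mu L)) := by
  obtain ⟨K, hK⟩ := h.bounded
  have hm := h.aestronglyMeasurable
  rw [cylinder_eq] at hm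
  exact memLp_prod_of_ae_bound hp hm (hK.mono fun t ht => ht.1)

lemma memLp_deriv (hp : 2 ≤ p) (h : MemLinftyW1Per p L T v dv) :
    MemLp (fun z : ℝ × ℝ => dv z.1 z.2) (ENNReal.ofReal p) ((mu T).prod (mu L)) := by
  obtain ⟨K, hK⟩ := h.bounded
  have hm := h.aestronglyMeasurable_deriv
  rw [cylinder_eq] at hm
  exact memLp_prod_of_ae_bound hp hm (hK.mono fun t ht => ht.2)

lemma memLp_two (hp : 2 ≤ p) (h : MemLinftyW1Per p L T v dv) :
    MemLp (fun z : ℝ × ℝ => v z.1 z.2) 2 ((mu T).prod (mu L)) :=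
  memLp_two_of_memLp hp (h.memLp hp)

end MemLinftyW1Per

lemma MemW1Per.zero (p L : ℝ) : MemW1Per p L (fun _ => 0) (fun _ => 0) where
  continuous := continuous_const
  periodic _ := rfl
  memLp := MemLp.zero
  memLp_deriv := MemLp.zero
  hasWeakDeriv := ⟨locallyIntegrableOn_zero, locallyIntegrableOn_zero, by simp⟩

lemma MemW1Per.sub {p L : ℝ} (hp : 2 ≤ p) (hL : 0 < L) {f df g dg : ℝ → ℝ}
    (hf : MemW1Per p L f df) (hg : MemW1Per p L g dg) :
    MemW1Per p L (fun s => f s - g s) (fun s => df s - dg s) :=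
  ((hf.isPrimitive hp hL).sub (hg.isPrimitive hp hL)).memW1Per hL (hf.continuous.sub hg.continuous)
    (hf.periodic.sub hg.periodic) (hf.memLp_deriv.sub hg.memLp_deriv)

namespace MemLinftyW1Per

variable {p L T : ℝ} {v dv w dw : ℝ → ℝ → ℝ}

lemma sub (hp : 2 ≤ p) (hL : 0 < L) (h₁ : MemLinftyW1Per p L T v dv)
    (h₂ : MemLinftyW1Per p L T w dw) :
    MemLinftyW1Per p L T (fun t s => v t s - w t s) (fun t s => dv t s - dw t s) where
  aestronglyMeasurable := h₁.aestronglyMeasurable.sub h₂.aestronglyMeasurable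
  aestronglyMeasurable_deriv := h₁.aestronglyMeasurable_deriv.sub h₂.aestronglyMeasurable_deriv
  memW1Per := by
    filter_upwards [h₁.memW1Per, h₂.memW1Per] with t h1 h2 using h1.sub hp hL h2
  bounded := by
    obtain ⟨K₁, hK₁⟩ := h₁.bounded
    obtain ⟨K₂, hK₂⟩ := h₂.bounded
    have h1p : 1 ≤ ENNReal.ofReal p := le_trans (by norm_num) (two_le_ofReal hp)
    refine ⟨K₁ + K₂, ?_⟩
    filter_upwards [hK₁, hK₂, h₁.memW1Per, h₂.memW1Per] with t k1 k2 m1 m2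
    push_cast
    exact ⟨(eLpNorm_sub_le m1.memLp.1 m2.memLp.1 h1p).trans (add_le_add k1.1 k2.1),
      (eLpNorm_sub_le m1.memLp_deriv.1 m2.memLp_deriv.1 h1p).trans (add_le_add k1.2 k2.2)⟩

lemma const {f df : ℝ → ℝ} (h : MemW1Per p L f df) :
    MemLinftyW1Per p L T (fun _ => f) (fun _ => df) where
  aestronglyMeasurable := by
    rw [cylinder_eq]; exact h.memLp.1.comp_snd
  aestronglyMeasurable_deriv := by
    rw [cylinder_eq]; exact h.memLp_deriv.1.comp_snd
  memW1Per := ae_of_all _ fun _ => h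
  bounded := by
    refine ⟨(eLpNorm f (ENNReal.ofReal p) (volume.restrict (Ioo 0 L))).toNNReal +
      (eLpNorm df (ENNReal.ofReal p) (volume.restrict (Ioo 0 L))).toNNReal,
      ae_of_all _ fun _ => ?_⟩
    push_cast
    rw [ENNReal.coe_toNNReal h.memLp.2.ne, ENNReal.coe_toNNReal h.memLp_deriv.2.ne]
    exact ⟨le_self_add, le_add_self⟩

open Classical in
/-- Cut-off in time by a measurable set. -/
lemma ite (h : MemLinftyW1Per p L T v dv) {A : Set ℝ} (hA : MeasurableSet A) :
    MemLinftyW1Per p L T (fun t s => if t ∈ A then v t s else 0)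
      (fun t s => if t ∈ A then dv t s else 0) where
  aestronglyMeasurable := by
    have : (fun z : ℝ × ℝ => if z.1 ∈ A then v z.1 z.2 else 0) =
        (Prod.fst ⁻¹' A).indicator (fun z : ℝ × ℝ => v z.1 z.2) := by
      ext z; simp [indicator_apply]
    rw [this]
    exact h.aestronglyMeasurable.indicator (measurable_fst hA)
  aestronglyMeasurable_deriv := by
    have : (fun z : ℝ × ℝ => if z.1 ∈ A then dv z.1 z.2 else 0) =
        (Prod.fst ⁻¹' A).indicator (fun z : ℝ × ℝ => dv z.1 z.2) := by
      ext z; simp [indicator_apply]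
    rw [this]
    exact h.aestronglyMeasurable_deriv.indicator (measurable_fst hA)
  memW1Per := by
    filter_upwards [h.memW1Per] with t ht
    by_cases htA : t ∈ A
    · simpa [htA] using ht
    · simpa [htA] using MemW1Per.zero p L
  bounded := by
    obtain ⟨K, hK⟩ := h.bounded
    refine ⟨K, ?_⟩
    filter_upwards [hK] with t ht
    by_cases htA : t ∈ A
    · simpa [htA] using ht
    · simp [htA]

end MemLinftyW1Per

/-! ### Elementary consequences of the definition of weak solutions -/

namespace WeakSolution

variable {p L : ℝ} {η : ℕ} {T : ℝ} {u₀ : ℝ → ℝ}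

/-- The tangential angle `θ = u + φ`. -/
noncomputable def θ (U : WeakSolution p L η T u₀) (t s : ℝ) : ℝ := U.u t s + phi L η s

/-- The derivative `∂ₛθ`. -/
noncomputable def a (U : WeakSolution p L η T u₀) (t s : ℝ) : ℝ := U.us t s + dphi L η

/-- The lower order part `∂ₜu - λ₁ sin θ + λ₂ cos θ` of the equation. -/
noncomputable def drift (U : WeakSolution p L η T u₀) (t s : ℝ) : ℝ :=
  U.ut t s - U.lam₁ t * Real.sin (U.θ t s) + U.lam₂ t * Real.cos (U.θ t s)

end WeakSolution

lemma continuous_phi (L : ℝ) (η : ℕ) : Continuous (phi L η) := by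
  unfold phi; fun_prop

lemma hasDerivAt_phi (L : ℝ) (η : ℕ) (x : ℝ) : HasDerivAt (phi L η) (dphi L η) x := by
  have := ((hasDerivAt_id x).const_mul (2 * Real.pi * η)).div_const L
  rw [mul_one] at this
  exact this

lemma isPrimitive_phi (L : ℝ) (η : ℕ) (a b : ℝ) :
    IsPrimitive a b (phi L η) (fun _ => dphi L η) :=
  IsPrimitive.of_hasDerivAt (hasDerivAt_phi L η) continuous_const

lemma phi_add_period {L : ℝ} (hL : 0 < L) (η : ℕ) (s : ℝ) :
    phi L η (s + L) = phi L η s + η * (2 * Real.pi) := by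
  unfold phi; field_simp

namespace WeakSolution

variable {p L : ℝ} {η : ℕ} {T : ℝ} {u₀ : ℝ → ℝ} (U : WeakSolution p L η T u₀)

lemma continuous_u {t : ℝ} (ht : t ∈ Ico 0 T) : Continuous (U.u t) := by
  obtain ⟨du, h⟩ := U.memW1Per t ht
  exact h.continuous

lemma continuous_θ {t : ℝ} (ht : t ∈ Ico 0 T) : Continuous (U.θ t) :=
  (U.continuous_u ht).add (continuous_phi L η)

lemma ae_mem_Ico (T : ℝ) : ∀ᵐ t ∂(mu T), t ∈ Ico 0 T := by
  filter_upwards [ae_restrict_mem measurableSet_Ioo] with t ht using Ioo_subset_Ico_self ht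

lemma memLp_u : MemLp (fun z : ℝ × ℝ => U.u z.1 z.2) 2 ((mu T).prod (mu L)) := by
  rw [← cylinder_eq]; exact U.memH1L2.memLp

lemma memLp_ut : MemLp (fun z : ℝ × ℝ => U.ut z.1 z.2) 2 ((mu T).prod (mu L)) := by
  rw [← cylinder_eq]; exact U.memH1L2.memLp_deriv

lemma ae_memLp_ut : ∀ᵐ t ∂(mu T), MemLp (U.ut t) 2 (mu L) := by
  have h1 := U.memLp_ut.1.prodMk_left
  have h2 := U.memLp_ut.integrable_sq.prod_right_ae
  filter_upwards [h1, h2] with t h1 h2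
  exact (memLp_two_iff_integrable_sq h1).2 h2

lemma aestronglyMeasurable_θ :
    AEStronglyMeasurable (fun z : ℝ × ℝ => U.θ z.1 z.2) ((mu T).prod (mu L)) :=
  U.memLp_u.1.add (continuous_phi L η).aestronglyMeasurable.comp_snd

lemma memLp_drift : MemLp (fun z : ℝ × ℝ => U.drift z.1 z.2) 2 ((mu T).prod (mu L)) := by
  have h1 : MemLp (fun z : ℝ × ℝ => Real.sin (U.θ z.1 z.2) * U.lam₁ z.1) 2
      ((mu T).prod (mu L)) :=
    memLp_mul_of_bound (Real.continuous_sin.comp_aestronglyMeasurable U.aestronglyMeasurable_θ) 1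
      (ae_of_all _ fun z => Real.abs_sin_le_one _) (U.memLp_lam₁.comp_fst (mu L))
  have h2 : MemLp (fun z : ℝ × ℝ => Real.cos (U.θ z.1 z.2) * U.lam₂ z.1) 2
      ((mu T).prod (mu L)) :=
    memLp_mul_of_bound (Real.continuous_cos.comp_aestronglyMeasurable U.aestronglyMeasurable_θ) 1
      (ae_of_all _ fun z => Real.abs_cos_le_one _) (U.memLp_lam₂.comp_fst (mu L))
  refine ((U.memLp_ut.sub h1).add h2).ae_eq (ae_of_all _ fun z => ?_)
  simp only [drift, Pi.add_apply, Pi.sub_apply]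
  ring

lemma memLp_a (hp : 2 ≤ p) :
    MemLp (fun z : ℝ × ℝ => U.a z.1 z.2) (ENNReal.ofReal p) ((mu T).prod (mu L)) :=
  (U.memLinftyW1Per.memLp_deriv hp).add (memLp_const _)

lemma integrable_drift_mul (hp : 2 ≤ p) {v dv : ℝ → ℝ → ℝ} (hv : MemLinftyW1Per p L T v dv) :
    Integrable (fun z : ℝ × ℝ => U.drift z.1 z.2 * v z.1 z.2) ((mu T).prod (mu L)) :=
  integrable_mul_of_memLp_two U.memLp_drift (hv.memLp_two hp)

lemma integrable_flux_mul (hp : 2 ≤ p) {v dv : ℝ → ℝ → ℝ} (hv : MemLinftyW1Per p L T v dv) :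
    Integrable (fun z : ℝ × ℝ => pFlux p (U.a z.1 z.2) * dv z.1 z.2) ((mu T).prod (mu L)) :=
  integrable_pFlux_mul hp (U.memLp_a hp) (hv.memLp_deriv hp)

/-- The weak equation, localized in time. -/
lemma ae_equation (hp : 2 ≤ p) (hT : 0 < T) (hL : 0 < L) {v dv : ℝ → ℝ → ℝ}
    (hv : MemLinftyW1Per p L T v dv) :
    ∀ᵐ t ∂(mu T), (∫ s, U.drift t s * v t s ∂(mu L)) +
      ∫ s, pFlux p (U.a t s) * dv t s ∂(mu L) = 0 := by
  classical
  have i1 := U.integrable_drift_mul hp hv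
  have i2 := U.integrable_flux_mul hp hv
  have hint : Integrable (fun t => ∫ s, (U.drift t s * v t s + pFlux p (U.a t s) * dv t s) ∂(mu L))
      (mu T) := (i1.add i2).integral_prod_left
  have key : (fun t => ∫ s, (U.drift t s * v t s + pFlux p (U.a t s) * dv t s) ∂(mu L))
      =ᵐ[mu T] 0 := by
    -- Cutting the test function off to an arbitrary measurable set of times keeps it admissible, so
    -- the time density integrates to zero over every such set.
    refine hint.ae_eq_zero_of_forall_setIntegral_eq_zero fun A hA _ => ?_
    have h := U.weakEquation _ _ (hv.ite hA)
    rw [intervalIntegral_eq_mu hT.le] at h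
    rw [← integral_indicator hA, ← h]
    refine integral_congr_ae (ae_of_all _ fun t => ?_)
    simp only
    rw [intervalIntegral_eq_mu hL.le]
    by_cases ht : t ∈ A
    · simp only [indicator_of_mem ht, ht, if_true]; rfl
    · simp [ht]
  filter_upwards [key, i1.prod_right_ae, i2.prod_right_ae] with t h1 h2 h3
  rw [← integral_add h2 h3]
  exact h1

end WeakSolution

/-! ### Weak solutions as primitives in time with values in `L²` -/

namespace WeakSolution

variable {p L : ℝ} {η : ℕ} {T : ℝ} {u₀ : ℝ → ℝ} (U : WeakSolution p L η T u₀)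

/-- Moments against a bounded `χ` are scalar functions of time, to which the one-dimensional theory
of weak derivatives applies. -/
lemma hasWeakDeriv_moment (hT : 0 < T) {χ : ℝ → ℝ} (hχ : Measurable χ)
    (hχ1 : ∀ s, |χ s| ≤ 1)
    (hc : ContinuousOn (fun t => ∫ s, χ s * U.u t s ∂(mu L)) (Ico 0 T)) :
    HasWeakDeriv 0 T (fun t => ∫ s, χ s * U.u t s ∂(mu L))
      (fun t => ∫ s, χ s * U.ut t s ∂(mu L)) := by
  have hχm : ∀ ψ : ℝ → ℝ, Continuous ψ → AEStronglyMeasurable (fun z : ℝ × ℝ => χ z.2 * ψ z.1)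
      ((mu T).prod (mu L)) := fun ψ hψ =>
    hχ.aestronglyMeasurable.comp_snd.mul hψ.aestronglyMeasurable.comp_fst
  have iu : Integrable (fun z : ℝ × ℝ => U.u z.1 z.2) ((mu T).prod (mu L)) :=
    U.memLp_u.integrable (by norm_num)
  have iut : Integrable (fun z : ℝ × ℝ => U.ut z.1 z.2) ((mu T).prod (mu L)) :=
    U.memLp_ut.integrable (by norm_num)
  have in1 : Integrable (fun t => ∫ s, χ s * U.ut t s ∂(mu L)) (mu T) := by
    have : Integrable (fun z : ℝ × ℝ => χ z.2 * U.ut z.1 z.2) ((mu T).prod (mu L)) :=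
      integrable_mul_of_bound hχ.aestronglyMeasurable.comp_snd 1 (ae_of_all _ fun z => hχ1 _) iut
    exact this.integral_prod_left
  refine ⟨(hc.mono Ioo_subset_Ico_self).locallyIntegrableOn measurableSet_Ioo,
    IntegrableOn.locallyIntegrableOn in1, fun ψ h1 h2 h3 => ?_⟩
  have hd : Continuous (deriv ψ) := h1.continuous_deriv (by simp)
  have gen : ∀ (f : ℝ → ℝ → ℝ) (ξ : ℝ → ℝ), Continuous ξ → HasCompactSupport ξ →
      Integrable (fun z : ℝ × ℝ => f z.1 z.2) ((mu T).prod (mu L)) →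
      ∫ t in (0 : ℝ)..T, (∫ s, χ s * f t s ∂(mu L)) * ξ t =
        ∫ s, χ s * (∫ t in (0 : ℝ)..T, f t s * ξ t) ∂(mu L) := by
    intro f ξ hξ hξc hf
    obtain ⟨C, hC⟩ := hξc.exists_bound_of_continuous hξ
    have hi : Integrable (Function.uncurry fun t s => (χ s * ξ t) * f t s)
        ((mu T).prod (mu L)) := by
      refine integrable_mul_of_bound (hχm ξ hξ) C (ae_of_all _ fun z => ?_) hf
      rw [abs_mul]
      calc |χ z.2| * |ξ z.1| ≤ 1 * C :=
            mul_le_mul (hχ1 _) (hC _) (abs_nonneg _) zero_le_one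
        _ = C := one_mul C
    rw [intervalIntegral_eq_mu hT.le]
    simp_rw [intervalIntegral_eq_mu hT.le, ← integral_const_mul, ← integral_mul_const]
    have e : ∀ t s, χ s * f t s * ξ t = (χ s * ξ t) * f t s := fun t s => by ring
    have e2 : ∀ t s, χ s * (f t s * ξ t) = (χ s * ξ t) * f t s := fun t s => by ring
    simp_rw [e, e2]
    exact integral_integral_swap hi
  rw [gen U.u (deriv ψ) hd h2.deriv iu, gen U.ut ψ h1.continuous h2 iut, ← integral_neg]
  refine integral_congr_ae ?_
  filter_upwards [U.memH1L2.weakDeriv ψ h1 h2 h3] with s hs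
  rw [hs]; ring

lemma continuousOn_moment (hL : 0 < L) {χ : ℝ → ℝ} (hχ : Measurable χ) (hχ1 : ∀ s, |χ s| ≤ 1) :
    ContinuousOn (fun t => ∫ s, χ s * U.u t s ∂(mu L)) (Ico 0 T) := by
  intro t₀ ht₀
  have hχ2 : MemLp χ 2 (mu L) := memLp_of_bound hχ.aestronglyMeasurable 1 (ae_of_all _ hχ1)
  have hlim := U.continuous_time t₀ ht₀
  have hsq : Tendsto (fun t => (∫ s, χ s * U.u t s ∂(mu L) - ∫ s, χ s * U.u t₀ s ∂(mu L)) ^ 2)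
      (𝓝[Ico 0 T] t₀) (𝓝 0) := by
    have hlim2 := hlim.const_mul (∫ s, χ s ^ 2 ∂(mu L))
    rw [mul_zero] at hlim2
    refine squeeze_zero' (Eventually.of_forall fun t => sq_nonneg _) ?_ hlim2
    filter_upwards [self_mem_nhdsWithin] with t ht
    have m1 := Continuous.memLp_mu (U.continuous_u ht) 2 L
    have m2 := Continuous.memLp_mu (U.continuous_u ht₀) 2 L
    rw [← integral_sub (integrable_mul_of_memLp_two hχ2 m1) (integrable_mul_of_memLp_two hχ2 m2),
      intervalIntegral_eq_mu hL.le]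
    simp_rw [← mul_sub]
    exact sq_integral_mul_le hχ2 (m1.sub m2)
  have habs := hsq.sqrt
  simp_rw [Real.sqrt_sq_eq_abs, Real.sqrt_zero] at habs
  rw [ContinuousWithinAt, tendsto_iff_dist_tendsto_zero]
  exact habs

/-- Every moment against the indicator of a measurable set is continuous with an integrable weak
derivative, hence is a primitive reaching down to time zero. Indicators of all measurable sets
determine a function almost everywhere. -/
lemma isTimePrimitive (hT : 0 < T) (hL : 0 < L) : IsTimePrimitive T L U.u U.ut where
  memLp := U.memLp_u
  memLp_deriv := U.memLp_ut
  continuous t ht := U.continuous_u ht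
  eq τ hτ := by
    rcases hτ.1.eq_or_lt with h0 | h0
    · rw [← h0]; simp
    have iut : Integrable (fun z : ℝ × ℝ => U.ut z.1 z.2) ((mu T).prod (mu L)) :=
      U.memLp_ut.integrable (by norm_num)
    have hle : (mu τ).prod (mu L) ≤ (mu T).prod (mu L) := by
      rw [Measure.prod_restrict, Measure.prod_restrict]
      exact Measure.restrict_mono (prod_mono (Ioo_subset_Ioo_right hτ.2.le) le_rfl) le_rfl
    have iut' := iut.mono_measure hle
    have i0 : Integrable (fun s => ∫ σ in (0 : ℝ)..τ, U.ut σ s) (mu L) := by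
      simp_rw [intervalIntegral_eq_mu hτ.1]
      exact iut'.integral_prod_right
    have i1 := Continuous.integrable_mu (U.continuous_u hτ) L
    have i2 := Continuous.integrable_mu (U.continuous_u ⟨le_rfl, hT⟩) L
    have hi : Integrable (fun s => U.u τ s - U.u 0 s - ∫ σ in (0 : ℝ)..τ, U.ut σ s) (mu L) :=
      (i1.sub i2).sub i0
    have key := hi.ae_eq_zero_of_forall_setIntegral_eq_zero fun A hA _ => ?_
    · filter_upwards [key] with s hs
      change _ = (0 : ℝ) at hs
      linarith
    · set χ : ℝ → ℝ := A.indicator fun _ => 1 with hχd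
      have hχ : Measurable χ := measurable_const.indicator hA
      have hχ1 : ∀ s, |χ s| ≤ 1 := fun s => by
        by_cases hs : s ∈ A <;> simp [hχd, hs]
      have hA' : ∀ f : ℝ → ℝ, ∫ s in A, f s ∂(mu L) = ∫ s, χ s * f s ∂(mu L) := fun f => by
        rw [← integral_indicator hA]
        refine integral_congr_ae (ae_of_all _ fun s => ?_)
        by_cases hs : s ∈ A <;> simp [hχd, hs]
      have hχi : ∀ f : ℝ → ℝ, Integrable f (mu L) → Integrable (fun s => χ s * f s) (mu L) :=
        fun f hf => integrable_mul_of_bound hχ.aestronglyMeasurable 1 (ae_of_all _ hχ1) hf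
      have hc := U.continuousOn_moment hL hχ hχ1
      -- The interval is shortened to `(0, τ)` because continuity in time is available on `[0, T)`
      -- only.
      have hw := (U.hasWeakDeriv_moment hT hχ hχ1 hc).restrict h0.le hτ.2.le
      have hχut : Integrable (Function.uncurry fun t s => χ s * U.ut t s) ((mu τ).prod (mu L)) :=
        integrable_mul_of_bound (f := fun z : ℝ × ℝ => χ z.2)
          hχ.aestronglyMeasurable.comp_snd 1 (ae_of_all _ fun z => hχ1 _) iut'
      have hp := hw.isPrimitive h0 (hc.mono fun x hx => ⟨hx.1, hx.2.trans_lt hτ.2⟩)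
        ((intervalIntegrable_iff_mu h0.le _).2 hχut.integral_prod_left)
      have h1 := hp.integral_eq (left_mem_Icc.2 h0.le) (right_mem_Icc.2 h0.le)
      have h2 : ∫ t in (0 : ℝ)..τ, ∫ s, χ s * U.ut t s ∂(mu L) =
          ∫ s, χ s * (∫ σ in (0 : ℝ)..τ, U.ut σ s) ∂(mu L) := by
        rw [intervalIntegral_eq_mu h0.le]
        simp_rw [intervalIntegral_eq_mu h0.le, ← integral_const_mul]
        exact integral_integral_swap hχut
      rw [hA']
      simp_rw [mul_sub]
      rw [integral_sub (integrable_fun_sub (hχi _ i1) (hχi _ i2)) (hχi _ i0),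
        integral_sub (hχi _ i1) (hχi _ i2), ← h2, h1]
      ring

end WeakSolution

/-! ### Differentiated closing conditions and the linear system for the multipliers -/

/-- A bound on all interval integrals yields an almost everywhere bound. -/
lemma ae_le_of_intervalIntegral_le {T K : ℝ} (hT : 0 < T) {n : ℝ → ℝ} (hn : Integrable n (mu T))
    (h : ∀ t₁ t₂, 0 ≤ t₁ → t₁ ≤ t₂ → t₂ < T → ∫ t in t₁..t₂, n t ≤ K * (t₂ - t₁)) :
    ∀ᵐ t ∂(mu T), n t ≤ K := by
  have hi : IntervalIntegrable n volume 0 T := (intervalIntegrable_iff_mu hT.le _).2 hn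
  refine (ae_restrict_iff' measurableSet_Ioo).2 ?_
  -- Lebesgue differentiation: at almost every time `n` is the limit of its forward averages.
  filter_upwards [hi.ae_hasDerivAt_integral] with x hx hxI
  rw [uIcc_of_le hT.le] at hx
  have hd := (hx (Ioo_subset_Icc_self hxI) 0 (left_mem_Icc.2 hT.le)).hasDerivWithinAt (s := Ioi x)
  rw [hasDerivWithinAt_iff_tendsto_slope' self_notMem_Ioi] at hd
  refine le_of_tendsto hd ?_
  have : Ioo x T ∈ 𝓝[>] x := Ioo_mem_nhdsGT hxI.2
  filter_upwards [this] with y hy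
  have hsub : ∀ a b, 0 ≤ a → a ≤ b → b ≤ T → IntervalIntegrable n volume a b := fun a b h1 h2 h3 =>
    hi.mono_set (by rw [uIcc_of_le h2, uIcc_of_le hT.le]; exact Icc_subset_Icc h1 h3)
  have e := h x y hxI.1.le hy.1.le hy.2
  rw [slope_def_field, div_le_iff₀ (by linarith [hy.1])]
  rw [← intervalIntegral.integral_add_adjacent_intervals (hsub 0 x le_rfl hxI.1.le hxI.2.le)
    (hsub x y hxI.1.le hy.1.le hy.2.le)]
  linarith

lemma ae_eq_zero_of_intervalIntegral_eq_zero {T : ℝ} (hT : 0 < T) {n : ℝ → ℝ}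
    (hn : Integrable n (mu T)) (h : ∀ τ ∈ Ico 0 T, ∫ t in (0 : ℝ)..τ, n t = 0) :
    ∀ᵐ t ∂(mu T), n t = 0 := by
  have hi : IntervalIntegrable n volume 0 T := (intervalIntegrable_iff_mu hT.le _).2 hn
  have h' : ∀ t₁ t₂, 0 ≤ t₁ → t₁ ≤ t₂ → t₂ < T → ∫ t in t₁..t₂, n t = 0 := by
    intro t₁ t₂ h1 h2 h3
    have hsub : ∀ a b, 0 ≤ a → a ≤ b → b ≤ T → IntervalIntegrable n volume a b :=
      fun a b h1 h2 h3 =>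
        hi.mono_set (by rw [uIcc_of_le h2, uIcc_of_le hT.le]; exact Icc_subset_Icc h1 h3)
    have e := intervalIntegral.integral_add_adjacent_intervals
      (hsub 0 t₁ le_rfl h1 (by linarith)) (hsub t₁ t₂ h1 h2 h3.le)
    rw [h t₁ ⟨h1, by linarith⟩, h t₂ ⟨by linarith, h3⟩] at e
    linarith
  have h1 := ae_le_of_intervalIntegral_le (K := 0) hT hn fun t₁ t₂ a b c => by
    rw [h' t₁ t₂ a b c]; simp
  have h2 := ae_le_of_intervalIntegral_le (K := 0) hT hn.neg fun t₁ t₂ a b c => by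
    have := h' t₁ t₂ a b c
    simp [this]
  filter_upwards [h1, h2] with t h1 h2
  simp only [Pi.neg_apply] at h2
  linarith

namespace WeakSolution

variable {p L : ℝ} {η : ℕ} {T : ℝ} {u₀ : ℝ → ℝ} (U : WeakSolution p L η T u₀)

/-- `∫ |∂ₛθ|^p`. -/
noncomputable def energy (t : ℝ) : ℝ := ∫ s, |U.a t s| ^ p ∂(mu L)

lemma energy_nonneg (t : ℝ) : 0 ≤ U.energy t := integral_nonneg fun _ => by positivity

lemma ae_isPrimitive_θ (hp : 2 ≤ p) (hL : 0 < L) :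
    ∀ᵐ t ∂(mu T), IsPrimitive 0 L (U.θ t) (U.a t) := by
  filter_upwards [U.memLinftyW1Per.memW1Per] with t ht
  exact (ht.isPrimitive hp hL).add (isPrimitive_phi L η 0 L)

lemma ae_memLp_a : ∀ᵐ t ∂(mu T), MemLp (U.a t) (ENNReal.ofReal p) (mu L) := by
  filter_upwards [U.memLinftyW1Per.memW1Per] with t ht
  exact ht.memLp_deriv.add (memLp_const _)

lemma θ_add_period (hL : 0 < L) {t : ℝ} (ht : t ∈ Ico 0 T) (s : ℝ) :
    U.θ t (s + L) = U.θ t s + η * (2 * Real.pi) := by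
  obtain ⟨du, h⟩ := U.memW1Per t ht
  simp only [θ, phi_add_period hL, h.periodic s]
  ring

lemma winding (hL : 0 < L) {t : ℝ} (ht : t ∈ Ico 0 T) :
    U.θ t L = U.θ t 0 + 2 * Real.pi * η := by
  have := U.θ_add_period hL ht 0
  rw [zero_add] at this
  rw [this]; ring

/-- The angle gains `η * (2 * π)` over a period, which the `2π`-periodicity of `Φ` absorbs; thus `Φ
∘ θ` is an admissible test function although `θ` is not periodic. -/
lemma memLinftyW1Per_comp (hp : 2 ≤ p) (hL : 0 < L) {Φ Φ' : ℝ → ℝ}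
    (hΦ : ∀ x, HasDerivAt Φ (Φ' x) x) (hΦ' : Continuous Φ') (h1 : ∀ x, |Φ x| ≤ 1)
    (h2 : ∀ x, |Φ' x| ≤ 1) (hper : Function.Periodic Φ (2 * Real.pi)) :
    MemLinftyW1Per p L T (fun t s => Φ (U.θ t s)) (fun t s => Φ' (U.θ t s) * U.a t s) := by
  have hΦc : Continuous Φ := continuous_iff_continuousAt.2 fun x => (hΦ x).continuousAt
  have hlip : LipschitzWith 1 Φ := by
    refine lipschitzWith_of_nnnorm_deriv_le (fun x => (hΦ x).differentiableAt) fun x => ?_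
    rw [(hΦ x).deriv, ← NNReal.coe_le_coe, coe_nnnorm]
    exact h2 x
  have hq : 1 ≤ ENNReal.ofReal p := le_trans (by norm_num) (two_le_ofReal hp)
  have hmul : ∀ᵐ t ∂(mu T), MemLp (fun s => Φ' (U.θ t s) * U.a t s) (ENNReal.ofReal p) (mu L) := by
    filter_upwards [U.ae_memLp_a, ae_mem_Ico T] with t ha htI
    exact memLp_mul_of_bound (hΦ'.comp (U.continuous_θ htI)).aestronglyMeasurable 1
      (ae_of_all _ fun s => h2 _) ha
  refine ⟨?_, ?_, ?_, ?_⟩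
  · rw [cylinder_eq]; exact hΦc.comp_aestronglyMeasurable U.aestronglyMeasurable_θ
  · rw [cylinder_eq]
    exact (hΦ'.comp_aestronglyMeasurable U.aestronglyMeasurable_θ).mul (U.memLp_a hp).1
  · filter_upwards [U.ae_isPrimitive_θ hp hL, hmul, ae_mem_Ico T] with t ht hm htI
    refine (ht.comp hL.le hΦ hlip).memW1Per hL (hΦc.comp (U.continuous_θ htI)) (fun s => ?_) hm
    change Φ (U.θ t (s + L)) = Φ (U.θ t s)
    rw [U.θ_add_period hL htI]
    exact hper.nat_mul η _
  · obtain ⟨K, hK⟩ := U.memLinftyW1Per.bounded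
    have hc : ∀ c : ℝ, MemLp (fun _ : ℝ => c) (ENNReal.ofReal p) (mu L) := fun c => memLp_const c
    refine ⟨(eLpNorm (fun _ : ℝ => (1 : ℝ)) (ENNReal.ofReal p) (mu L)).toNNReal +
      (K + (eLpNorm (fun _ : ℝ => dphi L η) (ENNReal.ofReal p) (mu L)).toNNReal), ?_⟩
    filter_upwards [hK, U.memLinftyW1Per.memW1Per] with t ht hm
    push_cast
    rw [ENNReal.coe_toNNReal (hc _).2.ne, ENNReal.coe_toNNReal (hc _).2.ne]
    constructor
    · refine le_trans (eLpNorm_mono fun s => ?_) le_self_add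
      simpa using h1 _
    · refine le_trans ?_ le_add_self
      calc eLpNorm (fun s => Φ' (U.θ t s) * U.a t s) (ENNReal.ofReal p) (mu L)
          ≤ eLpNorm (U.a t) (ENNReal.ofReal p) (mu L) := by
            refine eLpNorm_mono fun s => ?_
            rw [norm_mul]
            exact mul_le_of_le_one_left (norm_nonneg _) (h2 _)
        _ ≤ _ := (eLpNorm_add_le hm.memLp_deriv.1 (hc _).1 hq).trans (by gcongr; exact ht.2)

lemma memLinftyW1Per_sin (hp : 2 ≤ p) (hL : 0 < L) :
    MemLinftyW1Per p L T (fun t s => Real.sin (U.θ t s))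
      (fun t s => Real.cos (U.θ t s) * U.a t s) :=
  U.memLinftyW1Per_comp hp hL Real.hasDerivAt_sin Real.continuous_cos Real.abs_sin_le_one
    Real.abs_cos_le_one Real.sin_periodic

lemma memLinftyW1Per_cos (hp : 2 ≤ p) (hL : 0 < L) :
    MemLinftyW1Per p L T (fun t s => Real.cos (U.θ t s))
      (fun t s => -Real.sin (U.θ t s) * U.a t s) :=
  U.memLinftyW1Per_comp hp hL Real.hasDerivAt_cos Real.continuous_sin.neg Real.abs_cos_le_one
    (fun x => by rw [abs_neg]; exact Real.abs_sin_le_one x) Real.cos_periodic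

lemma integral_cos_eq_zero (hL : 0 < L) {t : ℝ} (ht : t ∈ Ico 0 T) :
    ∫ s, Real.cos (U.θ t s) ∂(mu L) = 0 := by
  rw [← intervalIntegral_eq_mu hL.le]; exact U.closed_cos t ht

lemma integral_sin_eq_zero (hL : 0 < L) {t : ℝ} (ht : t ∈ Ico 0 T) :
    ∫ s, Real.sin (U.θ t s) ∂(mu L) = 0 := by
  rw [← intervalIntegral_eq_mu hL.le]; exact U.closed_sin t ht

/-- The closing integrals vanish at all times, so their time derivatives vanish: `∂ₜu` is orthogonal
to `sin θ` and `cos θ`. -/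
lemma ae_integral_ut_mul_trig (hT : 0 < T) (hL : 0 < L) :
    ∀ᵐ t ∂(mu T), ∫ s, Real.sin (U.θ t s) * U.ut t s ∂(mu L) = 0 ∧
      ∫ s, Real.cos (U.θ t s) * U.ut t s ∂(mu L) = 0 := by
  have hi : Integrable (fun z : ℝ × ℝ => U.ut z.1 z.2) ((mu T).prod (mu L)) :=
    U.memLp_ut.integrable (by norm_num)
  have gen : ∀ Φ Φ' : ℝ → ℝ, (∀ x, HasDerivAt Φ (Φ' x) x) → Continuous Φ' → (∀ x, |Φ' x| ≤ 1) →
      (∀ t ∈ Ico 0 T, ∫ s, Φ (U.θ t s) ∂(mu L) = 0) →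
      ∀ᵐ t ∂(mu T), ∫ s, Φ' (U.θ t s) * U.ut t s ∂(mu L) = 0 := by
    intro Φ Φ' hΦ hΦ' h1 h0
    refine ae_eq_zero_of_intervalIntegral_eq_zero hT ?_ fun τ hτ => ?_
    · have : Integrable (fun z : ℝ × ℝ => Φ' (U.θ z.1 z.2) * U.ut z.1 z.2)
          ((mu T).prod (mu L)) :=
        integrable_mul_of_bound (hΦ'.comp_aestronglyMeasurable U.aestronglyMeasurable_θ) 1
          (ae_of_all _ fun z => h1 _) hi
      exact this.integral_prod_left
    · have := (U.isTimePrimitive hT hL).integral_comp_sub hT hτ (continuous_phi L η) hΦ hΦ'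
        (K := 1) (by simpa using h1)
      have e1 := h0 τ hτ
      have e2 := h0 0 ⟨le_rfl, hT⟩
      simp only [θ] at e1 e2
      rw [e1, e2, sub_zero] at this
      exact this.symm
  filter_upwards [gen (fun x => -Real.cos x) Real.sin
      (fun x => by have := (Real.hasDerivAt_cos x).neg; rw [neg_neg] at this; exact this) Real.continuous_sin Real.abs_sin_le_one
      (fun t ht => by rw [integral_neg, U.integral_cos_eq_zero hL ht, neg_zero]),
    gen Real.sin Real.cos Real.hasDerivAt_sin Real.continuous_cos Real.abs_cos_le_one
      (fun t ht => U.integral_sin_eq_zero hL ht)] with t h1 h2 using ⟨h1, h2⟩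

/-- The linear system for the Lagrange multipliers. -/
lemma ae_system (hp : 2 ≤ p) (hT : 0 < T) (hL : 0 < L) :
    ∀ᵐ t ∂(mu T), (U.lam₁ t * (∫ s, Real.sin (U.θ t s) ^ 2 ∂(mu L)) -
        U.lam₂ t * (∫ s, Real.sin (U.θ t s) * Real.cos (U.θ t s) ∂(mu L)) =
          ∫ s, |U.a t s| ^ p * Real.cos (U.θ t s) ∂(mu L)) ∧
      (-U.lam₁ t * (∫ s, Real.sin (U.θ t s) * Real.cos (U.θ t s) ∂(mu L)) +
        U.lam₂ t * (∫ s, Real.cos (U.θ t s) ^ 2 ∂(mu L)) =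
          ∫ s, |U.a t s| ^ p * Real.sin (U.θ t s) ∂(mu L)) := by
  -- Tested with `sin θ` and `cos θ`, the equation loses `∂ₜu` by orthogonality, and the flux term
  -- becomes `|a| ^ p` times `cos θ` or `-sin θ`.
  filter_upwards [U.ae_equation hp hT hL (U.memLinftyW1Per_sin hp hL),
    U.ae_equation hp hT hL (U.memLinftyW1Per_cos hp hL), U.ae_integral_ut_mul_trig hT hL,
    U.ae_memLp_ut, ae_mem_Ico T] with t h1 h2 h3 h4 htI
  have hc := U.continuous_θ htI
  have is : Integrable (fun s => Real.sin (U.θ t s) ^ 2) (mu L) :=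
    Continuous.integrable_mu (by fun_prop) L
  have isc : Integrable (fun s => Real.sin (U.θ t s) * Real.cos (U.θ t s)) (mu L) :=
    Continuous.integrable_mu (by fun_prop) L
  have ic : Integrable (fun s => Real.cos (U.θ t s) ^ 2) (mu L) :=
    Continuous.integrable_mu (by fun_prop) L
  have i4 := h4.integrable (q := 2) (by norm_num)
  have ius : Integrable (fun s => Real.sin (U.θ t s) * U.ut t s) (mu L) :=
    integrable_mul_of_bound (Real.continuous_sin.comp hc).aestronglyMeasurable 1
      (ae_of_all _ fun s => Real.abs_sin_le_one _) i4
  have iuc : Integrable (fun s => Real.cos (U.θ t s) * U.ut t s) (mu L) :=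
    integrable_mul_of_bound (Real.continuous_cos.comp hc).aestronglyMeasurable 1
      (ae_of_all _ fun s => Real.abs_cos_le_one _) i4
  have e1 : ∀ s, U.drift t s * Real.sin (U.θ t s) = Real.sin (U.θ t s) * U.ut t s -
      U.lam₁ t * Real.sin (U.θ t s) ^ 2 + U.lam₂ t * (Real.sin (U.θ t s) * Real.cos (U.θ t s)) :=
    fun s => by simp only [drift]; ring
  have e2 : ∀ s, U.drift t s * Real.cos (U.θ t s) = Real.cos (U.θ t s) * U.ut t s -
      U.lam₁ t * (Real.sin (U.θ t s) * Real.cos (U.θ t s)) + U.lam₂ t * Real.cos (U.θ t s) ^ 2 :=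
    fun s => by simp only [drift]; ring
  have e3 : ∀ s, pFlux p (U.a t s) * (Real.cos (U.θ t s) * U.a t s) =
      |U.a t s| ^ p * Real.cos (U.θ t s) := fun s => by
    rw [← pFlux_mul_self hp]; ring
  have e4 : ∀ s, pFlux p (U.a t s) * (-Real.sin (U.θ t s) * U.a t s) =
      -(|U.a t s| ^ p * Real.sin (U.θ t s)) := fun s => by
    rw [← pFlux_mul_self hp]; ring
  simp_rw [e1, e3] at h1
  simp_rw [e2, e4] at h2
  rw [integral_add (integrable_fun_sub ius (is.const_mul _)) (isc.const_mul _),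
    integral_sub ius (is.const_mul _), integral_const_mul, integral_const_mul, h3.1] at h1
  rw [integral_add (integrable_fun_sub iuc (isc.const_mul _)) (ic.const_mul _),
    integral_sub iuc (isc.const_mul _), integral_const_mul, integral_const_mul, h3.2,
    integral_neg] at h2
  exact ⟨by linarith, by linarith⟩

end WeakSolution

lemma abs_integral_mul_le_of_abs_le_one {L : ℝ} {f g : ℝ → ℝ} (hf : Integrable f (mu L))
    (hf0 : ∀ s, 0 ≤ f s) (hg : ∀ s, |g s| ≤ 1) :
    |∫ s, f s * g s ∂(mu L)| ≤ ∫ s, f s ∂(mu L) := by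
  refine abs_integral_le_integral_abs.trans (integral_mono_of_nonneg
    (ae_of_all _ fun _ => abs_nonneg _) hf (ae_of_all _ fun s => ?_))
  simp only [abs_mul, abs_of_nonneg (hf0 s)]
  exact mul_le_of_le_one_right (hf0 s) (hg s)

/-- A bound for the multipliers in terms of the energy. -/
noncomputable def lamBound (L E : ℝ) : ℝ := (L + E) / Real.pi ^ 2 * (2 * E)

lemma lamBound_mono {L E E' : ℝ} (hL : 0 ≤ L) (hE : 0 ≤ E) (h : E ≤ E') :
    lamBound L E ≤ lamBound L E' := by
  have hE' := hE.trans h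
  unfold lamBound
  gcongr

lemma lamBound_nonneg {L E : ℝ} (hL : 0 ≤ L) (hE : 0 ≤ E) : 0 ≤ lamBound L E := by
  unfold lamBound; positivity

lemma abs_le_lamBound {p L : ℝ} (hp : 2 ≤ p) (hL : 0 < L) {η : ℕ} (hη : 1 ≤ η) {θ a : ℝ → ℝ}
    (h : IsPrimitive 0 L θ a) (hθ : Continuous θ) (hw : θ L = θ 0 + 2 * Real.pi * η)
    (ha : MemLp a (ENNReal.ofReal p) (mu L)) {x y : ℝ}
    (h₁ : x * (∫ s, Real.sin (θ s) ^ 2 ∂(mu L)) -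
      y * (∫ s, Real.sin (θ s) * Real.cos (θ s) ∂(mu L)) =
        ∫ s, |a s| ^ p * Real.cos (θ s) ∂(mu L))
    (h₂ : -x * (∫ s, Real.sin (θ s) * Real.cos (θ s) ∂(mu L)) +
      y * (∫ s, Real.cos (θ s) ^ 2 ∂(mu L)) = ∫ s, |a s| ^ p * Real.sin (θ s) ∂(mu L)) :
    |x| ≤ lamBound L (∫ s, |a s| ^ p ∂(mu L)) ∧ |y| ≤ lamBound L (∫ s, |a s| ^ p ∂(mu L)) := by
  have hB := integral_sq_le hp ha
  rw [mu_real_univ hL.le] at hB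
  have key := sq_add_sq_le_of_system hL hη h hθ hw (memLp_two_of_memLp hp ha) hB h₁ h₂
  have hi := integrable_abs_rpow hp ha
  have hc := abs_integral_mul_le_of_abs_le_one hi (fun s => by positivity)
    (fun s => Real.abs_cos_le_one (θ s))
  have hs := abs_integral_mul_le_of_abs_le_one hi (fun s => by positivity)
    (fun s => Real.abs_sin_le_one (θ s))
  set E := ∫ s, |a s| ^ p ∂(mu L) with hE
  have hE0 : 0 ≤ E := integral_nonneg fun _ => by positivity
  -- The integral of `a ^ 2` is at most `L + E`, and each right-hand side is at most `E` in modulus,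
  -- so the sum of their squares is at most `(2 * E) ^ 2`.
  have hbound : x ^ 2 + y ^ 2 ≤ lamBound L E ^ 2 := by
    refine key.trans ?_
    unfold lamBound
    rw [mul_pow]
    refine mul_le_mul_of_nonneg_left ?_ (sq_nonneg _)
    have c2 := sq_le_sq' (by linarith [neg_le_of_abs_le hc]) (le_of_abs_le hc)
    have s2 := sq_le_sq' (by linarith [neg_le_of_abs_le hs]) (le_of_abs_le hs)
    nlinarith
  have h0 := lamBound_nonneg hL.le hE0
  exact ⟨abs_le_of_sq_le_sq (by nlinarith [sq_nonneg y]) h0,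
    abs_le_of_sq_le_sq (by nlinarith [sq_nonneg x]) h0⟩

lemma WeakSolution.ae_abs_lam_le {p L : ℝ} (hp : 2 ≤ p) (hL : 0 < L) {η : ℕ} (hη : 1 ≤ η) {T : ℝ}
    (hT : 0 < T) {u₀ : ℝ → ℝ} (U : WeakSolution p L η T u₀) :
    ∀ᵐ t ∂(mu T), |U.lam₁ t| ≤ lamBound L (U.energy t) ∧ |U.lam₂ t| ≤ lamBound L (U.energy t) := by
  filter_upwards [U.ae_system hp hT hL, U.ae_isPrimitive_θ hp hL, U.ae_memLp_a, WeakSolution.ae_mem_Ico T]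
    with t h1 h2 h3 htI
  exact abs_le_lamBound hp hL hη h2 (U.continuous_θ htI) (U.winding hL htI) h3 h1.1 h1.2

lemma intervalIntegrable_of_mu {T : ℝ} {n : ℝ → ℝ} (hn : Integrable n (mu T)) {a b : ℝ}
    (h1 : 0 ≤ a) (h2 : a ≤ b) (h3 : b ≤ T) : IntervalIntegrable n volume a b := by
  have hT : 0 ≤ T := h1.trans (h2.trans h3)
  refine ((intervalIntegrable_iff_mu hT _).2 hn).mono_set ?_
  rw [uIcc_of_le h2, uIcc_of_le hT]; exact Icc_subset_Icc h1 h3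

lemma ae_Ioc_of_ae_mu {T : ℝ} {P : ℝ → Prop} (h : ∀ᵐ t ∂(mu T), P t) {a b : ℝ}
    (h1 : 0 ≤ a) (h3 : b < T) : ∀ᵐ t ∂volume, t ∈ Ioc a b → P t := by
  have := (ae_restrict_iff' measurableSet_Ioo).1 h
  filter_upwards [this] with t ht hI
  exact ht ⟨h1.trans_lt hI.1, hI.2.trans_lt h3⟩

lemma intervalIntegral_mono_mu {T : ℝ} {f g : ℝ → ℝ} {a b : ℝ} (h1 : 0 ≤ a) (h2 : a ≤ b)
    (h3 : b < T) (hf : IntervalIntegrable f volume a b) (hg : IntervalIntegrable g volume a b)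
    (h : ∀ᵐ t ∂(mu T), t ∈ Ioc a b → f t ≤ g t) : ∫ t in a..b, f t ≤ ∫ t in a..b, g t := by
  refine intervalIntegral.integral_mono_ae_restrict h2 hf hg ?_
  rw [← restrict_Ioc_eq_restrict_Icc]
  refine (ae_restrict_iff' measurableSet_Ioc).2 ?_
  filter_upwards [ae_Ioc_of_ae_mu h h1 h3] with t ht hI using ht hI hI

/-! ### The energy inequality -/

/-- If all weighted forward averages of `E` starting at `x` are at most `E x`, and those
starting at `0` are at most `e₀`, then `E ≤ e₀`. -/
lemma ae_le_of_forward_average_le {T e₀ : ℝ} (hT : 0 < T) {E w : ℝ → ℝ}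
    (hE : Integrable E (mu T)) (hw : Continuous w) (hw0 : ∀ x, 0 < w x)
    (H0 : ∀ y, 0 ≤ y → y < T → ∫ t in (0 : ℝ)..y, w t * (E t - e₀) ≤ 0)
    (H1 : ∀ᵐ x ∂(mu T), ∀ y, x ≤ y → y < T → ∫ t in x..y, w t * (E t - E x) ≤ 0) :
    ∀ᵐ x ∂(mu T), E x ≤ e₀ := by
  have hEI : IntervalIntegrable E volume 0 T := (intervalIntegrable_iff_mu hT.le _).2 hE
  have hwE : ∀ c : ℝ, IntervalIntegrable (fun t => w t * (E t - c)) volume 0 T := fun c =>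
    (hEI.sub intervalIntegrable_const).continuousOn_mul hw.continuousOn
  have hwE' : ∀ c : ℝ, Integrable (fun t => w t * (E t - c)) (mu T) := fun c =>
    (intervalIntegrable_iff_mu hT.le _).1 (hwE c)
  have key : ∀ x₁ y, 0 ≤ x₁ → x₁ < y → y < T → ∫ t in x₁..y, w t * (E t - e₀) ≤ 0 := by
    intro x₁ y hx₁ hxy hyT
    set D : ℝ → ℝ := fun x => ∫ t in x..y, w t with hD
    set P : ℝ → ℝ := fun x => ∫ t in x..y, w t * (E t - e₀) with hP
    have hDpos : ∀ x ∈ Icc 0 x₁, 0 < D x := fun x hx =>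
      intervalIntegral.intervalIntegral_pos_of_pos (hw.intervalIntegrable _ _) hw0
        (hx.2.trans_lt hxy)
    have hDd : ∀ x, HasDerivAt D (-w x) x := fun x => by
      have := (hw.integral_hasStrictDerivAt y x).hasDerivAt.neg
      refine this.congr_of_eventuallyEq (Eventually.of_forall fun z => ?_)
      simp only [hD, Pi.neg_apply]
      exact intervalIntegral.integral_symm _ _
    have hDc : Continuous D := continuous_iff_continuousAt.2 fun x => (hDd x).continuousAt
    have hQ : IsPrimitive 0 x₁ (fun x => (D x)⁻¹) (fun x => w x / D x ^ 2) := by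
      refine IsPrimitive.of_hasDerivAt_Icc hx₁ (fun x hx => ?_) ?_
      · have := (hDd x).inv (hDpos x hx).ne'
        rw [neg_neg] at this
        exact this
      · exact hw.continuousOn.div (hDc.continuousOn.pow 2)
          fun x hx => pow_ne_zero 2 (hDpos x hx).ne'
    have hPp : IsPrimitive 0 x₁ P (fun x => -(w x * (E x - e₀))) := by
      refine ⟨(intervalIntegrable_of_mu (hwE' e₀) le_rfl hx₁ (hxy.le.trans hyT.le)).neg,
        fun x hx => ?_⟩
      have := intervalIntegral.integral_add_adjacent_intervals
        (intervalIntegrable_of_mu (hwE' e₀) le_rfl hx.1 (hx.2.trans (hxy.le.trans hyT.le)))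
        (intervalIntegrable_of_mu (hwE' e₀) hx.1 (hx.2.trans hxy.le) hyT.le)
      simp only [hP, intervalIntegral.integral_neg]
      linarith
    -- The quotient `P / D` is the weighted average of `E - e₀` over `[x, y]`. Its derivative in `x`
    -- is `w / D ^ 2 * (P - (E - e₀) * D)`, which is nonpositive by `H1`; so the sign given at `0`
    -- by `H0` persists up to `x₁`.
    have hm := hPp.mul hQ hx₁
    have hint := hm.integral_eq (left_mem_Icc.2 hx₁) (right_mem_Icc.2 hx₁)
    have hneg : ∫ x in (0 : ℝ)..x₁, (-(w x * (E x - e₀)) * (D x)⁻¹ + P x * (w x / D x ^ 2)) ≤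
        ∫ _ in (0 : ℝ)..x₁, (0 : ℝ) := by
      refine intervalIntegral_mono_mu (T := T) le_rfl hx₁ (hxy.trans hyT) hm.integrable
        intervalIntegrable_const ?_
      filter_upwards [H1] with x hx hxI
      have h1 := hx y (hxI.2.trans hxy.le) hyT
      have hxm : x ∈ Icc 0 x₁ := ⟨hxI.1.le, hxI.2⟩
      have hDx := hDpos x hxm
      have h2 : ∫ t in x..y, w t * (E t - E x) = P x - (E x - e₀) * D x := by
        have e : ∀ t, w t * (E t - E x) = w t * (E t - e₀) - (E x - e₀) * w t := fun t => by ring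
        simp_rw [e]
        rw [intervalIntegral.integral_sub
          (intervalIntegrable_of_mu (hwE' e₀) hxm.1 (hxm.2.trans hxy.le) hyT.le)
          ((hw.intervalIntegrable _ _).const_mul _), intervalIntegral.integral_const_mul]
      rw [h2] at h1
      have e : -(w x * (E x - e₀)) * (D x)⁻¹ + P x * (w x / D x ^ 2) =
          w x / D x ^ 2 * (P x - (E x - e₀) * D x) := by
        field_simp
        ring
      rw [e]
      exact mul_nonpos_of_nonneg_of_nonpos (div_nonneg (hw0 x).le (sq_nonneg _)) h1
    rw [hint] at hneg
    simp only [intervalIntegral.integral_zero] at hneg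
    have hP0 : P 0 * (D 0)⁻¹ ≤ 0 := mul_nonpos_of_nonpos_of_nonneg (H0 y (hx₁.trans hxy.le) hyT)
      (inv_nonneg.2 (hDpos 0 (left_mem_Icc.2 hx₁)).le)
    have hP1 : P x₁ * (D x₁)⁻¹ ≤ 0 := by linarith
    by_contra! hcon
    have : 0 < P x₁ * (D x₁)⁻¹ := mul_pos hcon (inv_pos.2 (hDpos x₁ (right_mem_Icc.2 hx₁)))
    linarith
  have := ae_le_of_intervalIntegral_le (K := 0) hT (hwE' e₀) fun t₁ t₂ h1 h2 h3 => by
    rcases h2.eq_or_lt with h | h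
    · rw [h]; simp
    · simpa using key t₁ t₂ h1 h h3
  filter_upwards [this] with x hx
  by_contra! hcon
  have := mul_pos (hw0 x) (sub_pos.2 hcon)
  linarith

lemma IsTimePrimitive.isPrimitive_sq {T L : ℝ} {v g : ℝ → ℝ → ℝ} (hT : 0 < T)
    (h : IsTimePrimitive T L v g) {τ : ℝ} (hτ : τ ∈ Ico 0 T) :
    IsPrimitive 0 τ (fun t => ∫ s, v t s ^ 2 ∂(mu L)) (fun t => 2 * ∫ s, g t s * v t s ∂(mu L)) where
  integrable := by
    refine intervalIntegrable_of_mu ?_ le_rfl hτ.1 hτ.2.le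
    exact (integrable_mul_of_memLp_two h.memLp_deriv h.memLp).integral_prod_left.const_mul 2
  eq t ht := by
    rw [← h.integral_sq_sub hT ⟨ht.1, ht.2.trans_lt hτ.2⟩]; ring

namespace WeakSolution

variable {p L : ℝ} {η : ℕ} {T : ℝ} {u₀ : ℝ → ℝ} (U : WeakSolution p L η T u₀)

lemma integrable_energy (hp : 2 ≤ p) : Integrable U.energy (mu T) :=
  (integrable_abs_rpow hp (U.memLp_a hp)).integral_prod_left

/-- The contribution of the Lagrange multipliers is quadratic. -/
lemma integral_drift_mul_sub (hL : 0 < L) {t : ℝ} (ht : t ∈ Ico 0 T)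
    (hut : MemLp (U.ut t) 2 (mu L)) {w : ℝ → ℝ} (hw : Continuous w)
    (hwc : ∫ s, Real.cos (w s + phi L η s) ∂(mu L) = 0)
    (hws : ∫ s, Real.sin (w s + phi L η s) ∂(mu L) = 0) {Λ : ℝ} (h1 : |U.lam₁ t| ≤ Λ)
    (h2 : |U.lam₂ t| ≤ Λ) :
    |(∫ s, U.drift t s * (U.u t s - w s) ∂(mu L)) - ∫ s, U.ut t s * (U.u t s - w s) ∂(mu L)| ≤
      2 * Λ * ∫ s, (U.u t s - w s) ^ 2 ∂(mu L) := by
  have hc := U.continuous_θ ht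
  have hcu := U.continuous_u ht
  have hϑ : Continuous (fun s => w s + phi L η s) := hw.add (continuous_phi L η)
  have e : ∀ s, U.u t s - w s = U.θ t s - (w s + phi L η s) := fun s => by simp only [θ]; ring
  have b1 := abs_integral_sin_mul_le (L := L) hc hϑ (by rw [U.integral_cos_eq_zero hL ht, hwc])
  have b2 := abs_integral_cos_mul_le (L := L) hc hϑ (by rw [U.integral_sin_eq_zero hL ht, hws])
  simp_rw [← e] at b1 b2
  have hz : Continuous (fun s => U.u t s - w s) := hcu.sub hw
  have i1 : Integrable (fun s => U.ut t s * (U.u t s - w s)) (mu L) :=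
    integrable_mul_of_memLp_two hut (Continuous.memLp_mu hz 2 L)
  have i2 : Integrable (fun s => Real.sin (U.θ t s) * (U.u t s - w s)) (mu L) :=
    Continuous.integrable_mu (by fun_prop) L
  have i3 : Integrable (fun s => Real.cos (U.θ t s) * (U.u t s - w s)) (mu L) :=
    Continuous.integrable_mu (by fun_prop) L
  have e1 : ∀ s, U.drift t s * (U.u t s - w s) = U.ut t s * (U.u t s - w s) -
      U.lam₁ t * (Real.sin (U.θ t s) * (U.u t s - w s)) +
      U.lam₂ t * (Real.cos (U.θ t s) * (U.u t s - w s)) := fun s => by simp only [drift]; ring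
  simp_rw [e1]
  rw [integral_add (integrable_fun_sub i1 (i2.const_mul _)) (i3.const_mul _),
    integral_sub i1 (i2.const_mul _), integral_const_mul, integral_const_mul]
  have hY : 0 ≤ ∫ s, (U.u t s - w s) ^ 2 ∂(mu L) := integral_nonneg fun _ => sq_nonneg _
  have c1 := mul_le_mul h1 b1 (abs_nonneg _) ((abs_nonneg _).trans h1)
  have c2 := mul_le_mul h2 b2 (abs_nonneg _) ((abs_nonneg _).trans h2)
  rw [← abs_mul] at c1 c2
  rw [abs_le] at c1 c2 ⊢
  constructor <;> linarith [c1.1, c1.2, c2.1, c2.2]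

/-- The test function is the difference to the profile frozen at `t₀`. Convexity bounds the energy
increment by `p` times its pairing with the flux, and the equation trades that for the pairing of
`-∂ₜu` with the difference, up to a quadratic multiplier term. The rate `4 * Λ` in the weight makes
the resulting bound an exact derivative, namely of `-p / 2` times the weighted squared distance to
the frozen profile. -/
lemma forward_average_energy_le (hp : 2 ≤ p) (hT : 0 < T) (hL : 0 < L) {Λ : ℝ}
    (hΛ : ∀ᵐ t ∂(mu T), |U.lam₁ t| ≤ Λ ∧ |U.lam₂ t| ≤ Λ) {t₀ : ℝ} (ht₀ : t₀ ∈ Ico 0 T)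
    {db : ℝ → ℝ} (hb : MemW1Per p L (U.u t₀) db) {y : ℝ} (hy : t₀ ≤ y) (hyT : y < T) :
    ∫ t in t₀..y, Real.exp (-(4 * Λ) * t) *
      (U.energy t - ∫ s, |db s + dphi L η| ^ p ∂(mu L)) ≤ 0 := by
  set Eb := ∫ s, |db s + dphi L η| ^ p ∂(mu L) with hEb
  set w : ℝ → ℝ := fun t => Real.exp (-(4 * Λ) * t) with hw
  have hwc : Continuous w := by fun_prop
  have hz := (U.isTimePrimitive hT hL).sub (IsTimePrimitive.const (T := T) hb.continuous)
  have hzp := (hz.isPrimitive_sq hT ⟨ht₀.1.trans hy, hyT⟩).mono ht₀.1 hy le_rfl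
  have hwp : IsPrimitive t₀ y w (fun t => -(4 * Λ) * w t) := by
    refine IsPrimitive.of_hasDerivAt (fun t => ?_) (by fun_prop)
    have := ((hasDerivAt_id t).const_mul (-(4 * Λ))).exp
    convert! this using 1
    simp [hw]; ring
  have hm := (hwp.mul hzp hy).const_mul (-(p / 2))
  have hint := hm.integral_eq (left_mem_Icc.2 hy) (right_mem_Icc.2 hy)
  have hcmp : ∫ t in t₀..y, w t * (U.energy t - Eb) ≤
      ∫ t in t₀..y, -(p / 2) * (-(4 * Λ) * w t * (∫ s, (U.u t s - U.u t₀ s) ^ 2 ∂(mu L)) +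
        w t * (2 * ∫ s, (U.ut t s - 0) * (U.u t s - U.u t₀ s) ∂(mu L))) := by
    refine intervalIntegral_mono_mu (T := T) ht₀.1 hy hyT ?_ hm.integrable ?_
    · exact ((intervalIntegrable_of_mu (U.integrable_energy hp) ht₀.1 hy hyT.le).sub
        intervalIntegrable_const).continuousOn_mul hwc.continuousOn
    · filter_upwards [U.ae_equation hp hT hL (U.memLinftyW1Per.sub hp hL (MemLinftyW1Per.const hb)),
        hΛ, U.ae_memLp_ut, U.ae_memLp_a, ae_mem_Ico T] with t h1 h2 h3 h4 htI _
      have hcl := U.integral_drift_mul_sub hL htI h3 hb.continuous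
        (U.integral_cos_eq_zero hL ht₀) (U.integral_sin_eq_zero hL ht₀) h2.1 h2.2
      have hbm : MemLp (fun s => db s + dphi L η) (ENNReal.ofReal p) (mu L) :=
        hb.memLp_deriv.add (memLp_const _)
      have hcv : U.energy t - Eb ≤ p * ∫ s, pFlux p (U.a t s) * (U.us t s - db s) ∂(mu L) := by
        have ia := integrable_abs_rpow hp h4
        have ib := integrable_abs_rpow hp hbm
        have ic := integrable_pFlux_mul hp h4 (h4.sub hbm)
        rw [hEb, energy, ← integral_sub ia ib, ← integral_const_mul]
        have ec : ∀ s, (U.a t - fun s => db s + dphi L η) s = U.us t s - db s := fun s => by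
          simp [a]
        simp_rw [ec] at ic
        refine integral_mono (ia.sub ib) (ic.const_mul p) fun s => ?_
        have := rpow_abs_sub_le_pFlux hp (U.a t s) (db s + dphi L η)
        rw [show U.a t s - (db s + dphi L η) = U.us t s - db s by simp [a]] at this
        exact this
      rw [eq_neg_of_add_eq_zero_right h1] at hcv
      simp only [sub_zero]
      set Y := ∫ s, (U.u t s - U.u t₀ s) ^ 2 ∂(mu L)
      set I := ∫ s, U.ut t s * (U.u t s - U.u t₀ s) ∂(mu L)
      set J := ∫ s, U.drift t s * (U.u t s - U.u t₀ s) ∂(mu L)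
      have hJ : I - 2 * Λ * Y ≤ J := by linarith [(abs_le.1 hcl).1]
      have hmain : U.energy t - Eb ≤ -p * (I - 2 * Λ * Y) := by nlinarith
      calc w t * (U.energy t - Eb) ≤ w t * (-p * (I - 2 * Λ * Y)) :=
            mul_le_mul_of_nonneg_left hmain (Real.exp_pos _).le
        _ = _ := by ring
  refine hcmp.trans ?_
  rw [hint]
  have h0 : ∫ s, (U.u t₀ s - U.u t₀ s) ^ 2 ∂(mu L) = 0 := by simp
  have h1 : 0 ≤ w y * ∫ s, (U.u y s - U.u t₀ s) ^ 2 ∂(mu L) :=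
    mul_nonneg (Real.exp_pos _).le (integral_nonneg fun _ => sq_nonneg _)
  rw [h0]
  nlinarith

lemma integral_abs_rpow_le_of_eLpNorm_le (hp : 2 ≤ p) {f : ℝ → ℝ}
    (hf : MemLp f (ENNReal.ofReal p) (mu L)) {K : NNReal}
    (hK : eLpNorm f (ENNReal.ofReal p) (mu L) ≤ K) : ∫ s, |f s| ^ p ∂(mu L) ≤ (K : ℝ) ^ p := by
  have hp0 : ENNReal.ofReal p ≠ 0 := by simp; linarith
  have hpt : (ENNReal.ofReal p).toReal = p := ENNReal.toReal_ofReal (by linarith)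
  rw [hf.eLpNorm_eq_integral_rpow_norm hp0 ENNReal.ofReal_ne_top, hpt] at hK
  have h0 : 0 ≤ ∫ s, |f s| ^ p ∂(mu L) := integral_nonneg fun _ => by positivity
  have h2 : (∫ s, |f s| ^ p ∂(mu L)) ^ p⁻¹ ≤ (K : ℝ) := by
    rw [← ENNReal.ofReal_coe_nnreal] at hK
    exact (ENNReal.ofReal_le_ofReal_iff K.2).1 hK
  have h3 := Real.rpow_le_rpow (Real.rpow_nonneg h0 _) h2 (show 0 ≤ p by linarith)
  rwa [← Real.rpow_mul h0, inv_mul_cancel₀ (by linarith), Real.rpow_one] at h3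

lemma exists_energy_bound (hp : 2 ≤ p) : ∃ M, ∀ᵐ t ∂(mu T), U.energy t ≤ M := by
  obtain ⟨K, hK⟩ := U.memLinftyW1Per.bounded
  have hc : MemLp (fun _ : ℝ => dphi L η) (ENNReal.ofReal p) (mu L) := memLp_const _
  have hq : 1 ≤ ENNReal.ofReal p := le_trans (by norm_num) (two_le_ofReal hp)
  refine ⟨((K + (eLpNorm (fun _ : ℝ => dphi L η) (ENNReal.ofReal p) (mu L)).toNNReal : NNReal) : ℝ) ^ p,
    ?_⟩
  filter_upwards [hK, U.ae_memLp_a, U.memLinftyW1Per.memW1Per] with t h1 h2 h3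
  refine integral_abs_rpow_le_of_eLpNorm_le hp h2 ?_
  push_cast
  rw [ENNReal.coe_toNNReal hc.2.ne]
  exact (eLpNorm_add_le h3.memLp_deriv.1 hc.1 hq).trans (by gcongr; exact h1.2)

/-- The energy is bounded by the energy of the initial datum. -/
lemma ae_energy_le (hp : 2 ≤ p) (hT : 0 < T) (hL : 0 < L) (hη : 1 ≤ η) {du₀ : ℝ → ℝ}
    (h₀ : MemW1Per p L u₀ du₀) :
    ∀ᵐ t ∂(mu T), U.energy t ≤ ∫ s, |du₀ s + dphi L η| ^ p ∂(mu L) := by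
  -- This bound depends on the solution, but it enters only through the rate of the exponential
  -- weight and leaves no trace in the conclusion.
  obtain ⟨M, hM⟩ := U.exists_energy_bound hp
  have hΛ : ∀ᵐ t ∂(mu T), |U.lam₁ t| ≤ lamBound L M ∧ |U.lam₂ t| ≤ lamBound L M := by
    filter_upwards [U.ae_abs_lam_le hp hL hη hT, hM] with t h1 h2
    have := lamBound_mono hL.le (U.energy_nonneg t) h2
    exact ⟨h1.1.trans this, h1.2.trans this⟩
  refine ae_le_of_forward_average_le hT (w := fun t => Real.exp (-(4 * lamBound L M) * t))
    (U.integrable_energy hp) (by fun_prop) (fun x => Real.exp_pos _) (fun y hy hyT => ?_) ?_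
  · have h0 : U.u 0 = u₀ := funext U.initial
    exact U.forward_average_energy_le hp hT hL hΛ ⟨le_rfl, hT⟩ (by rw [h0]; exact h₀) hy hyT
  · filter_upwards [U.memLinftyW1Per.memW1Per, ae_mem_Ico T] with x hx hxI y hy hyT
    exact U.forward_average_energy_le hp hT hL hΛ hxI hx hy hyT

end WeakSolution

/-! ### Stability of the multipliers at a fixed time -/

lemma abs_sin_sq_sub_le (x y : ℝ) : |Real.sin x ^ 2 - Real.sin y ^ 2| ≤ 2 * |x - y| := by
  have h := abs_sin_sub_sin_le x y
  have h1 : |Real.sin x + Real.sin y| ≤ 2 := by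
    refine (abs_add_le _ _).trans ?_
    linarith [Real.abs_sin_le_one x, Real.abs_sin_le_one y]
  rw [sq_sub_sq, abs_mul]
  exact mul_le_mul h1 h (abs_nonneg _) (by norm_num)

lemma abs_cos_sq_sub_le (x y : ℝ) : |Real.cos x ^ 2 - Real.cos y ^ 2| ≤ 2 * |x - y| := by
  have h := abs_cos_sub_cos_le x y
  have h1 : |Real.cos x + Real.cos y| ≤ 2 := by
    refine (abs_add_le _ _).trans ?_
    linarith [Real.abs_cos_le_one x, Real.abs_cos_le_one y]
  rw [sq_sub_sq, abs_mul]
  exact mul_le_mul h1 h (abs_nonneg _) (by norm_num)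

lemma abs_sin_mul_cos_sub_le (x y : ℝ) :
    |Real.sin x * Real.cos x - Real.sin y * Real.cos y| ≤ 2 * |x - y| := by
  have h := abs_sin_sub_sin_le x y
  have h' := abs_cos_sub_cos_le x y
  have e : Real.sin x * Real.cos x - Real.sin y * Real.cos y =
      (Real.sin x - Real.sin y) * Real.cos x + Real.sin y * (Real.cos x - Real.cos y) := by ring
  rw [e]
  refine (abs_add_le _ _).trans ?_
  rw [abs_mul, abs_mul]
  have h1 := mul_le_mul h (Real.abs_cos_le_one x) (abs_nonneg _) (abs_nonneg _)
  have h2 := mul_le_mul (Real.abs_sin_le_one y) h' (abs_nonneg _) zero_le_one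
  linarith

/-- Cauchy-Schwarz after writing `|a| ^ (p - 1) * |c|` as `|a| ^ (p / 2)` times `|a| ^ ((p - 2) / 2)
* |c|`. With `c = a - b`, the square of the second factor is at most twice the dissipation density.
-/
lemma sq_integral_rpow_mul_abs_le {p L : ℝ} (hp : 2 ≤ p) {a c d : ℝ → ℝ}
    (ha : MemLp a (ENNReal.ofReal p) (mu L)) (hc : AEStronglyMeasurable c (mu L))
    (hd : Integrable d (mu L)) (hcd : ∀ s, |a s| ^ (p - 2) * c s ^ 2 ≤ d s) :
    Integrable (fun s => |a s| ^ (p - 1) * |c s|) (mu L) ∧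
    (∫ s, |a s| ^ (p - 1) * |c s| ∂(mu L)) ^ 2 ≤
      (∫ s, |a s| ^ p ∂(mu L)) * ∫ s, d s ∂(mu L) := by
  have e1 : ∀ s, (|a s| ^ (p / 2)) ^ 2 = |a s| ^ p := fun s => by
    rw [← Real.rpow_mul_natCast (abs_nonneg _)]; norm_num
  have e2 : ∀ s, (|a s| ^ ((p - 2) / 2) * |c s|) ^ 2 = |a s| ^ (p - 2) * c s ^ 2 := fun s => by
    rw [mul_pow, ← Real.rpow_mul_natCast (abs_nonneg _), sq_abs]; norm_num
  have e3 : ∀ s, |a s| ^ (p / 2) * (|a s| ^ ((p - 2) / 2) * |c s|) = |a s| ^ (p - 1) * |c s| := by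
    intro s
    rw [← mul_assoc, ← Real.rpow_add_of_nonneg (abs_nonneg _) (by linarith) (by linarith)]
    ring_nf
  have hcont : ∀ r : ℝ, 0 ≤ r → AEStronglyMeasurable (fun s => |a s| ^ r) (mu L) := fun r hr =>
    (continuous_abs.rpow_const fun x => Or.inr hr).comp_aestronglyMeasurable ha.1
  have m1 : MemLp (fun s => |a s| ^ (p / 2)) 2 (mu L) := by
    rw [memLp_two_iff_integrable_sq (hcont _ (by linarith))]
    simp_rw [e1]; exact integrable_abs_rpow hp ha
  have hm2 : AEStronglyMeasurable (fun s => |a s| ^ ((p - 2) / 2) * |c s|) (mu L) :=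
    (hcont _ (by linarith)).mul (continuous_abs.comp_aestronglyMeasurable hc)
  have m2 : MemLp (fun s => |a s| ^ ((p - 2) / 2) * |c s|) 2 (mu L) := by
    rw [memLp_two_iff_integrable_sq hm2]
    refine hd.mono' (hm2.pow 2) (ae_of_all _ fun s => ?_)
    rw [Real.norm_eq_abs, abs_of_nonneg (sq_nonneg _), e2]
    exact hcd s
  have i := integrable_mul_of_memLp_two m1 m2
  have h := sq_integral_mul_le m1 m2
  simp_rw [e3] at i h
  simp_rw [e1] at h
  refine ⟨i, h.trans (mul_le_mul_of_nonneg_left (integral_mono m2.integrable_sq hd fun s => ?_)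
    (integral_nonneg fun _ => by positivity))⟩
  simp only
  rw [e2]; exact hcd s

/-- The dissipation `∫ (|a|^{p-2} a - |b|^{p-2} b) (a - b)`. -/
noncomputable def dissipation (p L : ℝ) (a b : ℝ → ℝ) : ℝ :=
  ∫ s, (pFlux p (a s) - pFlux p (b s)) * (a s - b s) ∂(mu L)

lemma integrable_dissipation {X : Type*} [MeasurableSpace X] {μ : Measure X} {p : ℝ} (hp : 2 ≤ p)
    {a b : X → ℝ} (ha : MemLp a (ENNReal.ofReal p) μ) (hb : MemLp b (ENNReal.ofReal p) μ) :
    Integrable (fun s => (pFlux p (a s) - pFlux p (b s)) * (a s - b s)) μ := by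
  have h1 := integrable_pFlux_mul hp ha (ha.sub hb)
  have h2 := integrable_pFlux_mul hp hb (ha.sub hb)
  simp_rw [sub_mul]
  exact h1.sub h2

lemma dissipation_nonneg {p : ℝ} (hp : 2 ≤ p) (L : ℝ) (a b : ℝ → ℝ) : 0 ≤ dissipation p L a b := by
  refine integral_nonneg fun s => le_trans ?_ (pFlux_monotone_bound hp (a s) (b s))
  positivity

/-- The arithmetic behind `sq_perturbation_le`: there `N₁` and `N₂` are weighted `L¹` norms of `a -
b`, while `S` bounds the sup norm of the angle difference and `R` is its `L¹` norm. -/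
lemma sq_le_of_abs_le_sum {p M D Λ L Y N₁ N₂ S R Q k : ℝ}
    (h : |k| ≤ p * (N₁ + N₂) + M * S + 4 * Λ * R)
    (h1 : N₁ ^ 2 ≤ M * (2 * D)) (h2 : N₂ ^ 2 ≤ M * (2 * D)) (hS : S ^ 2 = Q) (hR : R ^ 2 ≤ L * Y) :
    k ^ 2 ≤ 3 * (8 * p ^ 2 * M * D + M ^ 2 * Q + 16 * Λ ^ 2 * (L * Y)) := by
  have hsq : k ^ 2 ≤ (p * (N₁ + N₂) + M * S + 4 * Λ * R) ^ 2 := by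
    rw [← sq_abs]; gcongr
  have h3 : ∀ A B C : ℝ, (A + B + C) ^ 2 ≤ 3 * (A ^ 2 + B ^ 2 + C ^ 2) := fun A B C => by
    nlinarith [sq_nonneg (A - B), sq_nonneg (B - C), sq_nonneg (A - C)]
  refine hsq.trans ((h3 _ _ _).trans (mul_le_mul_of_nonneg_left ?_ (by norm_num)))
  rw [← hS]
  have hN : (N₁ + N₂) ^ 2 ≤ 8 * (M * D) := by nlinarith [sq_nonneg (N₁ - N₂)]
  have p1 : (p * (N₁ + N₂)) ^ 2 ≤ 8 * p ^ 2 * M * D :=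
    calc (p * (N₁ + N₂)) ^ 2 = p ^ 2 * (N₁ + N₂) ^ 2 := by ring
      _ ≤ p ^ 2 * (8 * (M * D)) := mul_le_mul_of_nonneg_left hN (sq_nonneg p)
      _ = _ := by ring
  have p2 : (M * S) ^ 2 = M ^ 2 * S ^ 2 := by ring
  have p3 : (4 * Λ * R) ^ 2 ≤ 16 * Λ ^ 2 * (L * Y) :=
    calc (4 * Λ * R) ^ 2 = 16 * Λ ^ 2 * R ^ 2 := by ring
      _ ≤ _ := mul_le_mul_of_nonneg_left hR (by positivity)
  linarith

/-- The perturbation of the right-hand side of the linear system for the multipliers. -/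
lemma sq_perturbation_le {p L : ℝ} (hp : 2 ≤ p) (hL : 0 < L) {θ a ϑ b : ℝ → ℝ}
    (hθ : Continuous θ) (hϑ : Continuous ϑ) (hz : IsPrimitive 0 L (fun s => θ s - ϑ s)
      (fun s => a s - b s))
    (ha : MemLp a (ENNReal.ofReal p) (mu L)) (hb : MemLp b (ENNReal.ofReal p) (mu L)) {M Λ : ℝ}
    (hMa : ∫ s, |a s| ^ p ∂(mu L) ≤ M) (hMb : ∫ s, |b s| ^ p ∂(mu L) ≤ M)
    {f g h k : ℝ → ℝ} (hf1 : ∀ x, |f x| ≤ 1)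
    (hf2 : ∀ x y, |f x - f y| ≤ |x - y|)
    (hg : ∀ x y, |g x - g y| ≤ 2 * |x - y|) (hh : ∀ x y, |h x - h y| ≤ 2 * |x - y|)
    {x y : ℝ} (hx : |x| ≤ Λ) (hy : |y| ≤ Λ)
    (hk : ∀ s, k s = |a s| ^ p * f (θ s) - |b s| ^ p * f (ϑ s) - x * (g (θ s) - g (ϑ s)) -
      y * (h (θ s) - h (ϑ s))) :
    (∫ s, k s ∂(mu L)) ^ 2 ≤ 3 * (8 * p ^ 2 * M * dissipation p L a b +
      M ^ 2 * (2 / L * (∫ s, (θ s - ϑ s) ^ 2 ∂(mu L)) + 2 * L * ∫ s, (a s - b s) ^ 2 ∂(mu L)) +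
      16 * Λ ^ 2 * (L * ∫ s, (θ s - ϑ s) ^ 2 ∂(mu L))) := by
  have hc : AEStronglyMeasurable (fun s => a s - b s) (mu L) := ha.1.sub hb.1
  have hD := integrable_dissipation hp ha hb
  have hzc : Continuous (fun s => θ s - ϑ s) := hθ.sub hϑ
  have hcd2 : MemLp (fun s => a s - b s) 2 (mu L) := (memLp_two_of_memLp hp (ha.sub hb))
  set D := dissipation p L a b with hDdef
  set Y := ∫ s, (θ s - ϑ s) ^ 2 ∂(mu L) with hY
  set Z := ∫ s, (a s - b s) ^ 2 ∂(mu L) with hZ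
  have hY0 : 0 ≤ Y := integral_nonneg fun _ => sq_nonneg _
  have hZ0 : 0 ≤ Z := integral_nonneg fun _ => sq_nonneg _
  have hD0 : 0 ≤ D := dissipation_nonneg hp L a b
  have hM0 : 0 ≤ M := (integral_nonneg fun _ => by positivity).trans hMa
  have hΛ0 : 0 ≤ Λ := (abs_nonneg _).trans hx
  obtain ⟨iN1, hN1⟩ := sq_integral_rpow_mul_abs_le hp ha hc (hD.const_mul 2) fun s => by
    have := pFlux_monotone_bound hp (a s) (b s)
    have h0 : 0 ≤ |b s| ^ (p - 2) * (a s - b s) ^ 2 := by positivity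
    nlinarith
  obtain ⟨iN2, hN2⟩ := sq_integral_rpow_mul_abs_le hp hb hc (hD.const_mul 2) fun s => by
    have := pFlux_monotone_bound hp (a s) (b s)
    have h0 : 0 ≤ |a s| ^ (p - 2) * (a s - b s) ^ 2 := by positivity
    nlinarith
  rw [integral_const_mul] at hN1 hN2
  change _ ≤ _ * (2 * D) at hN1
  change _ ≤ _ * (2 * D) at hN2
  set N₁ := ∫ s, |a s| ^ (p - 1) * |a s - b s| ∂(mu L) with hN₁
  set N₂ := ∫ s, |b s| ^ (p - 1) * |a s - b s| ∂(mu L) with hN₂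
  have hN1' : N₁ ^ 2 ≤ M * (2 * D) := hN1.trans (mul_le_mul_of_nonneg_right hMa (by linarith))
  have hN2' : N₂ ^ 2 ≤ M * (2 * D) := hN2.trans (mul_le_mul_of_nonneg_right hMb (by linarith))
  set S := Real.sqrt (2 / L * Y + 2 * L * Z) with hS
  have hS0 : 0 ≤ S := Real.sqrt_nonneg _
  have hS2 : S ^ 2 = 2 / L * Y + 2 * L * Z := Real.sq_sqrt (by positivity)
  have hsup : ∀ s ∈ Ioo 0 L, |θ s - ϑ s| ≤ S := fun s hs =>
    Real.abs_le_sqrt (hz.sq_le hL hzc hcd2 (Ioo_subset_Icc_self hs))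
  set R := ∫ s, |θ s - ϑ s| ∂(mu L) with hR
  have hR2 : R ^ 2 ≤ L * Y := by
    have := sq_integral_mul_le (μ := mu L) (f := fun _ => (1 : ℝ)) (g := fun s => |θ s - ϑ s|)
      (memLp_const _) (Continuous.memLp_mu hzc.abs 2 L)
    simpa [mu_real_univ hL.le, hL.le] using this
  have iR : Integrable (fun s => |θ s - ϑ s|) (mu L) := Continuous.integrable_mu hzc.abs L
  have ia := integrable_abs_rpow hp ha
  have ib := integrable_abs_rpow hp hb
  have hbig : |∫ s, k s ∂(mu L)| ≤ p * (N₁ + N₂) + M * S + 4 * Λ * R := by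
    have hpt : ∀ s ∈ Ioo 0 L, |k s| ≤ p * (|a s| ^ (p - 1) * |a s - b s| +
        |b s| ^ (p - 1) * |a s - b s|) + |b s| ^ p * S + 4 * Λ * |θ s - ϑ s| := by
      intro s hs
      -- The four terms are the change of the energy density, the change of the trigonometric
      -- factor, and the changes of two matrix entries. Only the second needs the sup norm of the
      -- angle difference, because `|b| ^ p` is merely integrable.
      have e : k s = (|a s| ^ p - |b s| ^ p) * f (θ s) + |b s| ^ p * (f (θ s) - f (ϑ s)) +
          -(x * (g (θ s) - g (ϑ s))) + -(y * (h (θ s) - h (ϑ s))) := by rw [hk]; ring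
      have t1 : |(|a s| ^ p - |b s| ^ p) * f (θ s)| ≤
          p * ((|a s| ^ (p - 1) + |b s| ^ (p - 1)) * |a s - b s|) := by
        rw [abs_mul]
        exact (mul_le_of_le_one_right (abs_nonneg _) (hf1 _)).trans (abs_rpow_abs_sub_le hp _ _)
      have t2 : |(|b s| ^ p * (f (θ s) - f (ϑ s)))| ≤ |b s| ^ p * S := by
        rw [abs_mul, abs_of_nonneg (show 0 ≤ |b s| ^ p by positivity)]
        exact mul_le_mul_of_nonneg_left ((hf2 _ _).trans (hsup s hs)) (by positivity)
      have t3 : |-(x * (g (θ s) - g (ϑ s)))| ≤ Λ * (2 * |θ s - ϑ s|) := by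
        rw [abs_neg, abs_mul]; exact mul_le_mul hx (hg _ _) (abs_nonneg _) hΛ0
      have t4 : |-(y * (h (θ s) - h (ϑ s)))| ≤ Λ * (2 * |θ s - ϑ s|) := by
        rw [abs_neg, abs_mul]; exact mul_le_mul hy (hh _ _) (abs_nonneg _) hΛ0
      rw [e]
      refine (abs_add_le _ _).trans ?_
      have := (abs_add_le ((|a s| ^ p - |b s| ^ p) * f (θ s) + |b s| ^ p * (f (θ s) - f (ϑ s)))
        (-(x * (g (θ s) - g (ϑ s)))))
      have := abs_add_le ((|a s| ^ p - |b s| ^ p) * f (θ s)) (|b s| ^ p * (f (θ s) - f (ϑ s)))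
      linarith
    have iN : Integrable (fun s => p * (|a s| ^ (p - 1) * |a s - b s| +
        |b s| ^ (p - 1) * |a s - b s|)) (mu L) := (iN1.add iN2).const_mul p
    have ibound : Integrable (fun s => p * (|a s| ^ (p - 1) * |a s - b s| +
        |b s| ^ (p - 1) * |a s - b s|) + |b s| ^ p * S + 4 * Λ * |θ s - ϑ s|) (mu L) :=
      (iN.add (ib.mul_const S)).add (iR.const_mul (4 * Λ))
    refine (abs_integral_le_integral_abs.trans (integral_mono_of_nonneg
      (ae_of_all _ fun _ => abs_nonneg _) ibound
      ((ae_restrict_iff' measurableSet_Ioo).2 (ae_of_all _ hpt)))).trans ?_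
    rw [integral_add (iN.fun_add (ib.mul_const S)) (iR.const_mul (4 * Λ)),
      integral_add iN (ib.mul_const S), integral_const_mul, integral_const_mul,
      integral_add iN1 iN2, integral_mul_const]
    have := mul_le_mul_of_nonneg_right hMb hS0
    linarith
  exact sq_le_of_abs_le_sum hbig hN1' hN2' hS2 hR2

/-- The constant in the stability estimate for the multipliers at a fixed time. -/
noncomputable def multiplierConst (p L M : ℝ) : ℝ :=
  ((L + M) / Real.pi ^ 2) ^ 2 * (6 * (8 * p ^ 2 * M + M ^ 2 * (2 / L + 2 * L) +
    16 * lamBound L M ^ 2 * L))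

lemma multiplierConst_nonneg {p L M : ℝ} (hL : 0 < L) (hM : 0 ≤ M) :
    0 ≤ multiplierConst p L M := by
  unfold multiplierConst; positivity

/-- Subtracting the systems, `(x - x', y - y')` solves one with the matrix of `θ`, whose right side
collects the difference of the sources and the difference of the matrices applied to the bounded
vector `(x', y')`. Coercivity for `θ` alone then suffices. -/
lemma sq_sub_multipliers_le {p L : ℝ} (hp : 2 ≤ p) (hL : 0 < L) {η : ℕ} (hη : 1 ≤ η)
    {θ a ϑ b : ℝ → ℝ} (h : IsPrimitive 0 L θ a) (hϑp : IsPrimitive 0 L ϑ b)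
    (hθ : Continuous θ) (hϑ : Continuous ϑ) (hw : θ L = θ 0 + 2 * Real.pi * η)
    (ha : MemLp a (ENNReal.ofReal p) (mu L)) (hb : MemLp b (ENNReal.ofReal p) (mu L)) {M : ℝ}
    (hMa : ∫ s, |a s| ^ p ∂(mu L) ≤ M) (hMb : ∫ s, |b s| ^ p ∂(mu L) ≤ M)
    {x y x' y' : ℝ} (hx' : |x'| ≤ lamBound L M) (hy' : |y'| ≤ lamBound L M)
    (h₁ : x * (∫ s, Real.sin (θ s) ^ 2 ∂(mu L)) -
      y * (∫ s, Real.sin (θ s) * Real.cos (θ s) ∂(mu L)) =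
        ∫ s, |a s| ^ p * Real.cos (θ s) ∂(mu L))
    (h₂ : -x * (∫ s, Real.sin (θ s) * Real.cos (θ s) ∂(mu L)) +
      y * (∫ s, Real.cos (θ s) ^ 2 ∂(mu L)) = ∫ s, |a s| ^ p * Real.sin (θ s) ∂(mu L))
    (h₁' : x' * (∫ s, Real.sin (ϑ s) ^ 2 ∂(mu L)) -
      y' * (∫ s, Real.sin (ϑ s) * Real.cos (ϑ s) ∂(mu L)) =
        ∫ s, |b s| ^ p * Real.cos (ϑ s) ∂(mu L))
    (h₂' : -x' * (∫ s, Real.sin (ϑ s) * Real.cos (ϑ s) ∂(mu L)) +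
      y' * (∫ s, Real.cos (ϑ s) ^ 2 ∂(mu L)) = ∫ s, |b s| ^ p * Real.sin (ϑ s) ∂(mu L)) :
    (x - x') ^ 2 + (y - y') ^ 2 ≤ multiplierConst p L M * (dissipation p L a b +
      (∫ s, (θ s - ϑ s) ^ 2 ∂(mu L)) + ∫ s, (a s - b s) ^ 2 ∂(mu L)) := by
  have hM0 : 0 ≤ M := (integral_nonneg fun _ => by positivity).trans hMa
  have hB : ∫ s, a s ^ 2 ∂(mu L) ≤ L + M := by
    have := integral_sq_le hp ha
    rw [mu_real_univ hL.le] at this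
    linarith
  have ct : ∀ {f : ℝ → ℝ}, Continuous f → Integrable f (mu L) := fun hf =>
    Continuous.integrable_mu hf L
  have is : Integrable (fun s => Real.sin (θ s) ^ 2) (mu L) := ct (by fun_prop)
  have isc : Integrable (fun s => Real.sin (θ s) * Real.cos (θ s)) (mu L) := ct (by fun_prop)
  have ic : Integrable (fun s => Real.cos (θ s) ^ 2) (mu L) := ct (by fun_prop)
  have is' : Integrable (fun s => Real.sin (ϑ s) ^ 2) (mu L) := ct (by fun_prop)
  have isc' : Integrable (fun s => Real.sin (ϑ s) * Real.cos (ϑ s)) (mu L) := ct (by fun_prop)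
  have ic' : Integrable (fun s => Real.cos (ϑ s) ^ 2) (mu L) := ct (by fun_prop)
  have itr : ∀ {f c : ℝ → ℝ}, Integrable f (mu L) → Continuous c → (∀ s, |c s| ≤ 1) →
      Integrable (fun s => f s * c s) (mu L) := fun {f c} hf hc hc1 => by
    have := integrable_mul_of_bound hc.aestronglyMeasurable 1 (ae_of_all _ hc1) hf
    simpa only [mul_comm] using this
  have ia := integrable_abs_rpow hp ha
  have ib := integrable_abs_rpow hp hb
  have iac := itr ia (Real.continuous_cos.comp hθ) fun s => Real.abs_cos_le_one _
  have ias := itr ia (Real.continuous_sin.comp hθ) fun s => Real.abs_sin_le_one _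
  have ibc := itr ib (Real.continuous_cos.comp hϑ) fun s => Real.abs_cos_le_one _
  have ibs := itr ib (Real.continuous_sin.comp hϑ) fun s => Real.abs_sin_le_one _
  simp only [Function.comp_apply] at iac ias ibc ibs
  have hz := h.sub hϑp
  have k1 := sq_perturbation_le hp hL hθ hϑ hz ha hb hMa hMb
    Real.abs_cos_le_one abs_cos_sub_cos_le abs_sin_sq_sub_le (h := fun x =>
      -(Real.sin x * Real.cos x)) (fun x y => by
        have := abs_sin_mul_cos_sub_le x y
        rw [← abs_neg] at this
        convert this using 2; ring) hx' hy'
    (k := fun s => |a s| ^ p * Real.cos (θ s) - |b s| ^ p * Real.cos (ϑ s) -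
      x' * (Real.sin (θ s) ^ 2 - Real.sin (ϑ s) ^ 2) -
      y' * (-(Real.sin (θ s) * Real.cos (θ s)) - -(Real.sin (ϑ s) * Real.cos (ϑ s))))
    (fun s => rfl)
  have k2 := sq_perturbation_le hp hL hθ hϑ hz ha hb hMa hMb
    Real.abs_sin_le_one abs_sin_sub_sin_le (g := fun x => -(Real.sin x * Real.cos x))
      (fun x y => by
        have := abs_sin_mul_cos_sub_le x y
        rw [← abs_neg] at this
        convert this using 2; ring) abs_cos_sq_sub_le hx' hy'
    (k := fun s => |a s| ^ p * Real.sin (θ s) - |b s| ^ p * Real.sin (ϑ s) -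
      x' * (-(Real.sin (θ s) * Real.cos (θ s)) - -(Real.sin (ϑ s) * Real.cos (ϑ s))) -
      y' * (Real.cos (θ s) ^ 2 - Real.cos (ϑ s) ^ 2))
    (fun s => rfl)
  have inegdiff : Integrable (fun s => -(Real.sin (θ s) * Real.cos (θ s)) -
      -(Real.sin (ϑ s) * Real.cos (ϑ s))) (mu L) := ct (by fun_prop)
  have enegdiff : ∫ s, (-(Real.sin (θ s) * Real.cos (θ s)) -
      -(Real.sin (ϑ s) * Real.cos (ϑ s))) ∂(mu L) =
      -(∫ s, Real.sin (θ s) * Real.cos (θ s) ∂(mu L)) +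
        ∫ s, Real.sin (ϑ s) * Real.cos (ϑ s) ∂(mu L) := by
    have e : ∀ s, -(Real.sin (θ s) * Real.cos (θ s)) - -(Real.sin (ϑ s) * Real.cos (ϑ s)) =
        Real.sin (ϑ s) * Real.cos (ϑ s) - Real.sin (θ s) * Real.cos (θ s) := fun s => by ring
    simp_rw [e]
    rw [integral_sub isc' isc]; ring
  have e1 : (x - x') * (∫ s, Real.sin (θ s) ^ 2 ∂(mu L)) -
      (y - y') * (∫ s, Real.sin (θ s) * Real.cos (θ s) ∂(mu L)) =
      ∫ s, (|a s| ^ p * Real.cos (θ s) - |b s| ^ p * Real.cos (ϑ s) -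
      x' * (Real.sin (θ s) ^ 2 - Real.sin (ϑ s) ^ 2) -
      y' * (-(Real.sin (θ s) * Real.cos (θ s)) - -(Real.sin (ϑ s) * Real.cos (ϑ s)))) ∂(mu L) := by
    rw [integral_sub (integrable_fun_sub (integrable_fun_sub iac ibc)
        ((integrable_fun_sub is is').const_mul _)) (inegdiff.const_mul _),
      integral_sub (integrable_fun_sub iac ibc) ((integrable_fun_sub is is').const_mul _),
      integral_sub iac ibc, integral_const_mul, integral_const_mul, integral_sub is is', enegdiff,
      ← h₁, ← h₁']
    ring
  have e2 : -(x - x') * (∫ s, Real.sin (θ s) * Real.cos (θ s) ∂(mu L)) +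
      (y - y') * (∫ s, Real.cos (θ s) ^ 2 ∂(mu L)) =
      ∫ s, (|a s| ^ p * Real.sin (θ s) - |b s| ^ p * Real.sin (ϑ s) -
      x' * (-(Real.sin (θ s) * Real.cos (θ s)) - -(Real.sin (ϑ s) * Real.cos (ϑ s))) -
      y' * (Real.cos (θ s) ^ 2 - Real.cos (ϑ s) ^ 2)) ∂(mu L) := by
    rw [integral_sub (integrable_fun_sub (integrable_fun_sub ias ibs)
        (inegdiff.const_mul _)) ((integrable_fun_sub ic ic').const_mul _),
      integral_sub (integrable_fun_sub ias ibs) (inegdiff.const_mul _),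
      integral_sub ias ibs, integral_const_mul, integral_const_mul, integral_sub ic ic', enegdiff,
      ← h₂, ← h₂']
    ring
  have key := sq_add_sq_le_of_system hL hη h hθ hw (memLp_two_of_memLp hp ha) hB e1 e2
  refine key.trans ?_
  unfold multiplierConst
  rw [mul_assoc]
  refine mul_le_mul_of_nonneg_left ?_ (sq_nonneg _)
  set D := dissipation p L a b with hDdef
  set Y := ∫ s, (θ s - ϑ s) ^ 2 ∂(mu L) with hY
  set Z := ∫ s, (a s - b s) ^ 2 ∂(mu L) with hZ
  have hY0 : 0 ≤ Y := integral_nonneg fun _ => sq_nonneg _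
  have hZ0 : 0 ≤ Z := integral_nonneg fun _ => sq_nonneg _
  have hD0 : 0 ≤ D := dissipation_nonneg hp L a b
  refine (add_le_add k1 k2).trans ?_
  have hsum : ∀ α β₁ β₂ γ : ℝ, 0 ≤ α → 0 ≤ β₁ → 0 ≤ β₂ → 0 ≤ γ →
      α * D + (β₁ * Y + β₂ * Z) + γ * Y ≤ (α + (β₁ + β₂) + γ) * (D + Y + Z) := by
    intro α β₁ β₂ γ h1 h2 h3 h4
    nlinarith [mul_nonneg h1 hY0, mul_nonneg h1 hZ0, mul_nonneg h2 hD0, mul_nonneg h2 hZ0,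
      mul_nonneg h3 hD0, mul_nonneg h3 hY0, mul_nonneg h4 hD0, mul_nonneg h4 hZ0]
  have := hsum (8 * p ^ 2 * M) (M ^ 2 * (2 / L)) (M ^ 2 * (2 * L)) (16 * lamBound L M ^ 2 * L)
    (by positivity) (by positivity) (by positivity) (by positivity)
  linarith

/-! ### Gronwall estimates for the difference of two solutions -/

lemma IsPrimitive.gronwall {τ k c : ℝ} (hτ : 0 ≤ τ) (hk : 0 ≤ k) (hc : 0 ≤ c) {y g : ℝ → ℝ}
    (h : IsPrimitive 0 τ y g) (hg : ∀ᵐ t ∂(mu τ), g t ≤ k * y t + c) :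
    y τ ≤ (y 0 + c * τ) * Real.exp (k * τ) := by
  set w : ℝ → ℝ := fun t => Real.exp (-k * t) with hw
  have hwp : IsPrimitive 0 τ w (fun t => -k * w t) := by
    refine IsPrimitive.of_hasDerivAt (fun t => ?_) (by fun_prop)
    have := ((hasDerivAt_id t).const_mul (-k)).exp
    convert! this using 1
    simp [hw]; ring
  have hm := hwp.mul h hτ
  have hint := hm.integral_eq (left_mem_Icc.2 hτ) (right_mem_Icc.2 hτ)
  have hle : ∫ t in (0 : ℝ)..τ, (-k * w t * y t + w t * g t) ≤ ∫ _ in (0 : ℝ)..τ, c := by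
    refine intervalIntegral.integral_mono_ae_restrict hτ hm.integrable intervalIntegrable_const ?_
    rw [← restrict_Ioc_eq_restrict_Icc, ← restrict_Ioo_eq_restrict_Ioc]
    filter_upwards [hg, ae_restrict_mem measurableSet_Ioo] with t ht htI
    have hw0 : 0 < w t := Real.exp_pos _
    have hw1 : w t ≤ 1 := Real.exp_le_one_iff.2 (by nlinarith [htI.1])
    nlinarith
  rw [hint, intervalIntegral.integral_const, smul_eq_mul, sub_zero] at hle
  have hw00 : w 0 = 1 := by simp [hw]
  have hwτ : w τ * Real.exp (k * τ) = 1 := by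
    rw [hw]; simp only; rw [← Real.exp_add]; simp
  rw [hw00, one_mul] at hle
  have h1 : w τ * y τ ≤ y 0 + c * τ := by linarith
  calc y τ = (w τ * y τ) * Real.exp (k * τ) := by
        rw [mul_right_comm, hwτ, one_mul]
    _ ≤ _ := mul_le_mul_of_nonneg_right h1 (Real.exp_pos _).le

lemma ae_mu_of_le {τ T : ℝ} (h : τ ≤ T) {P : ℝ → Prop} (hP : ∀ᵐ t ∂(mu T), P t) :
    ∀ᵐ t ∂(mu τ), P t :=
  ae_mono (Measure.restrict_mono (Ioo_subset_Ioo_right h) le_rfl) hP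

/-- Identities evaluated at a time `τ` are available for `τ < T`; continuity of the integral carries
bounds over to the endpoint. -/
lemma integral_mu_le_of_forall_lt {T C : ℝ} (hT : 0 < T) {n : ℝ → ℝ} (hn : Integrable n (mu T))
    (h : ∀ τ ∈ Ico 0 T, ∫ t in (0 : ℝ)..τ, n t ≤ C) : ∫ t, n t ∂(mu T) ≤ C := by
  have hp : IsPrimitive 0 T (fun x => ∫ t in (0 : ℝ)..x, n t) n :=
    ⟨(intervalIntegrable_iff_mu hT.le _).2 hn, fun x _ => by simp⟩
  have hc := (hp.continuousOn hT.le) T (right_mem_Icc.2 hT.le)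
  rw [← intervalIntegral_eq_mu hT.le]
  have hc2 : Tendsto (fun x => ∫ t in (0 : ℝ)..x, n t) (𝓝[Ico 0 T] T)
      (𝓝 (∫ t in (0 : ℝ)..T, n t)) := hc.mono Ico_subset_Icc_self
  have hne : (𝓝[Ico 0 T] T).NeBot := by
    rw [← mem_closure_iff_nhdsWithin_neBot, closure_Ico hT.ne]
    exact right_mem_Icc.2 hT.le
  exact le_of_tendsto hc2 (eventually_nhdsWithin_of_forall h)

namespace WeakSolution

variable {p L : ℝ} {η : ℕ} {T : ℝ} {u₀ w₀ : ℝ → ℝ} (U : WeakSolution p L η T u₀)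
  (W : WeakSolution p L η T w₀)

/-- The differential inequality for the difference of two solutions. -/
lemma ae_dissipation_le (hp : 2 ≤ p) (hT : 0 < T) (hL : 0 < L) {Λ : ℝ}
    (hU : ∀ᵐ t ∂(mu T), |U.lam₁ t| ≤ Λ ∧ |U.lam₂ t| ≤ Λ)
    (hW : ∀ᵐ t ∂(mu T), |W.lam₁ t| ≤ Λ ∧ |W.lam₂ t| ≤ Λ) :
    ∀ᵐ t ∂(mu T), (∫ s, (U.ut t s - W.ut t s) * (U.u t s - W.u t s) ∂(mu L)) +
      dissipation p L (U.a t) (W.a t) ≤ 4 * Λ * ∫ s, (U.u t s - W.u t s) ^ 2 ∂(mu L) := by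
  have hz := U.memLinftyW1Per.sub hp hL W.memLinftyW1Per
  filter_upwards [U.ae_equation hp hT hL hz, W.ae_equation hp hT hL hz, hU, hW, U.ae_memLp_ut,
    W.ae_memLp_ut, U.ae_memLp_a, W.ae_memLp_a, ae_mem_Ico T] with t e1 e2 h1 h2 m1 m2 a1 a2 htI
  -- The closing estimate is used twice, each solution serving once as the reference; each use costs
  -- `2 * Λ`, and the multipliers of `U` and `W` are never subtracted.
  have c1 := U.integral_drift_mul_sub hL htI m1 (W.continuous_u htI)
    (W.integral_cos_eq_zero hL htI) (W.integral_sin_eq_zero hL htI) h1.1 h1.2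
  have c2 := W.integral_drift_mul_sub hL htI m2 (U.continuous_u htI)
    (U.integral_cos_eq_zero hL htI) (U.integral_sin_eq_zero hL htI) h2.1 h2.2
  have hneg : ∀ f : ℝ → ℝ, ∫ s, f s * (W.u t s - U.u t s) ∂(mu L) =
      -∫ s, f s * (U.u t s - W.u t s) ∂(mu L) := fun f => by
    rw [← integral_neg]
    refine integral_congr_ae (ae_of_all _ fun s => ?_)
    simp only; ring
  have hsq : ∫ s, (W.u t s - U.u t s) ^ 2 ∂(mu L) = ∫ s, (U.u t s - W.u t s) ^ 2 ∂(mu L) := by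
    refine integral_congr_ae (ae_of_all _ fun s => ?_)
    simp only; ring
  rw [hneg, hneg, hsq] at c2
  have hzm : MemLp (fun s => U.u t s - W.u t s) 2 (mu L) :=
    Continuous.memLp_mu ((U.continuous_u htI).sub (W.continuous_u htI)) 2 L
  have i1 := integrable_mul_of_memLp_two m1 hzm
  have i2 := integrable_mul_of_memLp_two m2 hzm
  have hut : ∫ s, (U.ut t s - W.ut t s) * (U.u t s - W.u t s) ∂(mu L) =
      (∫ s, U.ut t s * (U.u t s - W.u t s) ∂(mu L)) -
        ∫ s, W.ut t s * (U.u t s - W.u t s) ∂(mu L) := by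
    simp_rw [sub_mul (U.ut t _)]
    exact integral_sub i1 i2
  have hus : ∀ s, U.us t s - W.us t s = U.a t s - W.a t s := fun s => by simp [a]
  have hdis : dissipation p L (U.a t) (W.a t) =
      (∫ s, pFlux p (U.a t s) * (U.us t s - W.us t s) ∂(mu L)) -
        ∫ s, pFlux p (W.a t s) * (U.us t s - W.us t s) ∂(mu L) := by
    simp_rw [hus, dissipation, sub_mul (pFlux p (U.a t _))]
    exact integral_sub (integrable_pFlux_mul hp a1 (a1.sub a2))
      (integrable_pFlux_mul hp a2 (a1.sub a2))
  rw [hut, hdis]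
  rw [abs_le] at c1 c2
  linarith [c1.1, c1.2, c2.1, c2.2]

lemma integral_sq_sub_le (hp : 2 ≤ p) (hT : 0 < T) (hL : 0 < L) {Λ : ℝ} (hΛ : 0 ≤ Λ)
    (hU : ∀ᵐ t ∂(mu T), |U.lam₁ t| ≤ Λ ∧ |U.lam₂ t| ≤ Λ)
    (hW : ∀ᵐ t ∂(mu T), |W.lam₁ t| ≤ Λ ∧ |W.lam₂ t| ≤ Λ) {τ : ℝ} (hτ : τ ∈ Ico 0 T) :
    ∫ s, (U.u τ s - W.u τ s) ^ 2 ∂(mu L) ≤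
      Real.exp (8 * Λ * T) * ∫ s, (u₀ s - w₀ s) ^ 2 ∂(mu L) := by
  have hP := ((U.isTimePrimitive hT hL).sub (W.isTimePrimitive hT hL)).isPrimitive_sq hT hτ
  have hg := hP.gronwall (k := 8 * Λ) (c := 0) hτ.1 (by positivity) le_rfl (by
    refine ae_mu_of_le hτ.2.le ?_
    filter_upwards [U.ae_dissipation_le W hp hT hL hU hW] with t ht
    have := dissipation_nonneg hp L (U.a t) (W.a t)
    linarith)
  simp_rw [U.initial, W.initial] at hg
  refine hg.trans ?_
  have h0 : 0 ≤ ∫ s, (u₀ s - w₀ s) ^ 2 ∂(mu L) := integral_nonneg fun _ => sq_nonneg _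
  rw [zero_mul, add_zero, mul_comm]
  refine mul_le_mul_of_nonneg_right (Real.exp_le_exp.2 ?_) h0
  exact mul_le_mul_of_nonneg_left hτ.2.le (by positivity)

lemma integrable_integral_dissipation (hp : 2 ≤ p) :
    Integrable (fun t => dissipation p L (U.a t) (W.a t)) (mu T) :=
  (integrable_dissipation hp (U.memLp_a hp) (W.memLp_a hp)).integral_prod_left

lemma integral_dissipation_le (hp : 2 ≤ p) (hT : 0 < T) (hL : 0 < L) {Λ : ℝ} (hΛ : 0 ≤ Λ)
    (hU : ∀ᵐ t ∂(mu T), |U.lam₁ t| ≤ Λ ∧ |U.lam₂ t| ≤ Λ)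
    (hW : ∀ᵐ t ∂(mu T), |W.lam₁ t| ≤ Λ ∧ |W.lam₂ t| ≤ Λ) :
    ∫ t, dissipation p L (U.a t) (W.a t) ∂(mu T) ≤
      (1 + 8 * Λ * T * Real.exp (8 * Λ * T)) * ∫ s, (u₀ s - w₀ s) ^ 2 ∂(mu L) := by
  set Y₀ := ∫ s, (u₀ s - w₀ s) ^ 2 ∂(mu L) with hY₀
  have h0 : 0 ≤ Y₀ := integral_nonneg fun _ => sq_nonneg _
  have hDi := U.integrable_integral_dissipation W hp
  refine integral_mu_le_of_forall_lt hT hDi fun τ hτ => ?_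
  have hP := ((U.isTimePrimitive hT hL).sub (W.isTimePrimitive hT hL)).isPrimitive_sq hT hτ
  have hint := hP.integral_eq (left_mem_Icc.2 hτ.1) (right_mem_Icc.2 hτ.1)
  simp_rw [U.initial, W.initial] at hint
  have hτ2 : 0 ≤ ∫ s, (U.u τ s - W.u τ s) ^ 2 ∂(mu L) := integral_nonneg fun _ => sq_nonneg _
  have hDI := intervalIntegrable_of_mu hDi le_rfl hτ.1 hτ.2.le
  have hle : ∫ t in (0 : ℝ)..τ, (2 * dissipation p L (U.a t) (W.a t)) ≤
      ∫ t in (0 : ℝ)..τ, (8 * Λ * (Real.exp (8 * Λ * T) * Y₀) -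
        2 * ∫ s, (U.ut t s - W.ut t s) * (U.u t s - W.u t s) ∂(mu L)) := by
    refine intervalIntegral_mono_mu (T := T) le_rfl hτ.1 hτ.2 (hDI.const_mul 2)
      (intervalIntegrable_const.sub hP.integrable) ?_
    filter_upwards [U.ae_dissipation_le W hp hT hL hU hW, ae_mem_Ico T] with t ht htI _
    have := U.integral_sq_sub_le W hp hT hL hΛ hU hW htI
    have h8 := mul_le_mul_of_nonneg_left this (show 0 ≤ 8 * Λ by positivity)
    linarith
  rw [intervalIntegral.integral_const_mul, intervalIntegral.integral_sub intervalIntegrable_const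
    hP.integrable, hint, intervalIntegral.integral_const, smul_eq_mul, sub_zero] at hle
  have hg0 : 0 ≤ 8 * Λ * (Real.exp (8 * Λ * T) * Y₀) := by positivity
  have := mul_le_mul_of_nonneg_right hτ.2.le hg0
  have hI0 : 0 ≤ 8 * Λ * T * Real.exp (8 * Λ * T) * Y₀ := by positivity
  nlinarith

lemma ae_sq_sub_lam_le (hp : 2 ≤ p) (hT : 0 < T) (hL : 0 < L) (hη : 1 ≤ η) {M : ℝ}
    (hU : ∀ᵐ t ∂(mu T), U.energy t ≤ M) (hW : ∀ᵐ t ∂(mu T), W.energy t ≤ M) :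
    ∀ᵐ t ∂(mu T), (U.lam₁ t - W.lam₁ t) ^ 2 + (U.lam₂ t - W.lam₂ t) ^ 2 ≤
      multiplierConst p L M * (dissipation p L (U.a t) (W.a t) +
        (∫ s, (U.u t s - W.u t s) ^ 2 ∂(mu L)) + ∫ s, (U.a t s - W.a t s) ^ 2 ∂(mu L)) := by
  filter_upwards [U.ae_system hp hT hL, W.ae_system hp hT hL, U.ae_isPrimitive_θ hp hL,
    W.ae_isPrimitive_θ hp hL, U.ae_memLp_a, W.ae_memLp_a, hU, hW, W.ae_abs_lam_le hp hL hη hT,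
    ae_mem_Ico T] with t s1 s2 p1 p2 m1 m2 h1 h2 l2 htI
  have hlb := lamBound_mono hL.le (W.energy_nonneg t) h2
  have key := sq_sub_multipliers_le hp hL hη p1 p2 (U.continuous_θ htI) (W.continuous_θ htI)
    (U.winding hL htI) m1 m2 h1 h2 (l2.1.trans hlb) (l2.2.trans hlb) s1.1 s1.2 s2.1 s2.2
  have e : ∀ s, U.θ t s - W.θ t s = U.u t s - W.u t s := fun s => by simp [θ]
  simp_rw [e] at key
  exact key

lemma ae_abs_lam_le_of_energy_le (hp : 2 ≤ p) (hT : 0 < T) (hL : 0 < L) (hη : 1 ≤ η) {M : ℝ}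
    (hU : ∀ᵐ t ∂(mu T), U.energy t ≤ M) :
    ∀ᵐ t ∂(mu T), |U.lam₁ t| ≤ lamBound L M ∧ |U.lam₂ t| ≤ lamBound L M := by
  filter_upwards [U.ae_abs_lam_le hp hL hη hT, hU] with t h1 h2
  have := lamBound_mono hL.le (U.energy_nonneg t) h2
  exact ⟨h1.1.trans this, h1.2.trans this⟩

end WeakSolution

/-! ### The stability estimate and uniqueness -/

/-- The constant in the stability estimates. -/
noncomputable def stabilityConst (p L T M C₀ : ℝ) : ℝ :=
  let g := Real.exp (8 * lamBound L M * T)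
  let κ := 1 + 8 * lamBound L M * T * g
  1 + (g + C₀ * κ) + multiplierConst p L M * (κ + T * g + C₀ * κ)

lemma stabilityConst_pos {p L T M C₀ : ℝ} (hL : 0 < L) (hT : 0 < T) (hM : 0 ≤ M) (hC₀ : 0 ≤ C₀) :
    0 < stabilityConst p L T M C₀ := by
  have := lamBound_nonneg hL.le hM
  have := multiplierConst_nonneg (p := p) hL hM
  unfold stabilityConst
  positivity

/-- Stability for solutions of bounded energy whose dissipation controls the `H¹` norm. -/
theorem stabilityEstimate_of_le_dissipation {p L : ℝ} {η : ℕ} {T : ℝ} {u₀ w₀ : ℝ → ℝ}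
    (U : WeakSolution p L η T u₀) (W : WeakSolution p L η T w₀) (hp : 2 ≤ p) (hT : 0 < T)
    (hL : 0 < L) (hη : 1 ≤ η) {M C₀ : ℝ} (hM : 0 ≤ M) (hC₀ : 0 ≤ C₀)
    (hU : ∀ᵐ t ∂(mu T), U.energy t ≤ M) (hW : ∀ᵐ t ∂(mu T), W.energy t ≤ M)
    (hnd : ∀ᵐ t ∂(mu T), ∫ s, (U.a t s - W.a t s) ^ 2 ∂(mu L) ≤
      C₀ * dissipation p L (U.a t) (W.a t)) :
    StabilityEstimate (stabilityConst p L T M C₀) U W := by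
  have hΛ := lamBound_nonneg hL.le hM
  have hmc := multiplierConst_nonneg (p := p) hL hM
  have hlU := U.ae_abs_lam_le_of_energy_le hp hT hL hη hU
  have hlW := W.ae_abs_lam_le_of_energy_le hp hT hL hη hW
  have hDle := U.integral_dissipation_le W hp hT hL hΛ hlU hlW
  have hDi := U.integrable_integral_dissipation W hp
  have hYle := fun τ hτ => U.integral_sq_sub_le W hp hT hL hΛ hlU hlW (τ := τ) hτ
  have hYi : Integrable (fun t => ∫ s, (U.u t s - W.u t s) ^ 2 ∂(mu L)) (mu T) :=
    (U.memLp_u.sub W.memLp_u).integrable_sq.integral_prod_left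
  have hZi : Integrable (fun t => ∫ s, (U.a t s - W.a t s) ^ 2 ∂(mu L)) (mu T) :=
    (memLp_two_of_memLp hp ((U.memLp_a hp).sub (W.memLp_a hp))).integrable_sq.integral_prod_left
  set Y₀ := ∫ s, (u₀ s - w₀ s) ^ 2 ∂(mu L) with hY₀
  have h0 : 0 ≤ Y₀ := integral_nonneg fun _ => sq_nonneg _
  -- Relative to the initial distance, `g` bounds the squared `L²` distance at each time, `κ` the
  -- total dissipation, and `C₀ * κ` the space-time norm of the difference of derivatives.
  set g := Real.exp (8 * lamBound L M * T) with hg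
  set κ := 1 + 8 * lamBound L M * T * g with hκ
  have hg0 : 0 < g := Real.exp_pos _
  have hκ0 : 0 < κ := by positivity
  have hC : stabilityConst p L T M C₀ =
      1 + (g + C₀ * κ) + multiplierConst p L M * (κ + T * g + C₀ * κ) := rfl
  have hYint : ∫ t, ∫ s, (U.u t s - W.u t s) ^ 2 ∂(mu L) ∂(mu T) ≤ T * g * Y₀ := by
    calc _ ≤ ∫ _, g * Y₀ ∂(mu T) := by
          refine integral_mono_ae hYi (integrable_const _) ?_
          filter_upwards [WeakSolution.ae_mem_Ico T] with t ht using hYle t ht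
      _ = _ := by rw [integral_const, mu_real_univ hT.le, smul_eq_mul]; ring
  have hZint : ∫ t, ∫ s, (U.a t s - W.a t s) ^ 2 ∂(mu L) ∂(mu T) ≤ C₀ * κ * Y₀ := by
    calc _ ≤ ∫ t, C₀ * dissipation p L (U.a t) (W.a t) ∂(mu T) :=
          integral_mono_ae hZi (hDi.const_mul _) hnd
      _ = C₀ * ∫ t, dissipation p L (U.a t) (W.a t) ∂(mu T) := integral_const_mul _ _
      _ ≤ C₀ * (κ * Y₀) := mul_le_mul_of_nonneg_left hDle hC₀
      _ = _ := by ring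
  have hlam : ∫ t, ((U.lam₁ t - W.lam₁ t) ^ 2 + (U.lam₂ t - W.lam₂ t) ^ 2) ∂(mu T) ≤
      multiplierConst p L M * (κ + T * g + C₀ * κ) * Y₀ := by
    have i1 := (U.memLp_lam₁.sub W.memLp_lam₁).integrable_sq
    have i2 := (U.memLp_lam₂.sub W.memLp_lam₂).integrable_sq
    calc _ ≤ ∫ t, multiplierConst p L M * (dissipation p L (U.a t) (W.a t) +
        (∫ s, (U.u t s - W.u t s) ^ 2 ∂(mu L)) + ∫ s, (U.a t s - W.a t s) ^ 2 ∂(mu L)) ∂(mu T) :=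
          integral_mono_ae (i1.add i2) (((hDi.add hYi).add hZi).const_mul _)
            (U.ae_sq_sub_lam_le W hp hT hL hη hU hW)
      _ = multiplierConst p L M * ((∫ t, dissipation p L (U.a t) (W.a t) ∂(mu T)) +
          (∫ t, ∫ s, (U.u t s - W.u t s) ^ 2 ∂(mu L) ∂(mu T)) +
          ∫ t, ∫ s, (U.a t s - W.a t s) ^ 2 ∂(mu L) ∂(mu T)) := by
          rw [integral_const_mul, integral_add (hDi.fun_add hYi) hZi, integral_add hDi hYi]
      _ ≤ multiplierConst p L M * (κ * Y₀ + T * g * Y₀ + C₀ * κ * Y₀) := by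
          refine mul_le_mul_of_nonneg_left ?_ hmc
          linarith
      _ = _ := by ring
  have hl12 : (∫ t, (U.lam₁ t - W.lam₁ t) ^ 2 ∂(mu T)) + ∫ t, (U.lam₂ t - W.lam₂ t) ^ 2 ∂(mu T) ≤
      multiplierConst p L M * (κ + T * g + C₀ * κ) * Y₀ := by
    have i1 := (U.memLp_lam₁.sub W.memLp_lam₁).integrable_sq
    have i2 := (U.memLp_lam₂.sub W.memLp_lam₂).integrable_sq
    have := integral_add i1 i2
    simp only [Pi.sub_apply] at this
    rwa [← this]
  have hn1 : 0 ≤ ∫ t, (U.lam₁ t - W.lam₁ t) ^ 2 ∂(mu T) := integral_nonneg fun _ => sq_nonneg _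
  have hn2 : 0 ≤ ∫ t, (U.lam₂ t - W.lam₂ t) ^ 2 ∂(mu T) := integral_nonneg fun _ => sq_nonneg _
  have hA : 0 ≤ (1 + (g + C₀ * κ)) * Y₀ := by positivity
  have hB : 0 ≤ multiplierConst p L M * (κ + T * g + C₀ * κ) * Y₀ := by positivity
  refine ⟨?_, ?_, fun τ hτ => ?_⟩
  · rw [intervalIntegral_eq_mu hT.le, intervalIntegral_eq_mu hL.le, hC, add_mul]
    linarith
  · rw [intervalIntegral_eq_mu hT.le, intervalIntegral_eq_mu hL.le, hC, add_mul]
    linarith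
  · simp_rw [intervalIntegral_eq_mu hT.le, intervalIntegral_eq_mu hL.le]
    rw [hC, add_mul]
    have hus : ∀ t s, U.us t s - W.us t s = U.a t s - W.a t s := fun t s => by
      simp [WeakSolution.a]
    simp_rw [hus]
    have := hYle τ (Ioo_subset_Ico_self hτ)
    linarith

/-- Continuous functions which agree almost everywhere on `(0, L)`, and are periodic, agree. -/
lemma eq_of_integral_sq_sub_eq_zero {L : ℝ} (hL : 0 < L) {f g : ℝ → ℝ} (hf : Continuous f)
    (hg : Continuous g) (hfp : Function.Periodic f L) (hgp : Function.Periodic g L)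
    (h : ∫ s, (f s - g s) ^ 2 ∂(mu L) = 0) (s : ℝ) : f s = g s := by
  have hi := Continuous.integrable_mu ((hf.sub hg).fun_pow 2) L
  have h1 := (integral_eq_zero_iff_of_nonneg (fun s => sq_nonneg _) hi).1 h
  have h2 : f =ᵐ[mu L] g := by
    filter_upwards [h1] with s hs
    have : (f s - g s) ^ 2 = 0 := hs
    nlinarith [pow_eq_zero_iff (two_ne_zero) |>.1 this]
  have h3 : EqOn f g (Ioo 0 L) :=
    Measure.eqOn_open_of_ae_eq h2 isOpen_Ioo hf.continuousOn hg.continuousOn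
  have h4 : EqOn f g (Icc 0 L) := by
    have := h3.closure hf hg
    rwa [closure_Ioo hL.ne] at this
  have hz : f (toIcoMod hL 0 s) = g (toIcoMod hL 0 s) := by
    have := toIcoMod_mem_Ico hL 0 s
    rw [zero_add] at this
    exact h4 (Ico_subset_Icc_self this)
  have e : toIcoMod hL 0 s = s - toIcoDiv hL 0 s • L := rfl
  rw [e, hfp.sub_zsmul_eq, hgp.sub_zsmul_eq] at hz
  exact hz

theorem StabilityEstimate.coincide {p L : ℝ} {η : ℕ} {T : ℝ} {u₀ w₀ : ℝ → ℝ}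
    {U : WeakSolution p L η T u₀} {W : WeakSolution p L η T w₀} (hT : 0 < T)
    (hL : 0 < L) {C : ℝ} (h : StabilityEstimate C U W) (h0 : u₀ = w₀) : Coincide U W := by
  have hz : C * ∫ s in (0 : ℝ)..L, (u₀ s - w₀ s) ^ 2 = 0 := by simp [h0]
  have hlam : ∀ l m : ℝ → ℝ, MemLp l 2 (mu T) → MemLp m 2 (mu T) →
      ∫ t in (0 : ℝ)..T, (l t - m t) ^ 2 ≤ 0 → ∀ᵐ t ∂(mu T), l t = m t := by
    intro l m hl hm hle
    rw [intervalIntegral_eq_mu hT.le] at hle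
    have he := le_antisymm hle (integral_nonneg fun _ => sq_nonneg _)
    have := (integral_eq_zero_iff_of_nonneg (fun _ => sq_nonneg _) (hl.sub hm).integrable_sq).1 he
    filter_upwards [this] with t ht
    have h2 : (l t - m t) ^ 2 = 0 := ht
    nlinarith [pow_eq_zero_iff (two_ne_zero) |>.1 h2]
  refine ⟨fun t ht s => ?_, hlam _ _ U.memLp_lam₁ W.memLp_lam₁ (h.lam₁_le.trans hz.le),
    hlam _ _ U.memLp_lam₂ W.memLp_lam₂ (h.lam₂_le.trans hz.le)⟩
  rcases ht.1.eq_or_lt with h1 | h1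
  · rw [← h1, U.initial, W.initial, h0]
  · have e := (h.energy_le t ⟨h1, ht.2⟩).trans hz.le
    simp_rw [intervalIntegral_eq_mu hT.le, intervalIntegral_eq_mu hL.le] at e
    have hn : 0 ≤ ∫ t, ∫ s, (U.us t s - W.us t s) ^ 2 ∂(mu L) ∂(mu T) :=
      integral_nonneg fun _ => integral_nonneg fun _ => sq_nonneg _
    have hn2 : 0 ≤ ∫ s, (U.u t s - W.u t s) ^ 2 ∂(mu L) := integral_nonneg fun _ => sq_nonneg _
    obtain ⟨du, hu⟩ := U.memW1Per t ht
    obtain ⟨dw, hw⟩ := W.memW1Per t ht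
    exact eq_of_integral_sq_sub_eq_zero hL hu.continuous hw.continuous hu.periodic hw.periodic
      (by linarith) s

/-- The case `p = 2`. -/
theorem exists_stability_two {L : ℝ} (hL : 0 < L) {η : ℕ} (hη : 1 ≤ η) {T : ℝ} (hT : 0 < T)
    (M : ℝ) : ∃ C : ℝ, 0 < C ∧
      ∀ u₀ du₀ w₀ dw₀ : ℝ → ℝ, MemW1Per 2 L u₀ du₀ → MemW1Per 2 L w₀ dw₀ →
        cStar 2 L η du₀ ≤ M → cStar 2 L η dw₀ ≤ M →
        ∀ (U : WeakSolution 2 L η T u₀) (W : WeakSolution 2 L η T w₀),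
          StabilityEstimate C U W ∧ (u₀ = w₀ → Coincide U W) := by
  -- `M` may be negative, in which case no datum qualifies; `|M|` keeps the constant positive in all
  -- cases.
  have hM0 : 0 ≤ |M| := abs_nonneg M
  refine ⟨_, stabilityConst_pos (p := 2) hL hT hM0 zero_le_one, fun u₀ du₀ w₀ dw₀ hu hw hcu hcw U W => ?_⟩
  have hE : ∀ (d : ℝ → ℝ), cStar 2 L η d ≤ M → ∫ s, |d s + dphi L η| ^ (2 : ℝ) ∂(mu L) ≤ |M| := by
    intro d hd
    unfold cStar at hd
    rw [intervalIntegral_eq_mu hL.le] at hd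
    have h0 : 0 ≤ ∫ s, |d s + dphi L η| ^ (2 : ℝ) ∂(mu L) := integral_nonneg fun _ => by positivity
    linarith [le_abs_self M]
  have hst : StabilityEstimate (stabilityConst 2 L T |M| 1) U W := by
    refine stabilityEstimate_of_le_dissipation U W le_rfl hT hL hη hM0 zero_le_one ?_ ?_ ?_
    · filter_upwards [U.ae_energy_le le_rfl hT hL hη hu] with t ht using ht.trans (hE _ hcu)
    · filter_upwards [W.ae_energy_le le_rfl hT hL hη hw] with t ht using ht.trans (hE _ hcw)
    -- For `p = 2` the flux is the identity, so the dissipation is the squared `L²` distance.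
    · refine ae_of_all _ fun t => le_of_eq ?_
      rw [one_mul, dissipation]
      refine integral_congr_ae (ae_of_all _ fun s => ?_)
      simp [pFlux, sq]
  exact ⟨hst, hst.coincide hT hL⟩

/-! ### Restriction of weak solutions to shorter time intervals -/

lemma measurePreserving_shift (h S : ℝ) :
    MeasurePreserving (fun t : ℝ => h + t) (mu S) (volume.restrict (Ioo h (h + S))) := by
  have := (measurePreserving_add_left (volume : Measure ℝ) h).restrict_preimage
    (measurableSet_Ioo (a := h) (b := h + S))
  convert! this using 2
  ext x; simp

lemma measurePreserving_unshift (h S : ℝ) :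
    MeasurePreserving (fun t : ℝ => t - h) (volume.restrict (Ioo h (h + S))) (mu S) := by
  have := (measurePreserving_sub_right (volume : Measure ℝ) h).restrict_preimage
    (measurableSet_Ioo (a := 0) (b := S))
  convert! this using 2
  ext x; simp [add_comm h]

lemma ae_mu_shift {T h S : ℝ} (h0 : 0 ≤ h) (hS : h + S ≤ T) {P : ℝ → Prop}
    (hP : ∀ᵐ t ∂(mu T), P t) : ∀ᵐ t ∂(mu S), P (h + t) :=
  (measurePreserving_shift h S).quasiMeasurePreserving.ae
    (ae_mono (Measure.restrict_mono (Ioo_subset_Ioo h0 hS) le_rfl) hP)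

lemma prod_restrict_le {T L h S : ℝ} (h0 : 0 ≤ h) (hS : h + S ≤ T) :
    (volume.restrict (Ioo h (h + S))).prod (mu L) ≤ (mu T).prod (mu L) := by
  rw [Measure.prod_restrict, Measure.prod_restrict]
  exact Measure.restrict_mono (prod_mono (Ioo_subset_Ioo h0 hS) le_rfl) le_rfl

namespace MemLinftyW1Per

variable {p L T : ℝ} {v dv : ℝ → ℝ → ℝ}

lemma shift (H : MemLinftyW1Per p L T v dv) {h S : ℝ} (h0 : 0 ≤ h) (hS : h + S ≤ T) :
    MemLinftyW1Per p L S (fun t => v (h + t)) (fun t => dv (h + t)) := by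
  have hmp : MeasurePreserving (fun z : ℝ × ℝ => (h + z.1, z.2)) ((mu S).prod (mu L))
      ((volume.restrict (Ioo h (h + S))).prod (mu L)) :=
    (measurePreserving_shift h S).prod (MeasurePreserving.id _)
  have h1 := H.aestronglyMeasurable
  have h2 := H.aestronglyMeasurable_deriv
  rw [cylinder_eq] at h1 h2
  obtain ⟨K, hK⟩ := H.bounded
  refine ⟨?_, ?_, ae_mu_shift h0 hS H.memW1Per, K, ae_mu_shift h0 hS hK⟩
  · rw [cylinder_eq]
    exact (h1.mono_measure (prod_restrict_le h0 hS)).comp_measurePreserving hmp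
  · rw [cylinder_eq]
    exact (h2.mono_measure (prod_restrict_le h0 hS)).comp_measurePreserving hmp

lemma aestronglyMeasurable_extend {T L h S : ℝ} {v : ℝ → ℝ → ℝ}
    (H : AEStronglyMeasurable (fun z : ℝ × ℝ => v z.1 z.2) (cylinder S L)) (h0 : 0 ≤ h)
    (hS : h + S ≤ T) :
    AEStronglyMeasurable (fun z : ℝ × ℝ => (Ioo h (h + S)).indicator (fun t => v (t - h) z.2) z.1)
      (cylinder T L) := by
  rw [cylinder_eq] at H ⊢
  have hmp : MeasurePreserving (fun z : ℝ × ℝ => (z.1 - h, z.2))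
      ((volume.restrict (Ioo h (h + S))).prod (mu L)) ((mu S).prod (mu L)) :=
    (measurePreserving_unshift h S).prod (MeasurePreserving.id _)
  have e : (fun z : ℝ × ℝ => (Ioo h (h + S)).indicator (fun t => v (t - h) z.2) z.1) =
      (Ioo h (h + S) ×ˢ univ).indicator (fun z : ℝ × ℝ => v (z.1 - h) z.2) := by
    ext z; simp [indicator_apply]
  rw [e, aestronglyMeasurable_indicator_iff (measurableSet_Ioo.prod MeasurableSet.univ),
    ← Measure.prod_restrict, Measure.restrict_univ, Measure.restrict_restrict measurableSet_Ioo,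
    inter_eq_left.2 (Ioo_subset_Ioo h0 hS)]
  exact H.comp_measurePreserving hmp

/-- Extension by zero of a test function to a longer time interval. -/
lemma extend {h S : ℝ} (H : MemLinftyW1Per p L S v dv) (h0 : 0 ≤ h) (hS : h + S ≤ T) :
    MemLinftyW1Per p L T (fun t s => (Ioo h (h + S)).indicator (fun t => v (t - h) s) t)
      (fun t s => (Ioo h (h + S)).indicator (fun t => dv (t - h) s) t) := by
  have hae : ∀ {P : ℝ → Prop}, (∀ᵐ t ∂(mu S), P t) →
      ∀ᵐ t ∂(mu T), t ∈ Ioo h (h + S) → P (t - h) := fun hP => by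
    have := (ae_restrict_iff' measurableSet_Ioo).1
      ((measurePreserving_unshift h S).quasiMeasurePreserving.ae hP)
    exact ae_restrict_of_ae this
  obtain ⟨K, hK⟩ := H.bounded
  refine ⟨aestronglyMeasurable_extend H.aestronglyMeasurable h0 hS,
    aestronglyMeasurable_extend H.aestronglyMeasurable_deriv h0 hS, ?_, K, ?_⟩
  · filter_upwards [hae H.memW1Per] with t ht
    by_cases hA : t ∈ Ioo h (h + S)
    · simpa only [indicator_of_mem hA] using ht hA
    · simpa only [indicator_of_notMem hA] using MemW1Per.zero p L
  · filter_upwards [hae hK] with t ht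
    by_cases hA : t ∈ Ioo h (h + S)
    · simpa only [indicator_of_mem hA] using ht hA
    · simp [indicator_of_notMem hA]

end MemLinftyW1Per

lemma IsTimePrimitive.memH1L2 {T L : ℝ} (hT : 0 < T) {v g : ℝ → ℝ → ℝ}
    (h : IsTimePrimitive T L v g) : MemH1L2 L T v g where
  memLp := by rw [cylinder_eq]; exact h.memLp
  memLp_deriv := by rw [cylinder_eq]; exact h.memLp_deriv
  weakDeriv ψ hψ _ hs := by
    filter_upwards [h.ae_isPrimitive hT, ae_ae_swap_of_ae_prod (h.ae_eq hT)] with s h1 h2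
    rw [← h1.integral_mul_deriv_test hT.le hψ hs, intervalIntegral_eq_mu hT.le,
      intervalIntegral_eq_mu hT.le]
    refine integral_congr_ae ?_
    filter_upwards [h2] with t ht
    rw [← ht]

namespace WeakSolution

variable {p L : ℝ} {η : ℕ} {T : ℝ} {u₀ : ℝ → ℝ}

/-- The weak solution on `[h, h + S)`, with initial time moved to `0`. -/
noncomputable def shift (U : WeakSolution p L η T u₀) (hL : 0 < L) {h S : ℝ} (hS0 : 0 < S)
    (h0 : 0 ≤ h) (hS : h + S ≤ T) : WeakSolution p L η S (U.u h) where
  u t := U.u (h + t)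
  ut t := U.ut (h + t)
  us t := U.us (h + t)
  lam₁ t := U.lam₁ (h + t)
  lam₂ t := U.lam₂ (h + t)
  memLinftyW1Per := U.memLinftyW1Per.shift h0 hS
  memH1L2 := ((U.isTimePrimitive (by linarith) hL).shift h0 hS).memH1L2 hS0
  memW1Per t ht := U.memW1Per _ ⟨by linarith [ht.1], by linarith [ht.2]⟩
  continuous_time t₀ ht₀ := by
    refine (U.continuous_time (h + t₀) ⟨by linarith [ht₀.1], by linarith [ht₀.2]⟩).comp ?_
    refine tendsto_nhdsWithin_iff.2 ⟨?_, ?_⟩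
    · exact tendsto_nhdsWithin_of_tendsto_nhds ((continuous_const_add h).tendsto t₀)
    · filter_upwards [self_mem_nhdsWithin] with t ht
      exact ⟨by linarith [ht.1], by linarith [ht.2]⟩
  memLp_lam₁ := (U.memLp_lam₁.mono_measure
    (Measure.restrict_mono (Ioo_subset_Ioo h0 hS) le_rfl)).comp_measurePreserving
      (measurePreserving_shift h S)
  memLp_lam₂ := (U.memLp_lam₂.mono_measure
    (Measure.restrict_mono (Ioo_subset_Ioo h0 hS) le_rfl)).comp_measurePreserving
      (measurePreserving_shift h S)
  weakEquation v dv hv := by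
    have hT : 0 < T := by linarith
    have key := U.weakEquation _ _ (hv.extend h0 hS)
    rw [intervalIntegral_eq_mu hT.le] at key
    rw [intervalIntegral_eq_mu hS0.le]
    have e : (fun t => ∫ s in (0 : ℝ)..L,
        ((U.ut t s - U.lam₁ t * Real.sin (U.u t s + phi L η s)
          + U.lam₂ t * Real.cos (U.u t s + phi L η s)) *
            (Ioo h (h + S)).indicator (fun t => v (t - h) s) t
        + pFlux p (U.us t s + dphi L η) * (Ioo h (h + S)).indicator (fun t => dv (t - h) s) t)) =
      (Ioo h (h + S)).indicator (fun t => ∫ s in (0 : ℝ)..L,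
        ((U.ut t s - U.lam₁ t * Real.sin (U.u t s + phi L η s)
          + U.lam₂ t * Real.cos (U.u t s + phi L η s)) * v (t - h) s
        + pFlux p (U.us t s + dphi L η) * dv (t - h) s)) := by
      ext t
      by_cases hA : t ∈ Ioo h (h + S)
      · simp only [indicator_of_mem hA]
      · simp [indicator_of_notMem hA]
    rw [e, integral_indicator measurableSet_Ioo, Measure.restrict_restrict measurableSet_Ioo,
      inter_eq_left.2 (Ioo_subset_Ioo h0 hS), ← (measurePreserving_shift h S).integral_comp
        (Homeomorph.addLeft h).measurableEmbedding] at key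
    simpa only [add_sub_cancel_left] using key
  closed_cos t ht := U.closed_cos _ ⟨by linarith [ht.1], by linarith [ht.2]⟩
  closed_sin t ht := U.closed_sin _ ⟨by linarith [ht.1], by linarith [ht.2]⟩
  initial s := by rw [add_zero]

/-- Translations in time are controlled by the initial increment. -/
lemma integral_sq_sub_shift_le (U : WeakSolution p L η T u₀) (hp : 2 ≤ p) (hL : 0 < L) {Λ : ℝ}
    (hΛ : 0 ≤ Λ) (hU : ∀ᵐ t ∂(mu T), |U.lam₁ t| ≤ Λ ∧ |U.lam₂ t| ≤ Λ) {h t : ℝ} (h0 : 0 ≤ h)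
    (ht : 0 ≤ t) (hT : h + t < T) :
    ∫ s, (U.u (h + t) s - U.u t s) ^ 2 ∂(mu L) ≤
      Real.exp (8 * Λ * T) * ∫ s, (U.u h s - u₀ s) ^ 2 ∂(mu L) := by
  have hS0 : 0 < T - h := by linarith
  -- The translate by `h` and the unshifted solution both solve the problem on `[0, T - h)`, so the
  -- stability estimate compares them with each other.
  have key := integral_sq_sub_le (U.shift hL hS0 h0 (by linarith))
    (U.shift hL hS0 le_rfl (by linarith)) hp hS0 hL hΛ
    (ae_mu_shift (T := T) h0 (by linarith) hU) (ae_mu_shift (T := T) le_rfl (by linarith) hU)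
    (τ := t) ⟨ht, by linarith⟩
  simp only [shift, zero_add, U.initial] at key
  refine key.trans (mul_le_mul_of_nonneg_right (Real.exp_le_exp.2 ?_)
    (integral_nonneg fun _ => sq_nonneg _))
  exact mul_le_mul_of_nonneg_left (by linarith) (by positivity)

end WeakSolution

/-! ### Comparison with a regular initial datum -/

/-- The formulas are Cramer's rule for the linear system satisfied by the multipliers, so the same
bound applies. -/
lemma abs_lamTilde_le {p L : ℝ} (hp : 2 ≤ p) (hL : 0 < L) {η : ℕ} (hη : 1 ≤ η) {θ a : ℝ → ℝ}
    (h : IsPrimitive 0 L θ a) (hθ : Continuous θ) (hw : θ L = θ 0 + 2 * Real.pi * η)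
    (ha : MemLp a (ENNReal.ofReal p) (mu L)) :
    |lamTilde₁ p L θ a| ≤ lamBound L (∫ s, |a s| ^ p ∂(mu L)) ∧
      |lamTilde₂ p L θ a| ≤ lamBound L (∫ s, |a s| ^ p ∂(mu L)) := by
  have hE : 0 ≤ ∫ s, |a s| ^ p ∂(mu L) := integral_nonneg fun _ => by positivity
  have hb := lamBound_nonneg hL.le hE
  -- With a vanishing determinant the quotients are zero by the convention for division, and the
  -- bound is trivial.
  by_cases hd : (matAT L θ).det = 0
  · simp only [lamTilde₁, lamTilde₂, hd, div_zero, zero_mul, abs_zero]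
    exact ⟨hb, hb⟩
  have hc : ∀ s, Real.cos (θ s) * Real.sin (θ s) = Real.sin (θ s) * Real.cos (θ s) := fun s =>
    mul_comm _ _
  have hdet : (matAT L θ).det = (∫ s, Real.sin (θ s) ^ 2 ∂(mu L)) *
      (∫ s, Real.cos (θ s) ^ 2 ∂(mu L)) - (∫ s, Real.sin (θ s) * Real.cos (θ s) ∂(mu L)) ^ 2 := by
    rw [matAT, Matrix.det_fin_two_of]
    simp_rw [intervalIntegral_eq_mu hL.le]
    ring
  rw [hdet] at hd
  refine abs_le_lamBound hp hL hη h hθ hw ha ?_ ?_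
  · rw [lamTilde₁, lamTilde₂, hdet]
    simp_rw [intervalIntegral_eq_mu hL.le, hc]
    field_simp
    ring
  · rw [lamTilde₁, lamTilde₂, hdet]
    simp_rw [intervalIntegral_eq_mu hL.le, hc]
    field_simp
    ring

/-- A datum whose flux has a weak derivative, in the form of a weak stationary equation with right
hand side `V`. -/
structure RegularDatum (p L : ℝ) (η : ℕ) (Λ : ℝ) (u₀ du₀ V : ℝ → ℝ) : Prop where
  memW1Per : MemW1Per p L u₀ du₀
  memLp : MemLp V 2 (mu L)
  weakEquation : ∃ x y : ℝ, |x| ≤ Λ ∧ |y| ≤ Λ ∧ ∀ χ dχ : ℝ → ℝ, MemW1Per p L χ dχ →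
    ∫ s, pFlux p (du₀ s + dphi L η) * dχ s ∂(mu L) =
      -∫ s, (V s - x * Real.sin (u₀ s + phi L η s) + y * Real.cos (u₀ s + phi L η s)) * χ s ∂(mu L)

/-- The exponent passes from `2` to `p` because the derivative is continuous, hence bounded on the
interval. -/
lemma MemW2Per.memW1Per {p L : ℝ} (hL : 0 < L) {f df ddf : ℝ → ℝ}
    (h : MemW2Per 2 L f df ddf) : MemW1Per p L f df :=
  (h.1.isPrimitive le_rfl hL).memW1Per hL h.1.continuous h.1.periodic
    (Continuous.memLp_mu h.2.continuous _ L)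

/-- Integration by parts moves the weak derivative of the flux onto the test function, and
periodicity removes the boundary terms. The datum thus becomes a stationary solution with
multipliers `λ̃₁`, `λ̃₂` and the additional force `V₀`. -/
lemma SmallDatum.regularDatum {p L : ℝ} (hp : 2 ≤ p) (hL : 0 < L) {η : ℕ} (hη : 1 ≤ η)
    {κ M : ℝ} {u₀ du₀ ddu₀ : ℝ → ℝ} (h : MemW2Per 2 L u₀ du₀ ddu₀)
    (hM : ∫ s, |du₀ s + dphi L η| ^ p ∂(mu L) ≤ M) (hs : SmallDatum p L η κ u₀ du₀) :
    ∃ V, RegularDatum p L η (lamBound L M) u₀ du₀ V ∧ ∫ s, V s ^ 2 ∂(mu L) ≤ κ := by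
  obtain ⟨G, hG, hG2, hV⟩ := hs.velocity
  have hu := h.1.continuous
  have hφ := continuous_phi L η
  have hdu := h.2.continuous
  have hθ : IsPrimitive 0 L (fun s => u₀ s + phi L η s) (fun s => du₀ s + dphi L η) :=
    (h.1.isPrimitive le_rfl hL).add (isPrimitive_phi L η 0 L)
  have hE : 0 ≤ ∫ s, |du₀ s + dphi L η| ^ p ∂(mu L) := integral_nonneg fun _ => by positivity
  have hlam := abs_lamTilde_le hp hL hη hθ (hu.add hφ) (by
    have h1 := h.1.periodic 0
    have h2 := phi_add_period hL η 0
    rw [zero_add] at h1 h2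
    rw [h1, h2]; ring) (Continuous.memLp_mu (hdu.add continuous_const) _ L)
  have hmono := lamBound_mono hL.le hE hM
  refine ⟨initialVelocity p L η u₀ du₀ G, ⟨h.memW1Per hL, ?_, _, _, hlam.1.trans hmono,
    hlam.2.trans hmono, fun χ dχ hχ => ?_⟩, ?_⟩
  · have hsin : Continuous fun s => lamTilde₁ p L (fun x => u₀ x + phi L η x)
        (fun x => du₀ x + dphi L η) * Real.sin (u₀ s + phi L η s) := by fun_prop
    have hcos : Continuous fun s => lamTilde₂ p L (fun x => u₀ x + phi L η x)
        (fun x => du₀ x + dphi L η) * Real.cos (u₀ s + phi L η s) := by fun_prop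
    exact (hG2.add (Continuous.memLp_mu hsin 2 L)).sub (Continuous.memLp_mu hcos 2 L)
  · have hF : IsPrimitive 0 L (fun s => pFlux p (du₀ s + dphi L η)) G :=
      hG.isPrimitive hL ((continuous_pFlux hp).comp (hdu.add continuous_const)).continuousOn
        ((intervalIntegrable_iff_mu hL.le _).2 (hG2.integrable (by norm_num)))
    rw [hF.integral_mul_eq_neg hL (hχ.isPrimitive hp hL) (by
      have h1 := h.2.periodic 0
      have h2 := hχ.periodic 0
      rw [zero_add] at h1 h2
      rw [h1, h2])]
    congr 1
    refine integral_congr_ae (ae_of_all _ fun s => ?_)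
    simp only [initialVelocity]
    ring
  · rw [intervalIntegral_eq_mu hL.le] at hV
    exact hV.trans (min_le_right _ _)

lemma RegularDatum.memLp_deriv {p L : ℝ} {η : ℕ} {Λ : ℝ} {u₀ du₀ V : ℝ → ℝ}
    (h : RegularDatum p L η Λ u₀ du₀ V) :
    MemLp (fun s => du₀ s + dphi L η) (ENNReal.ofReal p) (mu L) :=
  h.memW1Per.memLp_deriv.add (memLp_const _)

namespace WeakSolution

variable {p L : ℝ} {η : ℕ} {T : ℝ} {u₀ : ℝ → ℝ} (U : WeakSolution p L η T u₀)

/-- The analogue of `ae_dissipation_le` with the datum as second, stationary solution; its force `V`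
appears as an extra pairing. The closing conditions of the datum are those of the solution at time
zero. -/
lemma ae_dissipation_datum_le (hp : 2 ≤ p) (hT : 0 < T) (hL : 0 < L) {Λ : ℝ}
    (hU : ∀ᵐ t ∂(mu T), |U.lam₁ t| ≤ Λ ∧ |U.lam₂ t| ≤ Λ) {du₀ V : ℝ → ℝ}
    (h₀ : RegularDatum p L η Λ u₀ du₀ V) :
    ∀ᵐ t ∂(mu T), (∫ s, U.ut t s * (U.u t s - u₀ s) ∂(mu L)) +
      dissipation p L (U.a t) (fun s => du₀ s + dphi L η) ≤
        4 * Λ * (∫ s, (U.u t s - u₀ s) ^ 2 ∂(mu L)) + ∫ s, V s * (U.u t s - u₀ s) ∂(mu L) := by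
  have h0I : (0 : ℝ) ∈ Ico 0 T := ⟨le_rfl, hT⟩
  have hu0 : U.u 0 = u₀ := funext U.initial
  have hc0 : ∫ s, Real.cos (u₀ s + phi L η s) ∂(mu L) = 0 := by
    rw [← hu0]; exact U.integral_cos_eq_zero hL h0I
  have hs0 : ∫ s, Real.sin (u₀ s + phi L η s) ∂(mu L) = 0 := by
    rw [← hu0]; exact U.integral_sin_eq_zero hL h0I
  have hcu := h₀.memW1Per.continuous
  have hφ := continuous_phi L η
  obtain ⟨x, y, hx, hy, hxy⟩ := h₀.weakEquation
  filter_upwards [U.ae_equation hp hT hL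
    (U.memLinftyW1Per.sub hp hL (MemLinftyW1Per.const h₀.memW1Per)), hU, U.ae_memLp_ut,
    U.ae_memLp_a, U.memLinftyW1Per.memW1Per, ae_mem_Ico T] with t e1 h1 m1 a1 w1 htI
  have c1 := U.integral_drift_mul_sub hL htI m1 hcu hc0 hs0 h1.1 h1.2
  have e2 := hxy _ _ (w1.sub hp hL h₀.memW1Per)
  have hz : Continuous (fun s => U.u t s - u₀ s) := (U.continuous_u htI).sub hcu
  have hcθ := U.continuous_θ htI
  have hneg : ∀ f : ℝ → ℝ, ∫ s, f s * (u₀ s + phi L η s - U.θ t s) ∂(mu L) =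
      -∫ s, f s * (U.u t s - u₀ s) ∂(mu L) := fun f => by
    rw [← integral_neg]
    refine integral_congr_ae (ae_of_all _ fun s => ?_)
    simp only [θ]; ring
  have hsq : ∫ s, (u₀ s + phi L η s - U.θ t s) ^ 2 ∂(mu L) =
      ∫ s, (U.u t s - u₀ s) ^ 2 ∂(mu L) := by
    refine integral_congr_ae (ae_of_all _ fun s => ?_)
    simp only [θ]; ring
  have b1 := abs_integral_sin_mul_le (L := L) (θ := fun s => u₀ s + phi L η s) (hcu.add hφ) hcθ
    (by rw [U.integral_cos_eq_zero hL htI]; exact hc0)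
  have b2 := abs_integral_cos_mul_le (L := L) (θ := fun s => u₀ s + phi L η s) (hcu.add hφ) hcθ
    (by rw [U.integral_sin_eq_zero hL htI]; exact hs0)
  rw [hneg (fun s => Real.sin (u₀ s + phi L η s)), hsq, abs_neg] at b1
  rw [hneg (fun s => Real.cos (u₀ s + phi L η s)), hsq, abs_neg] at b2
  have i1 := integrable_mul_of_memLp_two h₀.memLp (Continuous.memLp_mu hz 2 L)
  have i2 : Integrable (fun s => Real.sin (u₀ s + phi L η s) * (U.u t s - u₀ s)) (mu L) :=
    Continuous.integrable_mu (by fun_prop) L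
  have i3 : Integrable (fun s => Real.cos (u₀ s + phi L η s) * (U.u t s - u₀ s)) (mu L) :=
    Continuous.integrable_mu (by fun_prop) L
  have e3 : ∀ s, (V s - x * Real.sin (u₀ s + phi L η s) + y * Real.cos (u₀ s + phi L η s)) *
      (U.u t s - u₀ s) = V s * (U.u t s - u₀ s) -
      x * (Real.sin (u₀ s + phi L η s) * (U.u t s - u₀ s)) +
      y * (Real.cos (u₀ s + phi L η s) * (U.u t s - u₀ s)) := fun s => by ring
  simp_rw [e3] at e2
  rw [integral_add (integrable_fun_sub i1 (i2.const_mul _)) (i3.const_mul _),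
    integral_sub i1 (i2.const_mul _), integral_const_mul, integral_const_mul] at e2
  have d1 := mul_le_mul hx b1 (abs_nonneg _) ((abs_nonneg _).trans hx)
  have d2 := mul_le_mul hy b2 (abs_nonneg _) ((abs_nonneg _).trans hy)
  rw [← abs_mul] at d1 d2
  have hus : ∀ s, U.us t s - du₀ s = U.a t s - (du₀ s + dphi L η) := fun s => by simp [a]
  have hdis : dissipation p L (U.a t) (fun s => du₀ s + dphi L η) =
      (∫ s, pFlux p (U.a t s) * (U.us t s - du₀ s) ∂(mu L)) -
        ∫ s, pFlux p (du₀ s + dphi L η) * (U.us t s - du₀ s) ∂(mu L) := by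
    simp_rw [hus, dissipation, sub_mul (pFlux p (U.a t _))]
    exact integral_sub (integrable_pFlux_mul hp a1 (a1.sub h₀.memLp_deriv))
      (integrable_pFlux_mul hp h₀.memLp_deriv (a1.sub h₀.memLp_deriv))
  rw [hdis]
  rw [abs_le] at c1 d1 d2
  linarith [c1.1, c1.2, d1.1, d1.2, d2.1, d2.2]

/-- The solution stays close to a regular datum for small times. -/
lemma integral_sq_sub_datum_le (hp : 2 ≤ p) (hL : 0 < L) {Λ : ℝ} (hΛ : 0 ≤ Λ)
    (hU : ∀ᵐ t ∂(mu T), |U.lam₁ t| ≤ Λ ∧ |U.lam₂ t| ≤ Λ) {du₀ V : ℝ → ℝ}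
    (h₀ : RegularDatum p L η Λ u₀ du₀ V) {h : ℝ} (hh : 0 < h) (hhT : h < T) :
    ∫ s, (U.u h s - u₀ s) ^ 2 ∂(mu L) ≤
      Real.exp (8 * Λ * T + 1) * (∫ s, V s ^ 2 ∂(mu L)) * h ^ 2 := by
  have hT : 0 < T := hh.trans hhT
  set v := ∫ s, V s ^ 2 ∂(mu L) with hv
  have hv0 : 0 ≤ v := integral_nonneg fun _ => sq_nonneg _
  have hP := ((U.isTimePrimitive hT hL).sub
    (IsTimePrimitive.const (T := T) h₀.memW1Per.continuous)).isPrimitive_sq hT ⟨hh.le, hhT⟩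
  -- Young's inequality is applied to the force term with weight `h`: over `[0, h]` the rate `1 / h`
  -- costs only a factor `e`, while the constant `h * v` integrates to the desired `h ^ 2 * v`.
  have hg := hP.gronwall (k := 8 * Λ + 1 / h) (c := h * v) hh.le (by positivity) (by positivity) (by
    refine ae_mu_of_le hhT.le ?_
    filter_upwards [U.ae_dissipation_datum_le hp hT hL hU h₀, ae_mem_Ico T] with t ht htI
    have hD := dissipation_nonneg hp L (U.a t) (fun s => du₀ s + dphi L η)
    have hz : Continuous (fun s => U.u t s - u₀ s) :=
      (U.continuous_u htI).sub h₀.memW1Per.continuous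
    have hcs := sq_integral_mul_le h₀.memLp (Continuous.memLp_mu hz 2 L)
    have hY : 0 ≤ ∫ s, (U.u t s - u₀ s) ^ 2 ∂(mu L) := integral_nonneg fun _ => sq_nonneg _
    simp only [sub_zero]
    set Y := ∫ s, (U.u t s - u₀ s) ^ 2 ∂(mu L)
    set N := ∫ s, V s * (U.u t s - u₀ s) ∂(mu L)
    have hyoung : 2 * N ≤ h * v + 1 / h * Y := by
      refine abs_le_of_sq_le_sq' ?_ (by positivity) |>.2
      have : 4 * (v * Y) ≤ (h * v + 1 / h * Y) ^ 2 := by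
        have e : (h * v + 1 / h * Y) ^ 2 = (h * v - 1 / h * Y) ^ 2 + 4 * (v * Y) := by
          field_simp; ring
        rw [e]; linarith [sq_nonneg (h * v - 1 / h * Y)]
      linarith
    linarith)
  simp only [U.initial, sub_self, zero_pow two_ne_zero, integral_zero, zero_add] at hg
  refine hg.trans ?_
  have : Real.exp ((8 * Λ + 1 / h) * h) ≤ Real.exp (8 * Λ * T + 1) := by
    refine Real.exp_le_exp.2 ?_
    have : (8 * Λ + 1 / h) * h = 8 * Λ * h + 1 := by field_simp
    rw [this]
    have := mul_le_mul_of_nonneg_left hhT.le (show 0 ≤ 8 * Λ by positivity)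
    linarith
  calc h * v * h * Real.exp ((8 * Λ + 1 / h) * h)
      ≤ h * v * h * Real.exp (8 * Λ * T + 1) := mul_le_mul_of_nonneg_left this (by positivity)
    _ = _ := by ring

/-- Lipschitz continuity in time, with values in `L²`. -/
lemma integral_sq_sub_le_of_regularDatum (hp : 2 ≤ p) (hL : 0 < L) {Λ : ℝ} (hΛ : 0 ≤ Λ)
    (hU : ∀ᵐ t ∂(mu T), |U.lam₁ t| ≤ Λ ∧ |U.lam₂ t| ≤ Λ) {du₀ V : ℝ → ℝ}
    (h₀ : RegularDatum p L η Λ u₀ du₀ V) {t₁ t₂ : ℝ} (h1 : 0 ≤ t₁) (h12 : t₁ ≤ t₂)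
    (h2 : t₂ < T) :
    ∫ s, (U.u t₂ s - U.u t₁ s) ^ 2 ∂(mu L) ≤
      Real.exp (16 * Λ * T + 1) * (∫ s, V s ^ 2 ∂(mu L)) * (t₂ - t₁) ^ 2 := by
  rcases h12.eq_or_lt with h | h
  · simp [h]
  have e1 := U.integral_sq_sub_shift_le hp hL hΛ hU (h := t₂ - t₁) (t := t₁) (by linarith) h1
    (by linarith)
  have e2 := U.integral_sq_sub_datum_le hp hL hΛ hU h₀ (h := t₂ - t₁) (by linarith) (by linarith)
  rw [sub_add_cancel] at e1
  refine e1.trans ((mul_le_mul_of_nonneg_left e2 (Real.exp_pos _).le).trans (le_of_eq ?_))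
  have e : Real.exp (16 * Λ * T + 1) = Real.exp (8 * Λ * T) * Real.exp (8 * Λ * T + 1) := by
    rw [← Real.exp_add]; congr 1; ring
  rw [e]
  ring

end WeakSolution

/-! ### Bounds on the time derivative -/

/-- Duality in `L²`, tested on a dense sequence. -/
lemma integral_sq_le_of_dense {L K : ℝ} {f : ℝ → ℝ} (hf : MemLp f 2 (mu L)) (hK : 0 ≤ K)
    {d : ℕ → Lp ℝ 2 (mu L)} (hd : DenseRange d)
    (h : ∀ n : ℕ, ∫ s, f s * (d n : ℝ → ℝ) s ∂(mu L) ≤ K * ‖d n‖) :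
    ∫ s, f s ^ 2 ∂(mu L) ≤ K ^ 2 := by
  set x : Lp ℝ 2 (mu L) := hf.toLp f with hx
  have hfx : ∀ χ : Lp ℝ 2 (mu L), inner ℝ χ x = ∫ s, f s * (χ : ℝ → ℝ) s ∂(mu L) := fun χ => by
    rw [L2.inner_def]
    refine integral_congr_ae ?_
    filter_upwards [hf.coeFn_toLp] with s hs
    rw [hx, hs]; rfl
  have hall : ∀ χ : Lp ℝ 2 (mu L), inner ℝ χ x ≤ K * ‖χ‖ := fun χ => by
    refine hd.induction_on
      (p := fun χ => inner ℝ χ x ≤ K * ‖χ‖) χ ?_ fun n => by rw [hfx]; exact h n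
    exact isClosed_le (by fun_prop) (by fun_prop)
  have hxx := hall x
  rw [real_inner_self_eq_norm_sq] at hxx
  have hn : ‖x‖ ≤ K := by
    rcases (norm_nonneg x).eq_or_lt with h0 | h0
    · rwa [← h0]
    · rw [sq] at hxx
      exact le_of_mul_le_mul_right hxx h0
  have e : ∫ s, f s ^ 2 ∂(mu L) = ‖x‖ ^ 2 := by
    rw [← real_inner_self_eq_norm_sq, hfx]
    refine integral_congr_ae ?_
    filter_upwards [hf.coeFn_toLp] with s hs
    rw [hx, hs, sq]
  rw [e]
  exact pow_le_pow_left₀ (norm_nonneg x) hn 2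

namespace IsTimePrimitive

variable {T L : ℝ} {v g : ℝ → ℝ → ℝ}

lemma intervalIntegral_integral_mul (h : IsTimePrimitive T L v g) {χ : ℝ → ℝ}
    (hχ : MemLp χ 2 (mu L)) {τ : ℝ} (hτ : τ ∈ Ico 0 T) :
    ∫ t in (0 : ℝ)..τ, ∫ s, g t s * χ s ∂(mu L) = ∫ s, (v τ s - v 0 s) * χ s ∂(mu L) := by
  have hgv : Integrable (fun z : ℝ × ℝ => g z.1 z.2 * χ z.2) ((mu T).prod (mu L)) :=
    integrable_mul_of_memLp_two h.memLp_deriv (hχ.comp_snd (mu T))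
  refine (integral_eq_of_ae_intervalIntegral (k := fun t s => g t s * χ s) hτ hgv ?_).symm
  filter_upwards [h.eq τ hτ] with s hs
  rw [hs, intervalIntegral.integral_mul_const]; ring

/-- Paired with a fixed `χ`, the Lipschitz bound on `v` gives a bound on the derivative at almost
every time. The null set depends on `χ`, so only a countable dense sequence is used before `L²`
duality. -/
lemma ae_integral_sq_deriv_le (hT : 0 < T) (h : IsTimePrimitive T L v g) {K : ℝ} (hK : 0 ≤ K)
    (hv : ∀ t₁ t₂, 0 ≤ t₁ → t₁ ≤ t₂ → t₂ < T →
      ∫ s, (v t₂ s - v t₁ s) ^ 2 ∂(mu L) ≤ K * (t₂ - t₁) ^ 2) :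
    ∀ᵐ t ∂(mu T), ∫ s, g t s ^ 2 ∂(mu L) ≤ K := by
  have hmem : ∀ᵐ t ∂(mu T), MemLp (g t) 2 (mu L) := by
    filter_upwards [h.memLp_deriv.1.prodMk_left, h.memLp_deriv.integrable_sq.prod_right_ae]
      with t h1 h2
    exact (memLp_two_iff_integrable_sq h1).2 h2
  have key : ∀ χ : Lp ℝ 2 (mu L), ∀ᵐ t ∂(mu T),
      ∫ s, g t s * (χ : ℝ → ℝ) s ∂(mu L) ≤ √K * ‖χ‖ := fun χ => by
    have hχ : MemLp χ 2 (mu L) := Lp.memLp χ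
    have hi : Integrable (fun t => ∫ s, g t s * (χ : ℝ → ℝ) s ∂(mu L)) (mu T) :=
      (integrable_mul_of_memLp_two h.memLp_deriv (hχ.comp_snd (mu T))).integral_prod_left
    refine ae_le_of_intervalIntegral_le hT hi fun t₁ t₂ h1 h12 h2 => ?_
    have m1 : t₁ ∈ Ico 0 T := ⟨h1, h12.trans_lt h2⟩
    have m2 : t₂ ∈ Ico 0 T := ⟨h1.trans h12, h2⟩
    rw [← intervalIntegral.integral_interval_sub_left
      (intervalIntegrable_of_mu hi le_rfl m2.1 h2.le)
      (intervalIntegrable_of_mu hi le_rfl h1 m1.2.le),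
      h.intervalIntegral_integral_mul hχ m1, h.intervalIntegral_integral_mul hχ m2]
    have c0 := h.continuous 0 ⟨le_rfl, hT⟩
    have c1 := h.continuous _ m1
    have c2 := h.continuous _ m2
    have hsub := integral_sub
      (integrable_mul_of_memLp_two (Continuous.memLp_mu (c2.sub c0) 2 L) hχ)
      (integrable_mul_of_memLp_two (Continuous.memLp_mu (c1.sub c0) 2 L) hχ)
    simp only [Pi.sub_apply] at hsub
    rw [← hsub]
    have hcs := sq_integral_mul_le (Continuous.memLp_mu (c2.sub c1) 2 L) hχ
    have hn : ∫ s, (χ : ℝ → ℝ) s ^ 2 ∂(mu L) = ‖χ‖ ^ 2 := by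
      rw [← real_inner_self_eq_norm_sq, L2.inner_def]
      refine integral_congr_ae (ae_of_all _ fun s => ?_)
      simp [sq]
    have e : ∫ s, ((v t₂ s - v 0 s) * (χ : ℝ → ℝ) s - (v t₁ s - v 0 s) * (χ : ℝ → ℝ) s) ∂(mu L) =
        ∫ s, (v t₂ - v t₁) s * (χ : ℝ → ℝ) s ∂(mu L) := by
      refine integral_congr_ae (ae_of_all _ fun s => ?_)
      simp only [Pi.sub_apply]; ring
    rw [e]
    refine (abs_le_of_sq_le_sq' ?_ (by have := sub_nonneg.2 h12; positivity)).2
    rw [hn] at hcs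
    refine hcs.trans ?_
    rw [mul_pow, mul_pow, Real.sq_sqrt hK, mul_right_comm]
    exact mul_le_mul_of_nonneg_right (hv t₁ t₂ h1 h12 h2) (sq_nonneg _)
  have : Fact ((2 : ENNReal) ≠ ⊤) := ⟨by norm_num⟩
  filter_upwards [hmem, ae_all_iff.2 fun n =>
    key (TopologicalSpace.denseSeq (Lp ℝ 2 (mu L)) n)] with t h1 h2
  rw [← Real.sq_sqrt hK]
  exact integral_sq_le_of_dense h1 (Real.sqrt_nonneg K) (TopologicalSpace.denseRange_denseSeq _) h2

end IsTimePrimitive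

/-! ### The flux as a primitive in space -/

/-- Periodic extension of a primitive with equal boundary values. -/
lemma IsPrimitive.exists_memW1Per {p L : ℝ} (hL : 0 < L) {f df : ℝ → ℝ}
    (h : IsPrimitive 0 L f df) (hb : f 0 = f L) (hdf : MemLp df (ENNReal.ofReal p) (mu L)) :
    ∃ g : ℝ → ℝ, MemW1Per p L g df ∧ ∀ s ∈ Icc 0 L, g s = f s := by
  have : Fact (0 < L) := ⟨hL⟩
  have hb' : f 0 = f (0 + L) := by rw [zero_add]; exact hb
  set g : ℝ → ℝ := fun s => AddCircle.liftIco L 0 f (s : AddCircle L) with hg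
  have hc : Continuous g := by
    refine (AddCircle.liftIco_continuous hb' ?_).comp (AddCircle.continuous_mk' L)
    rw [zero_add]; exact h.continuousOn hL.le
  have hper : Function.Periodic g L := fun s => by simp [hg]
  have hI : ∀ s ∈ Icc 0 L, g s = f s := by
    have h1 : ∀ s ∈ Ico 0 L, g s = f s := fun s hs =>
      AddCircle.liftIco_coe_apply (by rwa [zero_add])
    intro s hs
    rcases hs.2.eq_or_lt with h2 | h2
    · have := hper 0
      rw [zero_add] at this
      rw [h2, this, h1 0 ⟨le_rfl, hL⟩, hb]
    · exact h1 s ⟨hs.1, h2⟩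
  exact ⟨g, (h.congr (fun s hs => (hI s hs).symm) (ae_of_all _ fun _ => rfl) hL.le).memW1Per hL hc
    hper hdf, hI⟩

/-- The derivative of the tent function vanishing at `0` and `L` with kink at `q`. -/
noncomputable def tentDeriv (L q s : ℝ) : ℝ := (if s < q then 1 else 0) - q / L

lemma measurable_tentDeriv (L q : ℝ) : Measurable (tentDeriv L q) :=
  (Measurable.ite measurableSet_Iio measurable_const measurable_const).sub measurable_const

lemma memLp_tentDeriv (L q : ℝ) (r : ENNReal) : MemLp (tentDeriv L q) r (mu L) := by
  refine memLp_of_bound (measurable_tentDeriv L q).aestronglyMeasurable (1 + |q / L|)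
    (ae_of_all _ fun s => ?_)
  rw [tentDeriv]
  refine (abs_sub _ _).trans ?_
  split_ifs <;> simp

lemma isPrimitive_tent {L : ℝ} (hL : 0 < L) (q : ℝ) :
    IsPrimitive 0 L (fun x => ∫ t in (0 : ℝ)..x, tentDeriv L q t) (tentDeriv L q) :=
  ⟨(intervalIntegrable_iff_mu hL.le _).2 ((memLp_tentDeriv L q 1).integrable le_rfl),
    fun x _ => by simp⟩

lemma integral_mul_tentDeriv {L q : ℝ} (hq : q ∈ Ico 0 L) {n : ℝ → ℝ}
    (hn : Integrable n (mu L)) : ∫ s, n s * tentDeriv L q s ∂(mu L) =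
      (∫ s in (0 : ℝ)..q, n s) - q / L * ∫ s, n s ∂(mu L) := by
  rw [intervalIntegral_eq_integral_ite hq.1 hq.2.le, ← integral_const_mul]
  have i1 : Integrable (fun s => if s < q then n s else 0) (mu L) := by
    have := hn.indicator (measurableSet_Iio (a := q))
    refine this.congr (ae_of_all _ fun s => ?_)
    simp [indicator_apply]
  rw [← integral_sub i1 (hn.const_mul _)]
  refine integral_congr_ae (ae_of_all _ fun s => ?_)
  simp only [tentDeriv]
  split_ifs <;> ring

lemma tent_right {L q : ℝ} (hL : 0 < L) (hq : q ∈ Ico 0 L) :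
    ∫ t in (0 : ℝ)..L, tentDeriv L q t = 0 := by
  have := integral_mul_tentDeriv hq (n := fun _ => 1) (integrable_const _)
  simp only [one_mul] at this
  rw [intervalIntegral_eq_mu hL.le, this, integral_const, mu_real_univ hL.le]
  simp
  field_simp
  ring

/-- A weak equation tested on tents with rational kinks. -/
lemma exists_ae_eq_add_intervalIntegral {L : ℝ} (hL : 0 < L) {F g : ℝ → ℝ}
    (hF : Integrable F (mu L)) (hg : Integrable g (mu L))
    (h : ∀ q : ℚ, (q : ℝ) ∈ Ioo 0 L →
      (∫ s, g s * (∫ t in (0 : ℝ)..s, tentDeriv L q t) ∂(mu L)) +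
        ∫ s, F s * tentDeriv L q s ∂(mu L) = 0) :
    ∃ c, ∀ᵐ s ∂(mu L), F s = c + ∫ t in (0 : ℝ)..s, g t := by
  have hQ : IsPrimitive 0 L (fun x => ∫ t in (0 : ℝ)..x, g t) g :=
    ⟨(intervalIntegrable_iff_mu hL.le _).2 hg, fun x _ => by simp⟩
  set Q : ℝ → ℝ := fun x => ∫ t in (0 : ℝ)..x, g t with hQdef
  have hQi : Integrable Q (mu L) :=
    (hQ.continuousOn hL.le).integrableOn_Icc.mono_set Ioo_subset_Icc_self
  have hFQ : Integrable (fun s => F s - Q s) (mu L) := hF.sub hQi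
  set c := 1 / L * ∫ s, (F s - Q s) ∂(mu L) with hc
  have hn : Integrable (fun s => F s - Q s - c) (mu L) := hFQ.sub (integrable_const _)
  have hN : IsPrimitive 0 L (fun x => ∫ t in (0 : ℝ)..x, (F t - Q t - c))
      (fun s => F s - Q s - c) :=
    ⟨(intervalIntegrable_iff_mu hL.le _).2 hn, fun x _ => by simp⟩
  -- Testing with the tent at `q` says that the integral of `F - Q` over `(0, q)` is `q` times its
  -- mean `c`.
  have hrat : ∀ q : ℚ, (q : ℝ) ∈ Ioo 0 L → ∫ t in (0 : ℝ)..q, (F t - Q t - c) = 0 := by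
    intro q hq
    have hqI := Ioo_subset_Ico_self hq
    have h1 := h q hq
    have h2 := (isPrimitive_tent hL q).integral_mul_eq_neg hL hQ
      (by rw [tent_right hL hqI]; simp)
    have e1 : ∫ s, g s * (∫ t in (0 : ℝ)..s, tentDeriv L q t) ∂(mu L) =
        -∫ s, Q s * tentDeriv L q s ∂(mu L) := by
      rw [show (fun s => g s * (∫ t in (0 : ℝ)..s, tentDeriv L q t)) =
        fun s => (∫ t in (0 : ℝ)..s, tentDeriv L q t) * g s from funext fun s => mul_comm _ _, h2]
      simp_rw [mul_comm]
    have i1 : Integrable (fun s => F s * tentDeriv L q s) (mu L) := by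
      refine (hF.mul_bdd (measurable_tentDeriv L q).aestronglyMeasurable (c := 1 + |(q : ℝ) / L|)
        (ae_of_all _ fun s => ?_))
      rw [Real.norm_eq_abs, tentDeriv]
      refine (abs_sub _ _).trans ?_
      split_ifs <;> simp
    have i2 : Integrable (fun s => Q s * tentDeriv L q s) (mu L) := by
      refine (hQi.mul_bdd (measurable_tentDeriv L q).aestronglyMeasurable (c := 1 + |(q : ℝ) / L|)
        (ae_of_all _ fun s => ?_))
      rw [Real.norm_eq_abs, tentDeriv]
      refine (abs_sub _ _).trans ?_
      split_ifs <;> simp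
    have e2 := integral_mul_tentDeriv hqI hFQ
    simp_rw [sub_mul (F _)] at e2
    rw [integral_sub i1 i2] at e2
    rw [intervalIntegral.integral_sub (intervalIntegrable_of_mu hFQ le_rfl hqI.1 hqI.2.le)
      intervalIntegrable_const, intervalIntegral.integral_const, smul_eq_mul, sub_zero]
    have e3 : (q : ℝ) * c = q / L * ∫ s, (F s - Q s) ∂(mu L) := by rw [hc]; ring
    rw [e3]
    linarith
  -- The primitive is continuous and vanishes at the rational points, hence everywhere.
  have hz : ∀ τ ∈ Ico 0 L, ∫ t in (0 : ℝ)..τ, (F t - Q t - c) = 0 := by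
    intro τ hτ
    rcases hτ.1.eq_or_lt with h0 | h0
    · rw [← h0]; simp
    by_contra hcon
    have ho := ((hN.continuousOn hL.le).mono Ioo_subset_Icc_self).isOpen_inter_preimage isOpen_Ioo
      (isOpen_compl_singleton (x := (0 : ℝ)))
    obtain ⟨q, hq⟩ := Rat.denseRange_cast.exists_mem_open ho ⟨τ, ⟨h0, hτ.2⟩, hcon⟩
    exact hq.2 (hrat q hq.1)
  refine ⟨c, ?_⟩
  filter_upwards [ae_eq_zero_of_intervalIntegral_eq_zero hL hn hz] with s hs
  linarith

namespace WeakSolution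

variable {p L : ℝ} {η : ℕ} {T : ℝ} {u₀ : ℝ → ℝ} (U : WeakSolution p L η T u₀)

/-- The flux is a primitive of the lower order terms. -/
lemma ae_exists_flux_eq (hp : 2 ≤ p) (hT : 0 < T) (hL : 0 < L) :
    ∀ᵐ t ∂(mu T), ∃ c, ∀ᵐ s ∂(mu L),
      pFlux p (U.a t s) = c + ∫ x in (0 : ℝ)..s, U.drift t x := by
  -- Rational kinks make the family of test functions countable, so one null set of times serves for
  -- all of them.
  have key : ∀ q : ℚ, ∀ᵐ t ∂(mu T), (q : ℝ) ∈ Ioo 0 L →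
      (∫ s, U.drift t s * (∫ x in (0 : ℝ)..s, tentDeriv L q x) ∂(mu L)) +
        ∫ s, pFlux p (U.a t s) * tentDeriv L q s ∂(mu L) = 0 := by
    intro q
    by_cases hq : (q : ℝ) ∈ Ioo 0 L
    · obtain ⟨g, hg, hgs⟩ := (isPrimitive_tent hL q).exists_memW1Per hL
        (by rw [tent_right hL (Ioo_subset_Ico_self hq)]; simp) (memLp_tentDeriv L q (ENNReal.ofReal p))
      filter_upwards [U.ae_equation hp hT hL (MemLinftyW1Per.const hg)] with t ht _
      refine Eq.trans ?_ ht
      congr 1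
      refine integral_congr_ae ?_
      filter_upwards [ae_restrict_mem measurableSet_Ioo] with s hs
      rw [hgs s (Ioo_subset_Icc_self hs)]
    · exact ae_of_all _ fun _ h => absurd h hq
  have hdr : Integrable (fun z : ℝ × ℝ => U.drift z.1 z.2) ((mu T).prod (mu L)) :=
    U.memLp_drift.integrable (by norm_num)
  filter_upwards [ae_all_iff.2 key, U.ae_memLp_a, hdr.prod_right_ae] with t h1 h2 h3
  refine exists_ae_eq_add_intervalIntegral hL ?_ h3 h1
  simpa using integrable_pFlux_mul hp h2 (memLp_const (1 : ℝ))

end WeakSolution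

/-! ### Propagation of nondegeneracy -/

lemma IsPrimitive.sq_sub_le_mul {L : ℝ} {f g : ℝ → ℝ} (h : IsPrimitive 0 L f g)
    (hg : MemLp g 2 (mu L)) {x y : ℝ} (hx : 0 ≤ x) (hxy : x ≤ y) (hy : y ≤ L) :
    (f y - f x) ^ 2 ≤ (y - x) * ∫ s, g s ^ 2 ∂(mu L) := by
  have hsub : Ioo x y ⊆ Ioo 0 L := Ioo_subset_Ioo hx hy
  have hle : volume.restrict (Ioo x y) ≤ mu L := Measure.restrict_mono hsub le_rfl
  have hcs := sq_integral_mul_le (hg.mono_measure hle) (memLp_const (1 : ℝ))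
  rw [← h.integral_eq ⟨hx, hxy.trans hy⟩ ⟨hx.trans hxy, hy⟩, intervalIntegral.integral_of_le hxy,
    ← restrict_Ioo_eq_restrict_Ioc]
  simp only [mul_one, one_pow, integral_const, smul_eq_mul] at hcs
  have hv : (volume.restrict (Ioo x y)).real univ = y - x := by
    rw [measureReal_restrict_apply_univ, Real.volume_real_Ioo_of_le hxy]
  rw [hv, mul_comm] at hcs
  refine hcs.trans (mul_le_mul_of_nonneg_left ?_ (sub_nonneg.2 hxy))
  exact integral_mono_measure hle (ae_of_all _ fun _ => sq_nonneg _) hg.integrable_sq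

lemma IsPrimitive.abs_sub_le_of_mul_le {L : ℝ} {f g : ℝ → ℝ} (h : IsPrimitive 0 L f g)
    (hg : MemLp g 2 (mu L)) {N ℓ r : ℝ} (hN : ∫ s, g s ^ 2 ∂(mu L) ≤ N) (hr : 0 ≤ r)
    (hℓ : ℓ * N ≤ r ^ 2) {x y : ℝ} (hx : x ∈ Icc 0 L) (hy : y ∈ Icc 0 L) (hxy : |y - x| ≤ ℓ) :
    |f y - f x| ≤ r := by
  have hN0 : 0 ≤ ∫ s, g s ^ 2 ∂(mu L) := integral_nonneg fun _ => sq_nonneg _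
  have hsq : (f y - f x) ^ 2 ≤ |y - x| * ∫ s, g s ^ 2 ∂(mu L) := by
    rcases le_total x y with h1 | h1
    · rw [abs_of_nonneg (sub_nonneg.2 h1)]
      exact h.sq_sub_le_mul hg hx.1 h1 hy.2
    · rw [abs_sub_comm, abs_of_nonneg (sub_nonneg.2 h1), ← neg_sq, neg_sub]
      exact h.sq_sub_le_mul hg hy.1 h1 hx.2
  have := (hsq.trans (mul_le_mul hxy hN hN0 ((abs_nonneg _).trans hxy))).trans hℓ
  exact abs_le_of_sq_le_sq this hr

/-- The gap between the levels at which the flux has modulus `m / 2` and `3 m / 8`. -/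
noncomputable def levelGap (p m : ℝ) : ℝ := (m / 2) ^ (p - 1)⁻¹ - (3 * m / 8) ^ (p - 1)⁻¹

lemma levelGap_pos {p m : ℝ} (hp : 2 ≤ p) (hm : 0 < m) : 0 < levelGap p m :=
  sub_pos.2 (Real.rpow_lt_rpow (by positivity) (by linarith) (inv_pos.2 (by linarith)))

/-- If the dissipation between a profile with Hölder continuous flux and a nondegenerate profile
is small, then the first profile is nondegenerate too. -/
lemma ae_le_rpow_of_dissipation_lt {p L m N ℓ c : ℝ} (hp : 2 ≤ p) (hL : 0 < L) (hm : 0 < m)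
    (hℓ : 0 < ℓ) (hℓL : ℓ ≤ L / 2) (hℓN : ℓ * N ≤ (m / 8) ^ 2) {a b g : ℝ → ℝ}
    (ha : MemLp a (ENNReal.ofReal p) (mu L)) (hb : MemLp b (ENNReal.ofReal p) (mu L))
    (hbm : ∀ᵐ s ∂(mu L), m / 2 ≤ |b s| ^ (p - 1)) (hg : MemLp g 2 (mu L))
    (hF : ∀ᵐ s ∂(mu L), pFlux p (a s) = c + ∫ x in (0 : ℝ)..s, g x)
    (hN : ∫ s, g s ^ 2 ∂(mu L) ≤ N) (hD : dissipation p L a b < m / 8 * levelGap p m * ℓ) :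
    ∀ᵐ s ∂(mu L), m / 4 ≤ |a s| ^ (p - 1) := by
  have hH : IsPrimitive 0 L (fun s => c + ∫ x in (0 : ℝ)..s, g x) g :=
    ⟨(intervalIntegrable_iff_mu hL.le _).2 (hg.integrable (by norm_num)), fun x _ => by simp⟩
  have hp1 : 0 < p - 1 := by linarith
  suffices hall : ∀ s ∈ Ioo 0 L, m / 4 ≤ |c + ∫ x in (0 : ℝ)..s, g x| by
    filter_upwards [hF, ae_restrict_mem measurableSet_Ioo] with s hs hsI
    rw [← abs_pFlux hp, hs]
    exact hall s hsI
  intro s₁ hs₁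
  by_contra! hlt
  -- An interval of length `ℓ` starting or ending at `s₁` fits inside, on the right or on the left
  -- according to the half in which `s₁` lies; this uses `ℓ ≤ L / 2`.
  obtain ⟨x, hx0, hxL, hxs⟩ : ∃ x, 0 ≤ x ∧ x + ℓ ≤ L ∧ ∀ s ∈ Ioo x (x + ℓ), |s - s₁| ≤ ℓ := by
    rcases le_total s₁ (L / 2) with h | h
    · exact ⟨s₁, hs₁.1.le, by linarith, fun s hs => abs_le.2 ⟨by linarith [hs.1], by linarith [hs.2]⟩⟩
    · exact ⟨s₁ - ℓ, by linarith, by linarith [hs₁.2],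
        fun s hs => abs_le.2 ⟨by linarith [hs.1], by linarith [hs.2]⟩⟩
  have hsub : Ioo x (x + ℓ) ⊆ Ioo 0 L := Ioo_subset_Ioo hx0 hxL
  -- On this interval Hölder continuity keeps the flux of `a` below `m / 4 + m / 8 = 3 * m / 8` in
  -- modulus, while that of `b` is at least `m / 2`. The dissipation density is then at least the
  -- flux gap `m / 8` times the gap `levelGap p m` of the moduli.
  have hle : ∫ s, (Ioo x (x + ℓ)).indicator (fun _ => m / 8 * levelGap p m) s ∂(mu L) ≤
      dissipation p L a b := by
    refine integral_mono_ae ((integrable_const _).indicator measurableSet_Ioo)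
      (integrable_dissipation hp ha hb) ?_
    filter_upwards [hF, hbm] with s h1 h2
    have hmon := abs_rpow_diff_mul_le hp (a s) (b s)
    by_cases hs : s ∈ Ioo x (x + ℓ)
    · rw [indicator_of_mem hs]
      have h3 := hH.abs_sub_le_of_mul_le hg hN (by positivity) hℓN (Ioo_subset_Icc_self hs₁)
        (Ioo_subset_Icc_self (hsub hs)) (hxs s hs)
      have h4 : |a s| ^ (p - 1) ≤ 3 * m / 8 := by
        rw [← abs_pFlux hp, h1]
        have := abs_sub_abs_le_abs_sub (c + ∫ x in (0 : ℝ)..s, g x) (c + ∫ x in (0 : ℝ)..s₁, g x)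
        linarith
      have h5 : |a s| ≤ (3 * m / 8) ^ (p - 1)⁻¹ := by
        have := Real.rpow_le_rpow (by positivity) h4 (inv_nonneg.2 hp1.le)
        rwa [Real.rpow_rpow_inv (abs_nonneg _) hp1.ne'] at this
      have h6 : (m / 2) ^ (p - 1)⁻¹ ≤ |b s| := by
        have := Real.rpow_le_rpow (by positivity) h2 (inv_nonneg.2 hp1.le)
        rwa [Real.rpow_rpow_inv (abs_nonneg _) hp1.ne'] at this
      have hgap := levelGap_pos hp hm
      have h7 : levelGap p m ≤ |b s| - |a s| := by rw [levelGap]; linarith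
      have h8 : m / 8 ≤ |b s| ^ (p - 1) - |a s| ^ (p - 1) := by linarith
      have h9 := mul_le_mul h8 h7 hgap.le (by linarith)
      linarith
    · rw [indicator_of_notMem hs]
      have := Real.rpow_nonneg (abs_nonneg (a s)) (p - 2)
      have := Real.rpow_nonneg (abs_nonneg (b s)) (p - 2)
      exact (by positivity : (0 : ℝ) ≤ 1 / 2 * ((|a s| ^ (p - 2) + |b s| ^ (p - 2)) *
        (a s - b s) ^ 2)).trans (pFlux_monotone_bound hp (a s) (b s))
  rw [integral_indicator measurableSet_Ioo, Measure.restrict_restrict measurableSet_Ioo,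
    inter_eq_left.2 hsub, setIntegral_const, Real.volume_real_Ioo_of_le (by linarith),
    smul_eq_mul] at hle
  linarith

/-- Between nondegenerate profiles the dissipation controls the `L²` distance. -/
lemma integral_sq_sub_le_dissipation {p L m : ℝ} (hp : 2 ≤ p) (hm : 0 < m) {a b : ℝ → ℝ}
    (ha : MemLp a (ENNReal.ofReal p) (mu L)) (hb : MemLp b (ENNReal.ofReal p) (mu L))
    (ham : ∀ᵐ s ∂(mu L), m ≤ |a s| ^ (p - 1)) (hbm : ∀ᵐ s ∂(mu L), m ≤ |b s| ^ (p - 1)) :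
    ∫ s, (a s - b s) ^ 2 ∂(mu L) ≤ (m ^ ((p - 2) / (p - 1)))⁻¹ * dissipation p L a b := by
  have hp1 : 0 < p - 1 := by linarith
  have hlow : ∀ x : ℝ, m ≤ |x| ^ (p - 1) → m ^ ((p - 2) / (p - 1)) ≤ |x| ^ (p - 2) := fun x hx => by
    have := Real.rpow_le_rpow hm.le hx (show 0 ≤ (p - 2) / (p - 1) by
      exact div_nonneg (by linarith) hp1.le)
    rwa [← Real.rpow_mul (abs_nonneg _), mul_div_cancel₀ _ hp1.ne'] at this
  have hρ : 0 < m ^ ((p - 2) / (p - 1)) := Real.rpow_pos_of_pos hm _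
  rw [dissipation, ← integral_const_mul]
  refine integral_mono_ae (memLp_two_of_memLp hp (ha.sub hb)).integrable_sq
    ((integrable_dissipation hp ha hb).const_mul _) ?_
  filter_upwards [ham, hbm] with s h1 h2
  have e := pFlux_monotone_bound hp (a s) (b s)
  have l1 := hlow _ h1
  have l2 := hlow _ h2
  set ρ := m ^ ((p - 2) / (p - 1))
  have : ρ * (a s - b s) ^ 2 ≤ (pFlux p (a s) - pFlux p (b s)) * (a s - b s) := by
    refine le_trans ?_ e
    rw [← mul_assoc]
    exact mul_le_mul_of_nonneg_right (by linarith) (sq_nonneg _)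
  rw [inv_mul_eq_div, le_div_iff₀ hρ, mul_comm]
  exact this

/-! ### Solutions starting from small data -/

namespace WeakSolution

variable {p L : ℝ} {η : ℕ} {T : ℝ} {u₀ : ℝ → ℝ} (U : WeakSolution p L η T u₀)

lemma integral_sq_drift_le (hL : 0 < L) {t : ℝ} (ht : t ∈ Ico 0 T)
    (hut : MemLp (U.ut t) 2 (mu L)) {Λ : ℝ} (h1 : |U.lam₁ t| ≤ Λ) (h2 : |U.lam₂ t| ≤ Λ) :
    MemLp (U.drift t) 2 (mu L) ∧
      ∫ s, U.drift t s ^ 2 ∂(mu L) ≤ 2 * (∫ s, U.ut t s ^ 2 ∂(mu L)) + 8 * Λ ^ 2 * L := by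
  have hc := U.continuous_θ ht
  have hΛ : 0 ≤ Λ := (abs_nonneg _).trans h1
  have hr : Continuous fun s => U.lam₁ t * Real.sin (U.θ t s) - U.lam₂ t * Real.cos (U.θ t s) := by
    fun_prop
  have hd : U.drift t = fun s => U.ut t s -
      (U.lam₁ t * Real.sin (U.θ t s) - U.lam₂ t * Real.cos (U.θ t s)) := by
    ext s; simp only [drift]; ring
  have hm : MemLp (U.drift t) 2 (mu L) := by
    rw [hd]; exact hut.sub (Continuous.memLp_mu hr 2 L)
  refine ⟨hm, ?_⟩
  calc ∫ s, U.drift t s ^ 2 ∂(mu L) ≤ ∫ s, (2 * U.ut t s ^ 2 + 8 * Λ ^ 2) ∂(mu L) := by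
        refine integral_mono hm.integrable_sq
          ((hut.integrable_sq.const_mul 2).add (integrable_const _)) fun s => ?_
        have b1 : |U.lam₁ t * Real.sin (U.θ t s)| ≤ Λ := by
          rw [abs_mul]
          have := mul_le_mul h1 (Real.abs_sin_le_one (U.θ t s)) (abs_nonneg _) hΛ
          linarith
        have b2 : |U.lam₂ t * Real.cos (U.θ t s)| ≤ Λ := by
          rw [abs_mul]
          have := mul_le_mul h2 (Real.abs_cos_le_one (U.θ t s)) (abs_nonneg _) hΛ
          linarith
        have b3 := (abs_sub _ _).trans (add_le_add b1 b2)
        have b4 := sq_le_sq' (abs_le.1 b3).1 (abs_le.1 b3).2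
        rw [hd]
        simp only
        nlinarith [sq_nonneg (U.ut t s +
          (U.lam₁ t * Real.sin (U.θ t s) - U.lam₂ t * Real.cos (U.θ t s)))]
    _ = _ := by
        rw [integral_add (hut.integrable_sq.const_mul 2) (integrable_const _), integral_const_mul,
          integral_const, mu_real_univ hL.le, smul_eq_mul]
        ring

/-- The growth factor for solutions on time intervals of length at most `T₁`. -/
noncomputable def _root_.PElastic.growth (Λ T₁ : ℝ) : ℝ := Real.exp (16 * Λ * T₁ + 1)

lemma _root_.PElastic.one_le_growth {Λ T₁ : ℝ} (hΛ : 0 ≤ Λ) (hT₁ : 0 ≤ T₁) : 1 ≤ growth Λ T₁ :=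
  Real.one_le_exp (by positivity)

/-- Bound for the square of the `L²` norm of the lower order terms. -/
noncomputable def _root_.PElastic.driftConst (L Λ T₁ : ℝ) : ℝ :=
  2 * growth Λ T₁ + 8 * Λ ^ 2 * L

/-- Bound for the dissipation with respect to the datum, relative to the size of the initial
velocity. -/
noncomputable def _root_.PElastic.dissipationConst (Λ T₁ : ℝ) : ℝ :=
  growth Λ T₁ * (4 * Λ * T₁ ^ 2 + 2 * T₁)

/-- A solution starting from a nondegenerate datum with small initial velocity stays
nondegenerate. -/
lemma ae_le_rpow_of_regularDatum (hp : 2 ≤ p) (hT : 0 < T) (hL : 0 < L) {Λ : ℝ} (hΛ : 0 ≤ Λ)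
    (hU : ∀ᵐ t ∂(mu T), |U.lam₁ t| ≤ Λ ∧ |U.lam₂ t| ≤ Λ) {du₀ V : ℝ → ℝ}
    (h₀ : RegularDatum p L η Λ u₀ du₀ V) {m κ T₁ ℓ : ℝ} (hm : 0 < m)
    (hbm : ∀ᵐ s ∂(mu L), m / 2 ≤ |du₀ s + dphi L η| ^ (p - 1)) (hT₁ : T ≤ T₁) (hκ1 : κ ≤ 1)
    (hV : ∫ s, V s ^ 2 ∂(mu L) ≤ κ) (hℓ : 0 < ℓ) (hℓL : ℓ ≤ L / 2)
    (hℓN : ℓ * driftConst L Λ T₁ ≤ (m / 8) ^ 2)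
    (hκ : κ * dissipationConst Λ T₁ < m / 8 * levelGap p m * ℓ) :
    ∀ᵐ t ∂(mu T), ∀ᵐ s ∂(mu L), m / 4 ≤ |U.a t s| ^ (p - 1) := by
  have hκ0 : 0 ≤ κ := (integral_nonneg fun _ => sq_nonneg _).trans hV
  have hT₁0 : 0 ≤ T₁ := hT.le.trans hT₁
  have hG1 := one_le_growth hΛ hT₁0
  have hGle : Real.exp (16 * Λ * T + 1) ≤ growth Λ T₁ :=
    Real.exp_le_exp.2 (by linarith [mul_le_mul_of_nonneg_left hT₁ (show 0 ≤ 16 * Λ by positivity)])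
  have hGκ : Real.exp (16 * Λ * T + 1) * (∫ s, V s ^ 2 ∂(mu L)) ≤ growth Λ T₁ * κ :=
    mul_le_mul hGle hV (integral_nonneg fun _ => sq_nonneg _) (by linarith)
  have hlip : ∀ t₁ t₂, 0 ≤ t₁ → t₁ ≤ t₂ → t₂ < T →
      ∫ s, (U.u t₂ s - U.u t₁ s) ^ 2 ∂(mu L) ≤ growth Λ T₁ * κ * (t₂ - t₁) ^ 2 :=
    fun t₁ t₂ h1 h12 h2 => (U.integral_sq_sub_le_of_regularDatum hp hL hΛ hU h₀ h1 h12 h2).trans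
      (mul_le_mul_of_nonneg_right hGκ (sq_nonneg _))
  -- Lipschitz continuity in time yields smallness of `∂ₜu`, of order `κ` in the squared `L²` norm.
  have hut := (U.isTimePrimitive hT hL).ae_integral_sq_deriv_le hT
    (K := growth Λ T₁ * κ) (by positivity) hlip
  filter_upwards [hut, hU, U.ae_memLp_ut, U.ae_memLp_a, U.ae_dissipation_datum_le hp hT hL hU h₀,
    U.ae_exists_flux_eq hp hT hL, ae_mem_Ico T] with t e1 e2 m1 m2 e3 e4 htI
  obtain ⟨c, hc⟩ := e4
  obtain ⟨md, hd⟩ := U.integral_sq_drift_le hL htI m1 e2.1 e2.2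
  have hz := hlip 0 t le_rfl htI.1 htI.2
  simp_rw [U.initial, sub_zero] at hz
  have hzc : Continuous (fun s => U.u t s - u₀ s) :=
    (U.continuous_u htI).sub h₀.memW1Per.continuous
  have hz2 : ∫ s, (U.u t s - u₀ s) ^ 2 ∂(mu L) ≤ growth Λ T₁ * κ * T₁ ^ 2 :=
    hz.trans (mul_le_mul_of_nonneg_left (pow_le_pow_left₀ htI.1 (htI.2.le.trans hT₁) 2)
      (by positivity))
  -- Both `∂ₜu` and `V` are paired with `u - u₀`. Each factor has `L²` norm of order `√κ`, so the
  -- dissipation relative to the datum is of order `κ`.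
  have cs1 := sq_integral_mul_le m1 (Continuous.memLp_mu hzc 2 L)
  have cs2 := sq_integral_mul_le h₀.memLp (Continuous.memLp_mu hzc 2 L)
  have hz0 : 0 ≤ ∫ s, (U.u t s - u₀ s) ^ 2 ∂(mu L) := integral_nonneg fun _ => sq_nonneg _
  have bound : ∀ {A v : ℝ}, A ^ 2 ≤ v * ∫ s, (U.u t s - u₀ s) ^ 2 ∂(mu L) → v ≤ growth Λ T₁ * κ →
      |A| ≤ growth Λ T₁ * κ * T₁ := fun {A v} hA hv => by
    refine abs_le_of_sq_le_sq (hA.trans ?_) (by positivity)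
    calc v * _ ≤ (growth Λ T₁ * κ) * (growth Λ T₁ * κ * T₁ ^ 2) :=
          mul_le_mul hv hz2 hz0 (by positivity)
      _ = _ := by ring
  have b1 := (abs_le.1 (bound cs1 e1)).1
  have b2 := (abs_le.1 (bound cs2 (hV.trans (le_mul_of_one_le_left hκ0 hG1)))).2
  have hzΛ := mul_le_mul_of_nonneg_left hz2 (show 0 ≤ 4 * Λ by positivity)
  have hDle : dissipation p L (U.a t) (fun s => du₀ s + dphi L η) ≤ κ * dissipationConst Λ T₁ := by
    rw [dissipationConst]
    linarith
  -- Here `κ ≤ 1` makes the bound independent of `κ`, so the length `ℓ` can be fixed before `κ`.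
  have hN : ∫ s, U.drift t s ^ 2 ∂(mu L) ≤ driftConst L Λ T₁ := by
    rw [driftConst]
    have := mul_le_mul_of_nonneg_left hκ1 (show 0 ≤ growth Λ T₁ by linarith)
    linarith
  exact ae_le_rpow_of_dissipation_lt hp hL hm hℓ hℓL hℓN m2 h₀.memLp_deriv hbm md hc hN
    (hDle.trans_lt hκ)

end WeakSolution

/-! ### Uniform bound on the existence time and choice of the threshold -/

/-- A lower bound on the energy turns `maxTime`, which depends on the datum, into a bound depending
only on `p`, `L` and `η`. -/
lemma le_cStar_of_nondegenerate {p L : ℝ} (hp : 2 ≤ p) (hL : 0 < L) {η : ℕ} {m : ℝ}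
    (hm : 0 ≤ m) {du₀ : ℝ → ℝ} (hdu : Continuous du₀)
    (hbm : ∀ᵐ s ∂(mu L), m ≤ |du₀ s + dphi L η| ^ (p - 1)) :
    2 * L * m ^ (p / (p - 1)) ≤ cStar p L η du₀ := by
  have hp1 : 0 < p - 1 := by linarith
  have hi := integrable_abs_rpow hp (Continuous.memLp_mu (hdu.add (continuous_const
    (y := dphi L η))) (ENNReal.ofReal p) L)
  have h : ∫ _, m ^ (p / (p - 1)) ∂(mu L) ≤ ∫ s, |du₀ s + dphi L η| ^ p ∂(mu L) := by
    refine integral_mono_ae (integrable_const _) hi ?_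
    filter_upwards [hbm] with s hs
    have := Real.rpow_le_rpow hm hs (show 0 ≤ p / (p - 1) by positivity)
    rwa [← Real.rpow_mul (abs_nonneg _), mul_div_cancel₀ _ hp1.ne'] at this
  rw [integral_const, mu_real_univ hL.le, smul_eq_mul] at h
  rw [cStar, intervalIntegral_eq_mu hL.le]
  linarith

/-- Keeping only the summand `4 / L ^ 2` gives `c₁ ≥ 32 * c_* / L`; inserted into the quotient this
leaves `L / (8192 * p * c_*)`, with `8192 = 8 * 32 ^ 2`. -/
lemma maxTime_le {p L c : ℝ} (hp : 2 ≤ p) (hL : 0 < L) {η : ℕ} {du₀ : ℝ → ℝ} (hc : 0 < c)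
    (h : c ≤ cStar p L η du₀) : maxTime p L η du₀ ≤ L / (8192 * p * c) := by
  have hC : 0 < cStar p L η du₀ := hc.trans_le h
  have hone : 32 * cStar p L η du₀ / L ≤ cOne p L η du₀ := by
    have : 0 ≤ (8 * cStar p L η du₀ / Real.pi) ^ (2 * p / (p - 1)) :=
      Real.rpow_nonneg (by positivity) _
    have h2 := mul_le_mul_of_nonneg_left (le_add_of_nonneg_right (a := 4 / L ^ 2) this)
      (show 0 ≤ 8 * L * cStar p L η du₀ by positivity)
    rw [cOne]
    refine le_trans (le_of_eq ?_) h2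
    field_simp
    ring
  have hp0 : 0 < p := by linarith
  rw [maxTime]
  calc cStar p L η du₀ / (8 * p * L * cOne p L η du₀ ^ 2)
      ≤ cStar p L η du₀ / (8 * p * L * (32 * cStar p L η du₀ / L) ^ 2) := by gcongr
    _ = L / (8192 * p * cStar p L η du₀) := by
        field_simp
        norm_num
    _ ≤ L / (8192 * p * c) := by gcongr

/-- The case `p > 2`, for small data. -/
theorem exists_stability_of_two_le {L : ℝ} (hL : 0 < L) {η : ℕ} (hη : 1 ≤ η) {p : ℝ}
    (hp : 2 ≤ p) : ∃ κ : ℝ, 0 < κ ∧ ∀ T : ℝ, 0 < T → ∃ C : ℝ, 0 < C ∧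
      ∀ u₀ du₀ ddu₀ w₀ dw₀ ddw₀ : ℝ → ℝ,
        MemW2Per 2 L u₀ du₀ ddu₀ → MemW2Per 2 L w₀ dw₀ ddw₀ →
        SmallDatum p L η κ u₀ du₀ → SmallDatum p L η κ w₀ dw₀ →
        T ≤ maxTime p L η du₀ → T ≤ maxTime p L η dw₀ →
        ∀ (U : WeakSolution p L η T u₀) (W : WeakSolution p L η T w₀),
          StabilityEstimate C U W ∧ (u₀ = w₀ → Coincide U W) := by
  have hp0 : 0 < p := by linarith
  have hdphi : 0 < |dphi L η| := by
    have : (0 : ℝ) < η := by exact_mod_cast hη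
    have : 0 < dphi L η := by
      have := Real.pi_pos
      rw [dphi]; positivity
    exact abs_pos.2 this.ne'
  set m := |dphi L η| ^ (p - 1) with hmdef
  have hm : 0 < m := Real.rpow_pos_of_pos hdphi _
  -- `c_*` is twice the energy, so the bound by `4` in the smallness condition becomes a bound by
  -- `2`.
  set M := 2 * (L * |dphi L η| ^ p) with hMdef
  have hM : 0 ≤ M := by positivity
  set Λ := lamBound L M
  have hΛ : 0 ≤ Λ := lamBound_nonneg hL.le hM
  set c := 2 * L * (m / 2) ^ (p / (p - 1)) with hcdef
  have hc : 0 < c := by positivity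
  -- `T₁` exceeds every admissible time, so `ℓ` and `κ` below can be chosen independently of `T`.
  set T₁ := L / (8192 * p * c) with hT₁def
  have hT₁ : 0 < T₁ := by positivity
  have hN : 0 < driftConst L Λ T₁ := by
    have := one_le_growth hΛ hT₁.le
    rw [driftConst]; positivity
  -- Over a length `ℓ` the flux varies by at most `m / 8`.
  set ℓ := min (L / 2) ((m / 8) ^ 2 / driftConst L Λ T₁) with hℓdef
  have hℓ : 0 < ℓ := lt_min (by positivity) (by positivity)
  have hℓN : ℓ * driftConst L Λ T₁ ≤ (m / 8) ^ 2 := by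
    rw [← le_div_iff₀ hN]; exact min_le_right _ _
  have hgap := levelGap_pos hp hm
  have hQ : 0 ≤ dissipationConst Λ T₁ := by
    have := one_le_growth hΛ hT₁.le
    rw [dissipationConst]; positivity
  set R := m / 8 * levelGap p m * ℓ with hR
  have hR0 : 0 < R := by positivity
  -- `R` is the dissipation that a loss of nondegeneracy would cost. The added `1` makes the
  -- comparison with `R` strict.
  set κ := min 1 (R / (dissipationConst Λ T₁ + 1)) with hκdef
  have hκ0 : 0 < κ := lt_min one_pos (by positivity)
  have hκR : κ * dissipationConst Λ T₁ < R := by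
    have h1 : κ * (dissipationConst Λ T₁ + 1) ≤ R := by
      rw [← le_div_iff₀ (by linarith)]; exact min_le_right _ _
    linarith
  set C₀ := ((m / 4) ^ ((p - 2) / (p - 1)))⁻¹ with hC₀def
  have hC₀ : 0 ≤ C₀ := by positivity
  have main : ∀ {T : ℝ}, 0 < T → ∀ {u₀ du₀ ddu₀ : ℝ → ℝ}, MemW2Per 2 L u₀ du₀ ddu₀ →
      SmallDatum p L η κ u₀ du₀ → T ≤ maxTime p L η du₀ → ∀ U : WeakSolution p L η T u₀,
      (∀ᵐ t ∂(mu T), U.energy t ≤ M) ∧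
        ∀ᵐ t ∂(mu T), ∀ᵐ s ∂(mu L), m / 4 ≤ |U.a t s| ^ (p - 1) := by
    intro T hT u₀ du₀ ddu₀ h2 hs hTm U
    have hE : ∫ s, |du₀ s + dphi L η| ^ p ∂(mu L) ≤ M := by
      have := hs.energy
      rw [cStar, intervalIntegral_eq_mu hL.le, intervalIntegral.integral_const, smul_eq_mul,
        sub_zero] at this
      linarith
    have hbm : ∀ᵐ s ∂(mu L), m / 2 ≤ |du₀ s + dphi L η| ^ (p - 1) := by
      filter_upwards [hs.nondegenerate] with s hs
      linarith
    obtain ⟨V, hV, hVκ⟩ := hs.regularDatum hp hL hη h2 hE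
    have hen : ∀ᵐ t ∂(mu T), U.energy t ≤ M := by
      filter_upwards [U.ae_energy_le hp hT hL hη hV.memW1Per] with t ht using ht.trans hE
    have hTT : T ≤ T₁ := hTm.trans (maxTime_le hp hL hc
      (le_cStar_of_nondegenerate hp hL (by positivity) h2.2.continuous hbm))
    exact ⟨hen, U.ae_le_rpow_of_regularDatum hp hT hL hΛ
      (U.ae_abs_lam_le_of_energy_le hp hT hL hη hen) hV hm hbm hTT (min_le_left _ _) hVκ hℓ
      (min_le_left _ _) hℓN hκR⟩
  refine ⟨κ, hκ0, fun T hT => ⟨stabilityConst p L T M C₀, stabilityConst_pos hL hT hM hC₀,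
    fun u₀ du₀ ddu₀ w₀ dw₀ ddw₀ hu hw hsu hsw hTu hTw U W => ?_⟩⟩
  obtain ⟨eU, nU⟩ := main hT hu hsu hTu U
  obtain ⟨eW, nW⟩ := main hT hw hsw hTw W
  have hst := stabilityEstimate_of_le_dissipation U W hp hT hL hη hM hC₀ eU eW (by
    filter_upwards [nU, nW, U.ae_memLp_a, W.ae_memLp_a] with t h1 h2 m1 m2
    exact integral_sq_sub_le_dissipation hp (by positivity) m1 m2 h1 h2)
  exact ⟨hst, hst.coincide hT hL⟩

end PElastic

theorem lemma3p20 (L : ℝ) (hL : 0 < L) (η : ℕ) (hη : 1 ≤ η) :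
    -- the case `p = 2`
    (∀ T : ℝ, 0 < T → ∀ M : ℝ, ∃ C : ℝ, 0 < C ∧
      ∀ u₀ du₀ w₀ dw₀ : ℝ → ℝ,
        PElastic.MemW1Per 2 L u₀ du₀ → PElastic.MemW1Per 2 L w₀ dw₀ →
        PElastic.cStar 2 L η du₀ ≤ M → PElastic.cStar 2 L η dw₀ ≤ M →
        ∀ (U : PElastic.WeakSolution 2 L η T u₀) (W : PElastic.WeakSolution 2 L η T w₀),
          PElastic.StabilityEstimate C U W ∧ (u₀ = w₀ → PElastic.Coincide U W)) ∧
    -- the case `p > 2` with small data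
    (∀ p : ℝ, 2 < p → ∃ κ : ℝ, 0 < κ ∧ ∀ T : ℝ, 0 < T → ∃ C : ℝ, 0 < C ∧
      ∀ u₀ du₀ ddu₀ w₀ dw₀ ddw₀ : ℝ → ℝ,
        PElastic.MemW2Per 2 L u₀ du₀ ddu₀ → PElastic.MemW2Per 2 L w₀ dw₀ ddw₀ →
        PElastic.SmallDatum p L η κ u₀ du₀ → PElastic.SmallDatum p L η κ w₀ dw₀ →
        T ≤ PElastic.maxTime p L η du₀ → T ≤ PElastic.maxTime p L η dw₀ →
        ∀ (U : PElastic.WeakSolution p L η T u₀) (W : PElastic.WeakSolution p L η T w₀),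
          PElastic.StabilityEstimate C U W ∧ (u₀ = w₀ → PElastic.Coincide U W)) := by
  exact ⟨fun T hT M => PElastic.exists_stability_two hL hη hT M,
    fun p hp => PElastic.exists_stability_of_two_le hL hη hp.le⟩
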